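/- Let $n\ge 0$, let $p>1$, and let $V:\mathbb R^n\to\mathbb R$ be an even, strictly convex function that is $p$-homogeneous ($V(rx)=r^pV(x)$ for $r>0$) and of class $C^2$ on $\mathbb R^n\setminus\{0\}$ (in particular, this covers $V\in C^2(\mathbb R^n)$). Assume that $V$ is unconditional, i.e. $V(\pm x_1,\dots,\pm x_n)=V(x_1,\dots,x_n)$ for every choice of signs, and that the function $$x=(x_1,\dots,x_n)\mapsto V\bigl(x_1^{1/p},\dots,x_n^{1/p}\bigr)$$ is concave on $\mathbb R^n_+=\{x: x_i\ge 0\ \text{for all } i\}$. Then $\int e^{-V}dx$ is positive and finite, so that $d\mu=\frac{e^{-V}dx}{\int e^{-V}dx}$ is a probability measure, and the inequality $$\operatorname{Var}_\mu f\le\Bigl(1-\frac1p\Bigr)\int_{\mathbb R^n}\bigl\langle (D^2V)^{-1}\nabla f,\nabla f\bigr\rangle\,d\mu \qquad (*)$$ holds for every unconditional $f\in C^1(\mathbb R^n)$. Let $V^*(y)=\sup_x(\langle x,y\rangle-V(x))$ be the Legendre transform of $V$. Assume, in addition, that for every coordinate hyperplane $H$ with unit normal $e$ and for every $x'\in H$,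 the function $t\mapsto\det D^2V^*(x'+te)$ is decreasing (non-increasing) on $[0,+\infty)$, where $\det D^2V^*$ is given the value $+\infty$ at the points where $V^*$ is not twice differentiable. Then $(*)$ holds for every even $f\in C^1(\mathbb R^n)$. Here $(*)$ is an inequality in $[0,+\infty]$: its left side is $+\infty$ if $f\notin L^2(\mu)$, and at points where $D^2V(x)$ is not invertible, $\langle (D^2V(x))^{-1}\xi,\xi\rangle$ means $\langle\eta,\xi\rangle$ for any $\eta$ with $D^2V(x)\eta=\xi$, and $+\infty$ if there is no such $\eta$. -/

import Mathlib

open MeasureTheory ProbabilityTheory Set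
open scoped ENNReal RealInnerProductSpace

noncomputable section

namespace StrongBL

/-- `ℝⁿ` with its Euclidean structure. -/
abbrev Rn (n : ℕ) : Type := EuclideanSpace ℝ (Fin n)

/-- `f` is unconditional: `f (±x₁, …, ±xₙ) = f (x₁, …, xₙ)` for every choice of the signs. -/
def IsUnconditional {n : ℕ} (f : Rn n → ℝ) : Prop :=
  ∀ s : Fin n → ℝ, (∀ i, s i = 1 ∨ s i = -1) →
    ∀ x : Rn n, f (WithLp.toLp 2 fun i => s i * x i) = f x

/-- `V` is (positively) `p`-homogeneous. -/
def IsHomogeneousOfDegree {n : ℕ} (p : ℝ) (V : Rn n → ℝ) : Prop :=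
  ∀ r : ℝ, 0 < r → ∀ x : Rn n, V (r • x) = r ^ p * V x

/-- The closed orthant `ℝⁿ₊ = {x | xᵢ ≥ 0 for all i}`. -/
def orthant (n : ℕ) : Set (Rn n) := {x | ∀ i, 0 ≤ x i}

/-- The coordinatewise power `x ↦ (x₁ ^ s, …, xₙ ^ s)`, used on the closed orthant. -/
def coordPow {n : ℕ} (s : ℝ) (x : Rn n) : Rn n := WithLp.toLp 2 fun i => x i ^ s

/-- The Hessian `D²V(x)`, as the derivative of the gradient field of `V`. -/
def hess {n : ℕ} (V : Rn n → ℝ) (x : Rn n) : Rn n →L[ℝ] Rn n := fderiv ℝ (gradient V) x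

/-- The Legendre transform `V*(y) = sup_x (⟨x, y⟩ - V x)`. It is used only for functions `V` of
superlinear growth, for which the supremum is finite. -/
def legendre {n : ℕ} (V : Rn n → ℝ) (y : Rn n) : ℝ := ⨆ x : Rn n, (⟪x, y⟫ - V x)

open Classical in
/-- `det D²U(y)` for a differentiable convex function `U`, as an extended nonnegative number:
it is `+∞` at the points where `U` is not twice differentiable. -/
def detHess {n : ℕ} (U : Rn n → ℝ) (y : Rn n) : ℝ≥0∞ :=
  if DifferentiableAt ℝ (gradient U) y then ENNReal.ofReal (hess U y).det else ⊤

/-- The quadratic form `⟨A⁻¹ ξ, ξ⟩` of the inverse of a symmetric positive semidefinite operator: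
the value `⟨η, ξ⟩` at a solution `η` of `A η = ξ` (it does not depend on the solution), and `+∞`
if there is no solution. For invertible `A` this is literally `⟨A⁻¹ ξ, ξ⟩`, see
`invForm_of_equiv`. -/
def invForm {n : ℕ} (A : Rn n →L[ℝ] Rn n) (ξ : Rn n) : ℝ≥0∞ :=
  ⨅ (η : Rn n) (_ : A η = ξ), ENNReal.ofReal ⟪η, ξ⟫

theorem invForm_of_equiv {n : ℕ} (A : Rn n ≃L[ℝ] Rn n) (ξ : Rn n) :
    invForm (A : Rn n →L[ℝ] Rn n) ξ = ENNReal.ofReal ⟪A.symm ξ, ξ⟫ := by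
  apply le_antisymm
  · exact iInf₂_le (A.symm ξ) (by simp)
  · refine le_iInf₂ fun η hη => ?_
    have h : η = A.symm ξ := by rw [← hη]; simp
    rw [h]

/-- The measure `dμ = e^{-V} dx / ∫ e^{-V} dx`. -/
def gibbs {n : ℕ} (V : Rn n → ℝ) : Measure (Rn n) :=
  (∫⁻ x : Rn n, ENNReal.ofReal (Real.exp (-V x)))⁻¹ •
    (volume : Measure (Rn n)).withDensity fun x => ENNReal.ofReal (Real.exp (-V x))

/-- `Var_μ f ≤ (1 - 1/p) ∫ ⟨(D²V)⁻¹ ∇f, ∇f⟩ dμ` for `μ = e^{-V} dx / ∫ e^{-V} dx`, as an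
inequality in `[0, ∞]`; the variance is `+∞` if `f` is not square integrable. -/
def StrongBrascampLieb {n : ℕ} (p : ℝ) (V f : Rn n → ℝ) : Prop :=
  evariance f (gibbs V) ≤
    ENNReal.ofReal (1 - 1 / p) * ∫⁻ x, invForm (hess V x) (gradient f x) ∂(gibbs V)

end StrongBL

end

noncomputable section

namespace StrongBL

open Filter Topology

/-! The engine is the Brascamp–Lieb inequality `Var f ≤ ∫ ⟨(D²W)⁻¹∇f, ∇f⟩` for a density `e^{-W}`
with `W` convex. It is proved on segments, carried to cubes by induction on the dimension
(`BrascampLiebFor.prod`) and to `ℝⁿ` by exhaustion (`exists_const_brascampLieb`). The factor `1 -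
1/p` comes from applying it in suitable coordinates.

Unconditional `f` (`exists_const_of_unconditional`). By symmetry only the open orthant matters.
Under `x = e^t` the density becomes `e^{-W}` with `W(t) = V(e^t) - ∑ tᵢ`, and for `vᵢ = xᵢuᵢ` one
has `⟨D²W u, u⟩ = ⟨D²V v, v⟩ + ∑ ∂ᵢV vᵢ²/xᵢ`. Differentiating the concave function `V(x^{1/p})`
twice shows that the last sum is at least `⟨D²V v, v⟩/(p-1)` (`hess_le`). Hence `D²W` dominates
`p/(p-1)` times the transported `D²V`, and its inverse form is at most `1 - 1/p` times the inverse
form of `D²V`.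

Even `f` (`exists_const_of_even`). Split `f` into even and odd parts under each coordinate
reflection; the cross terms vanish in the second moment and in the energy (`exists_const_of_parts`).
A component that is not unconditional is odd in at least two coordinates `i ≠ j`, because it is even
under `x ↦ -x`, so it vanishes on both hyperplanes. Two one-dimensional estimates are available for
it. Along lines parallel to `e_j`: `∫ f² dμ ≤ ∫ ⟨∇f, e_j⟩²/⟨D²V e_j, e_j⟩ dμ`
(`lintegral_sq_le_primal`). In the dual variable `z = ∇V(x)`, where `V = V*/(p-1)` and the Jacobian
`det D²V*` decreases along `e_i`: `∫ f² dμ ≤ (p-1) ∫ ⟨∇f, (D²V)⁻¹e_i⟩²/⟨(D²V)⁻¹e_i, e_i⟩ dμ`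
(`lintegral_sq_le_dual`). The vectors `e_j` and `(D²V)⁻¹e_i` are orthogonal for `D²V`, so the two
integrands add up to at most `⟨(D²V)⁻¹∇f, ∇f⟩` (`inverse_form_ge`). Averaging the estimates with
weights `1 - 1/p` and `1/p` gives the constant. The determinant hypothesis also forces `D²V` to be
nondegenerate off the coordinate hyperplanes, by a Sard argument (`hess_pos_of_antitone`). -/

/-! ### One-dimensional inequality on an interval -/

theorem setLIntegral_Ioo_le_of_forall {s b : ℝ} (f : ℝ → ℝ≥0∞) (C : ℝ≥0∞)
    (h : ∀ y ∈ Ioo s b, ∫⁻ x in Ioo s y, f x ≤ C) : ∫⁻ x in Ioo s b, f x ≤ C := by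
  rcases le_or_gt b s with hbs | hsb
  · simp [Ioo_eq_empty (not_lt.mpr hbs)]
  obtain ⟨u, hu, hub, hlim⟩ := exists_seq_strictMono_tendsto' hsb
  have hU : Ioo s b = ⋃ n, Ioo s (u n) := by
    ext x
    simp only [mem_iUnion, mem_Ioo]
    constructor
    · rintro ⟨h1, h2⟩
      obtain ⟨n, hn⟩ := (hlim.eventually (lt_mem_nhds h2)).exists
      exact ⟨n, h1, hn⟩
    · rintro ⟨n, h1, h2⟩
      exact ⟨h1, h2.trans (hub n).2⟩
  rw [hU, setLIntegral_iUnion_of_directed]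
  · exact iSup_le fun n => h _ (hub n)
  · exact (monotone_nat_of_le_succ fun n =>
      Ioo_subset_Ioo_right (hu (Nat.lt_succ_self n)).le).directed_le

theorem setLIntegral_Ioi_le_of_forall {s : ℝ} (f : ℝ → ℝ≥0∞) (C : ℝ≥0∞)
    (h : ∀ y, s < y → ∫⁻ x in Ioo s y, f x ≤ C) : ∫⁻ x in Ioi s, f x ≤ C := by
  have hU : Ioi s = ⋃ n : ℕ, Ioo s (s + n + 1) := by
    ext x
    simp only [mem_iUnion, mem_Ioo, mem_Ioi]
    constructor
    · intro h1
      obtain ⟨n, hn⟩ := exists_nat_gt (x - s)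
      exact ⟨n, h1, by linarith⟩
    · rintro ⟨n, h1, h2⟩
      exact h1
  rw [hU, setLIntegral_iUnion_of_directed]
  · exact iSup_le fun n => h _ (by linarith [(n.cast_nonneg : (0 : ℝ) ≤ n)])
  · exact (monotone_nat_of_le_succ fun n =>
      Ioo_subset_Ioo_right (by push_cast; linarith)).directed_le

/-- The integrand is the derivative of `-e^{-ψ}`. Only an inequality is kept, so nothing need be
known at the right end. -/
theorem setLIntegral_deriv_mul_exp_neg_le {s b : ℝ} {ψ ψ1 : ℝ → ℝ}
    (hψ : ∀ t ∈ Ico s b, HasDerivAt ψ (ψ1 t) t) (hc : ContinuousOn ψ1 (Ico s b))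
    (hpos : ∀ t ∈ Ico s b, 0 ≤ ψ1 t) :
    ∫⁻ x in Ioo s b, ENNReal.ofReal (ψ1 x * Real.exp (-ψ x)) ≤
      ENNReal.ofReal (Real.exp (-ψ s)) := by
  refine setLIntegral_Ioo_le_of_forall _ _ fun y hy => ?_
  have hsub : Icc s y ⊆ Ico s b := fun t ht => ⟨ht.1, ht.2.trans_lt hy.2⟩
  have hcψ : ContinuousOn ψ (Icc s y) := fun t ht =>
    (hψ t (hsub ht)).continuousAt.continuousWithinAt
  have hcont : ContinuousOn (fun x => ψ1 x * Real.exp (-ψ x)) (Icc s y) :=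
    (hc.mono hsub).mul (Real.continuous_exp.comp_continuousOn hcψ.neg)
  have hint : ∫ x in s..y, ψ1 x * Real.exp (-ψ x) = Real.exp (-ψ s) - Real.exp (-ψ y) := by
    rw [intervalIntegral.integral_eq_sub_of_hasDerivAt (f := fun x => -Real.exp (-ψ x))]
    · ring
    · intro x hx
      rw [uIcc_of_le hy.1.le] at hx
      exact ((hψ x (hsub hx)).neg.exp.neg).congr_deriv (by rw [Pi.neg_apply]; ring)
    · exact (uIcc_of_le hy.1.le ▸ hcont).intervalIntegrable
  have hle : ∫⁻ x in Ioo s y, ENNReal.ofReal (ψ1 x * Real.exp (-ψ x)) ≤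
      ∫⁻ x in Ioc s y, ENNReal.ofReal (ψ1 x * Real.exp (-ψ x)) :=
    lintegral_mono_set Ioo_subset_Ioc_self
  refine hle.trans ?_
  rw [← ofReal_integral_eq_lintegral_ofReal, ← intervalIntegral.integral_of_le hy.1.le, hint]
  · exact ENNReal.ofReal_le_ofReal (by linarith [Real.exp_pos (-ψ y)])
  · exact (hcont.integrableOn_compact isCompact_Icc).mono_set Ioc_subset_Icc_self
  · refine (ae_restrict_mem measurableSet_Ioc).mono fun x hx => ?_
    exact mul_nonneg (hpos x (hsub (Ioc_subset_Icc_self hx))) (Real.exp_pos _).le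

/-- A pointwise Cauchy–Schwarz bound for primitives. -/
theorem sq_sub_le_integral_mul {s x : ℝ} (hsx : s ≤ x) {h h1 ψ1 ψ2 q : ℝ → ℝ}
    (hh : ∀ t ∈ Icc s x, HasDerivAt h (h1 t) t) (hψ : ∀ t ∈ Icc s x, HasDerivAt ψ1 (ψ2 t) t)
    (ch : ContinuousOn h1 (Icc s x)) (cψ : ContinuousOn ψ2 (Icc s x))
    (cq : ContinuousOn q (Icc s x))
    (hq : ∀ t ∈ Icc s x, ∀ l : ℝ, 2 * l * h1 t - l ^ 2 * ψ2 t ≤ q t) :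
    (h x - h s) ^ 2 ≤ (∫ t in s..x, q t) * (ψ1 x - ψ1 s) := by
  -- Integrate the pointwise majorant; the bound for all `l` then makes a discriminant nonpositive.
  have key : ∀ l : ℝ, 2 * l * (h x - h s) - l ^ 2 * (ψ1 x - ψ1 s) ≤ ∫ t in s..x, q t := by
    intro l
    have e : ∫ t in s..x, (2 * l * h1 t - l ^ 2 * ψ2 t)
        = (2 * l * h x - l ^ 2 * ψ1 x) - (2 * l * h s - l ^ 2 * ψ1 s) := by
      refine intervalIntegral.integral_eq_sub_of_hasDerivAt
        (f := fun t => 2 * l * h t - l ^ 2 * ψ1 t) (fun t ht => ?_) ?_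
      · rw [uIcc_of_le hsx] at ht
        exact ((hh t ht).const_mul _).sub ((hψ t ht).const_mul _)
      · refine ContinuousOn.intervalIntegrable ?_
        rw [uIcc_of_le hsx]
        fun_prop
    have := intervalIntegral.integral_mono_on (μ := volume)
      (f := fun t => 2 * l * h1 t - l ^ 2 * ψ2 t) (g := q) hsx ?_ ?_ (fun t ht => hq t ht l)
    · rw [e] at this; linarith
    · refine ContinuousOn.intervalIntegrable ?_
      rw [uIcc_of_le hsx]
      fun_prop
    · refine ContinuousOn.intervalIntegrable ?_
      rwa [uIcc_of_le hsx]
  have := discrim_le_zero (a := ψ1 x - ψ1 s) (b := -2 * (h x - h s)) (c := ∫ t in s..x, q t)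
    (fun l => by linarith [key l])
  rw [discrim] at this
  nlinarith

/-- The one-dimensional Brascamp–Lieb inequality on an interval, for a function vanishing at the
left end point and a potential that increases. -/
theorem brascampLieb_Ioo_of_tendsto_zero {a b : ℝ} {h h1 ψ ψ1 ψ2 q : ℝ → ℝ}
    (h0 : Tendsto h (𝓝[>] a) (𝓝 0))
    (hh : ∀ t ∈ Ioo a b, HasDerivAt h (h1 t) t) (hψ : ∀ t ∈ Ioo a b, HasDerivAt ψ (ψ1 t) t)
    (hψ1 : ∀ t ∈ Ioo a b, HasDerivAt ψ1 (ψ2 t) t)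
    (ch : ContinuousOn h1 (Ioo a b)) (cψ : ContinuousOn ψ2 (Ioo a b))
    (cq : ContinuousOn q (Ioo a b)) (hpos : ∀ t ∈ Ioo a b, 0 ≤ ψ1 t)
    (hq : ∀ t ∈ Ioo a b, ∀ l : ℝ, 2 * l * h1 t - l ^ 2 * ψ2 t ≤ q t) :
    ∫⁻ t in Ioo a b, ENNReal.ofReal (h t ^ 2 * Real.exp (-ψ t)) ≤
      ∫⁻ t in Ioo a b, ENNReal.ofReal (q t * Real.exp (-ψ t)) := by
  have q0 : ∀ t ∈ Ioo a b, 0 ≤ q t := fun t ht => by simpa using hq t ht 0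
  have cψ0 : ContinuousOn ψ (Ioo a b) := fun t ht => (hψ t ht).continuousAt.continuousWithinAt
  have cψ1 : ContinuousOn ψ1 (Ioo a b) := fun t ht => (hψ1 t ht).continuousAt.continuousWithinAt
  -- Let `s` decrease to `a`, where `h` tends to `0`; the term `-ψ1 s` is dropped because `ψ1` is
  -- nonnegative.
  have bound : ∀ x ∈ Ioo a b, ENNReal.ofReal (h x ^ 2) ≤
      (∫⁻ s in Ioo a x, ENNReal.ofReal (q s)) * ENNReal.ofReal (ψ1 x) := by
    intro x hx
    have hl : Tendsto (fun s => ENNReal.ofReal ((h x - h s) ^ 2)) (𝓝[>] a)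
        (𝓝 (ENNReal.ofReal (h x ^ 2))) := by
      have : Tendsto (fun s => (h x - h s) ^ 2) (𝓝[>] a) (𝓝 ((h x - 0) ^ 2)) :=
        (tendsto_const_nhds.sub h0).pow 2
      rw [sub_zero] at this
      exact (ENNReal.continuous_ofReal.tendsto _).comp this
    refine le_of_tendsto hl ?_
    filter_upwards [Ioo_mem_nhdsGT hx.1] with s hs
    have hsub : Icc s x ⊆ Ioo a b := fun t ht => ⟨hs.1.trans_le ht.1, ht.2.trans_lt hx.2⟩
    have h3 := sq_sub_le_integral_mul hs.2.le (fun t ht => hh t (hsub ht))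
      (fun t ht => hψ1 t (hsub ht)) (ch.mono hsub) (cψ.mono hsub) (cq.mono hsub)
      (fun t ht => hq t (hsub ht))
    have hI : 0 ≤ ∫ t in s..x, q t :=
      intervalIntegral.integral_nonneg hs.2.le fun t ht => q0 t (hsub ht)
    have h4 : (h x - h s) ^ 2 ≤ (∫ t in s..x, q t) * ψ1 x :=
      h3.trans (mul_le_mul_of_nonneg_left
        (by linarith [hpos s ⟨hs.1, hs.2.trans hx.2⟩]) hI)
    refine (ENNReal.ofReal_le_ofReal h4).trans ?_
    rw [ENNReal.ofReal_mul hI]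
    gcongr
    rw [intervalIntegral.integral_of_le hs.2.le, integral_Ioc_eq_integral_Ioo,
      ofReal_integral_eq_lintegral_ofReal]
    · exact lintegral_mono_set (Ioo_subset_Ioo_left hs.1.le)
    · exact ((cq.mono hsub).integrableOn_compact isCompact_Icc).mono_set Ioo_subset_Icc_self
    · refine (ae_restrict_mem measurableSet_Ioo).mono fun t ht => ?_
      exact q0 t (hsub (Ioo_subset_Icc_self ht))
  set Q : ℝ → ℝ≥0∞ := (Ioo a b).indicator fun s => ENNReal.ofReal (q s) with hQ
  set G : ℝ → ℝ≥0∞ := (Ioo a b).indicator fun x => ENNReal.ofReal (ψ1 x * Real.exp (-ψ x))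
    with hG
  have mQ : AEMeasurable Q volume := by
    rw [hQ, aemeasurable_indicator_iff measurableSet_Ioo]
    exact (cq.aemeasurable measurableSet_Ioo).ennreal_ofReal
  have mG : AEMeasurable G volume := by
    rw [hG, aemeasurable_indicator_iff measurableSet_Ioo]
    exact ((cψ1.mul (Real.continuous_exp.comp_continuousOn cψ0.neg)).aemeasurable
      measurableSet_Ioo).ennreal_ofReal
  -- Tonelli on the triangle `s < x`: after the exchange the inner integral of `ψ1 e^{-ψ}` over `x >
  -- s` is at most `e^{-ψ s}`.
  have mT : MeasurableSet {z : ℝ × ℝ | z.2 < z.1} := measurableSet_lt measurable_snd measurable_fst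
  calc ∫⁻ t in Ioo a b, ENNReal.ofReal (h t ^ 2 * Real.exp (-ψ t))
      ≤ ∫⁻ x, ∫⁻ s, {z : ℝ × ℝ | z.2 < z.1}.indicator (fun z => Q z.2 * G z.1) (x, s) := by
        rw [← lintegral_indicator measurableSet_Ioo]
        refine lintegral_mono fun x => ?_
        by_cases hx : x ∈ Ioo a b
        · rw [indicator_of_mem hx]
          have e : ∀ s, {z : ℝ × ℝ | z.2 < z.1}.indicator (fun z => Q z.2 * G z.1) (x, s)
              = (Ioo a x).indicator (fun s => ENNReal.ofReal (q s)) s * G x := by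
            intro s
            by_cases hs : s < x
            · rw [indicator_of_mem (by exact hs)]
              simp only [hQ]
              congr 1
              by_cases hsa : a < s
              · rw [indicator_of_mem (show s ∈ Ioo a b from ⟨hsa, hs.trans hx.2⟩),
                  indicator_of_mem (show s ∈ Ioo a x from ⟨hsa, hs⟩)]
              · rw [indicator_of_notMem (fun h => hsa h.1), indicator_of_notMem (fun h => hsa h.1)]
            · rw [indicator_of_notMem (by exact hs), indicator_of_notMem (fun h => hs h.2), zero_mul]
          simp_rw [e]
          rw [lintegral_mul_const'' _ ?_, lintegral_indicator measurableSet_Ioo, hG,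
            indicator_of_mem hx, ENNReal.ofReal_mul (hpos x hx), ENNReal.ofReal_mul (sq_nonneg _),
            ← mul_assoc]
          · gcongr
            exact bound x hx
          · rw [aemeasurable_indicator_iff measurableSet_Ioo]
            exact ((cq.mono (Ioo_subset_Ioo_right hx.2.le)).aemeasurable
              measurableSet_Ioo).ennreal_ofReal
        · rw [indicator_of_notMem hx]; exact zero_le
    _ = ∫⁻ s, ∫⁻ x, {z : ℝ × ℝ | z.2 < z.1}.indicator (fun z => Q z.2 * G z.1) (x, s) := by
        refine lintegral_lintegral_swap ?_
        exact ((mQ.comp_snd).mul (mG.comp_fst)).indicator mT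
    _ ≤ ∫⁻ t in Ioo a b, ENNReal.ofReal (q t * Real.exp (-ψ t)) := by
        rw [← lintegral_indicator measurableSet_Ioo]
        refine lintegral_mono fun s => ?_
        by_cases hs : s ∈ Ioo a b
        · rw [indicator_of_mem hs]
          have e : ∀ x, {z : ℝ × ℝ | z.2 < z.1}.indicator (fun z => Q z.2 * G z.1) (x, s)
              = Q s * (Ioo s b).indicator
                (fun x => ENNReal.ofReal (ψ1 x * Real.exp (-ψ x))) x := by
            intro x
            by_cases hx : s < x
            · rw [indicator_of_mem (by exact hx)]
              simp only [hG]
              congr 1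
              by_cases hxb : x < b
              · rw [indicator_of_mem (show x ∈ Ioo a b from ⟨hs.1.trans hx, hxb⟩),
                  indicator_of_mem (show x ∈ Ioo s b from ⟨hx, hxb⟩)]
              · rw [indicator_of_notMem (fun h => hxb h.2), indicator_of_notMem (fun h => hxb h.2)]
            · rw [indicator_of_notMem (by exact hx), indicator_of_notMem (fun h => hx h.1), mul_zero]
          simp_rw [e]
          have hQs : Q s = ENNReal.ofReal (q s) := indicator_of_mem hs _
          rw [lintegral_const_mul' _ _ (by rw [hQs]; exact ENNReal.ofReal_ne_top),
            lintegral_indicator measurableSet_Ioo, hQs, ENNReal.ofReal_mul (q0 s hs)]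
          gcongr
          have hsub : Ico s b ⊆ Ioo a b := fun t ht => ⟨hs.1.trans_le ht.1, ht.2⟩
          exact setLIntegral_deriv_mul_exp_neg_le (fun t ht => hψ t (hsub ht)) (cψ1.mono hsub)
            (fun t ht => hpos t (hsub ht))
        · rw [indicator_of_notMem hs]
          have hQs : Q s = 0 := indicator_of_notMem hs _
          refine le_of_eq ?_
          rw [lintegral_eq_zero_of_ae_eq_zero]
          refine Eventually.of_forall fun x => ?_
          simp [indicator, hQs]

/-! ### Comparison with decreasing weights -/

/-- A lower subset of the half-line is the half-line itself or an interval `(0, b)` up to its right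
end point, which is null for `ν₁`. -/
theorem measure_le_of_isLowerSet_Ioi {ν₁ ν₂ : Measure ℝ} [NullSingletonClass ν₁]
    (h : ∀ b, 0 < b → ν₁ (Ioo 0 b) ≤ ν₂ (Ioo 0 b)) {L : Set ℝ} (hL : L ⊆ Ioi 0)
    (hlow : ∀ x ∈ L, ∀ y, 0 < y → y ≤ x → y ∈ L) : ν₁ L ≤ ν₂ L := by
  rcases L.eq_empty_or_nonempty with rfl | ⟨x0, hx0⟩
  · simp
  by_cases hb : BddAbove L
  · set b := sSup L with hbdef
    have h1 : Ioo 0 b ⊆ L := fun y hy => by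
      obtain ⟨x, hx, hyx⟩ := exists_lt_of_lt_csSup ⟨x0, hx0⟩ hy.2
      exact hlow x hx y hy.1 hyx.le
    have h2 : L ⊆ Ioc 0 b := fun y hy => ⟨hL hy, le_csSup hb hy⟩
    have hbpos : 0 < b := (show (0 : ℝ) < x0 from hL hx0).trans_le (le_csSup hb hx0)
    calc ν₁ L ≤ ν₁ (Ioc 0 b) := measure_mono h2
      _ = ν₁ (Ioo 0 b) := (measure_congr Ioo_ae_eq_Ioc).symm
      _ ≤ ν₂ (Ioo 0 b) := h b hbpos
      _ ≤ ν₂ L := measure_mono h1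
  · have hLe : L = ⋃ n : ℕ, Ioo 0 ((n : ℝ) + 1) := by
      ext y
      simp only [mem_iUnion, mem_Ioo]
      constructor
      · intro hy
        obtain ⟨n, hn⟩ := exists_nat_gt y
        exact ⟨n, hL hy, by linarith⟩
      · rintro ⟨n, h1, -⟩
        rw [not_bddAbove_iff] at hb
        obtain ⟨x, hx, hyx⟩ := hb y
        exact hlow x hx y h1 hyx.le
    have hmono : Monotone fun n : ℕ => Ioo (0 : ℝ) ((n : ℝ) + 1) :=
      monotone_nat_of_le_succ fun n => Ioo_subset_Ioo_right (by push_cast; linarith)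
    rw [hLe, hmono.measure_iUnion, hmono.measure_iUnion]
    exact iSup_mono fun n => h _ (by positivity)

/-- Comparison of integrals of decreasing weights on the half-line. -/
theorem setLIntegral_mul_antitone_le {F₁ F₂ : ℝ → ℝ≥0∞} {r : ℝ → ℝ}
    (m₁ : AEMeasurable F₁ (volume.restrict (Ioi 0)))
    (m₂ : AEMeasurable F₂ (volume.restrict (Ioi 0)))
    (hr : AntitoneOn r (Ioi 0)) (hr0 : ∀ t, 0 < t → 0 ≤ r t)
    (h : ∀ b, 0 < b → ∫⁻ t in Ioo 0 b, F₁ t ≤ ∫⁻ t in Ioo 0 b, F₂ t) :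
    ∫⁻ t in Ioi 0, F₁ t * ENNReal.ofReal (r t) ≤ ∫⁻ t in Ioi 0, F₂ t * ENNReal.ofReal (r t) := by
  have mr : AEMeasurable r (volume.restrict (Ioi 0)) :=
    aemeasurable_restrict_of_antitoneOn measurableSet_Ioi hr
  -- Layer-cake formula: the superlevel sets of a decreasing weight are lower sets, on which the two
  -- measures compare.
  have key : ∀ F : ℝ → ℝ≥0∞, AEMeasurable F (volume.restrict (Ioi 0)) →
      ∫⁻ t in Ioi 0, F t * ENNReal.ofReal (r t) =
      ∫⁻ l in Ioi (0 : ℝ), ((volume.restrict (Ioi 0)).withDensity F) ({t | l < r t} ∩ Ioi 0) := by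
    intro F mF
    have ac : (volume.restrict (Ioi (0 : ℝ))).withDensity F ≪ volume.restrict (Ioi 0) :=
      withDensity_absolutelyContinuous _ _
    have hpos : ∀ᵐ t ∂(volume.restrict (Ioi (0 : ℝ))).withDensity F, t ∈ Ioi (0 : ℝ) :=
      ac.ae_le (ae_restrict_mem measurableSet_Ioi)
    have := lintegral_eq_lintegral_meas_lt ((volume.restrict (Ioi 0)).withDensity F) (f := r)
      (hpos.mono fun t ht => hr0 t ht) (mr.mono_ac ac)
    rw [lintegral_withDensity_eq_lintegral_mul₀ mF mr.ennreal_ofReal] at this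
    simp only [Pi.mul_apply] at this
    rw [this]
    refine lintegral_congr fun l => measure_congr ?_
    filter_upwards [hpos] with t ht
    exact propext ⟨fun h => ⟨h, ht⟩, fun h => h.1⟩
  rw [key F₁ m₁, key F₂ m₂]
  refine lintegral_mono fun l => ?_
  refine measure_le_of_isLowerSet_Ioi ?_ inter_subset_right ?_
  · intro b hb
    rw [withDensity_apply _ measurableSet_Ioo, withDensity_apply _ measurableSet_Ioo,
      Measure.restrict_restrict measurableSet_Ioo,
      inter_eq_left.mpr (Ioo_subset_Ioi_self : Ioo (0 : ℝ) b ⊆ Ioi 0)]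
    exact h b hb
  · rintro x ⟨hx, hx0⟩ y hy hyx
    exact ⟨lt_of_lt_of_le hx (hr hy hx0 hyx), hy⟩

/-! ### Brascamp–Lieb on a segment -/

theorem integral_sub_mul_add_mul {α : Type*} [MeasurableSpace α] {μ : Measure α}
    {f g h : α → ℝ} (hf : Integrable f μ) (hg : Integrable g μ) (hh : Integrable h μ) (c d : ℝ) :
    ∫ x, (f x - c * g x + d * h x) ∂μ = ∫ x, f x ∂μ - c * ∫ x, g x ∂μ + d * ∫ x, h x ∂μ := by
  rw [integral_add (f := fun x => f x - c * g x) (hf.sub (hg.const_mul c)) (hh.const_mul d),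
    integral_sub hf (hg.const_mul c), integral_const_mul, integral_const_mul]

theorem integral_sq_sub_const_expand {α : Type*} [MeasurableSpace α] {μ : Measure α}
    {h w : α → ℝ} (hw : Integrable w μ) (h1 : Integrable (fun x => h x * w x) μ)
    (h2 : Integrable (fun x => h x ^ 2 * w x) μ) (c : ℝ) :
    ∫ x, (h x - c) ^ 2 * w x ∂μ =
      ∫ x, h x ^ 2 * w x ∂μ - 2 * c * ∫ x, h x * w x ∂μ + c ^ 2 * ∫ x, w x ∂μ := by
  rw [← integral_sub_mul_add_mul h2 h1 hw]
  exact integral_congr_ae (Eventually.of_forall fun x => by ring)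

/-- The Brascamp–Lieb inequality on a segment. -/
theorem brascampLieb_Icc {a b : ℝ} (hab : a ≤ b) {h h1 ψ ψ1 ψ2 q : ℝ → ℝ}
    (hh : ∀ t, HasDerivAt h (h1 t) t) (hψ : ∀ t, HasDerivAt ψ (ψ1 t) t)
    (hψ1 : ∀ t, HasDerivAt ψ1 (ψ2 t) t) (ch : Continuous h1) (cψ : Continuous ψ2)
    (cq : Continuous q) (hq : ∀ t l : ℝ, 2 * l * h1 t - l ^ 2 * ψ2 t ≤ q t) :
    (∫ t in Icc a b, Real.exp (-ψ t)) * (∫ t in Icc a b, h t ^ 2 * Real.exp (-ψ t))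
      - (∫ t in Icc a b, h t * Real.exp (-ψ t)) ^ 2 ≤
    (∫ t in Icc a b, q t * Real.exp (-ψ t)) * ∫ t in Icc a b, Real.exp (-ψ t) := by
  have c0 : Continuous h := continuous_iff_continuousAt.2 fun t => (hh t).continuousAt
  have cψ0 : Continuous ψ := continuous_iff_continuousAt.2 fun t => (hψ t).continuousAt
  have q0 : ∀ t, 0 ≤ q t := fun t => by simpa using hq t 0
  -- A quadratic polynomial in `l` that is bounded above, with zero constant term, cannot have `-ψ2
  -- t > 0` as leading coefficient.
  have ψ2nn : ∀ t, 0 ≤ ψ2 t := by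
    intro t
    by_contra! hneg
    have hd := discrim_le_zero (a := ψ2 t) (b := -2 * h1 t) (c := q t)
      (fun l => by linarith [hq t l])
    rw [discrim] at hd
    have hqt : q t = 0 := by
      by_contra hne
      have : 0 < q t := lt_of_le_of_ne (q0 t) (Ne.symm hne)
      nlinarith [sq_nonneg (h1 t), mul_pos this (neg_pos.2 hneg)]
    have h10 : h1 t = 0 := by
      rw [hqt] at hd
      nlinarith [sq_nonneg (h1 t)]
    have := hq t 1
    rw [hqt, h10] at this
    linarith
  have hmono : Monotone ψ1 :=
    monotone_of_deriv_nonneg (fun t => (hψ1 t).differentiableAt)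
      fun t => by rw [(hψ1 t).deriv]; exact ψ2nn t
  -- Split at a minimum of `ψ`: away from it the potential increases on both sides, and `h - h x0`
  -- vanishes at the common end point.
  obtain ⟨x0, hx0, hmin⟩ := isCompact_Icc.exists_isMinOn (nonempty_Icc.2 hab) cψ0.continuousOn
  set c := h x0
  have right : ∫⁻ t in Ioo x0 b, ENNReal.ofReal ((h t - c) ^ 2 * Real.exp (-ψ t)) ≤
      ∫⁻ t in Ioo x0 b, ENNReal.ofReal (q t * Real.exp (-ψ t)) := by
    refine brascampLieb_Ioo_of_tendsto_zero (h := fun t => h t - c) (h1 := h1) (ψ1 := ψ1)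
      (ψ2 := ψ2) ?_ (fun t _ => (hh t).sub_const c) (fun t _ => hψ t) (fun t _ => hψ1 t)
      ch.continuousOn cψ.continuousOn cq.continuousOn ?_ (fun t _ => hq t)
    · have : Tendsto (fun t => h t - c) (𝓝 x0) (𝓝 (h x0 - c)) :=
        (c0.sub continuous_const).tendsto x0
      rw [sub_self] at this
      exact this.mono_left nhdsWithin_le_nhds
    · intro t ht
      obtain ⟨ξ, hξ, hs⟩ := exists_hasDerivAt_eq_slope ψ ψ1 ht.1 cψ0.continuousOn
        (fun x _ => hψ x)
      have h1 : ψ x0 ≤ ψ t := hmin ⟨hx0.1.trans ht.1.le, ht.2.le⟩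
      have h2 : 0 ≤ ψ1 ξ := by
        rw [hs]; exact div_nonneg (by linarith) (by linarith [ht.1])
      exact h2.trans (hmono hξ.2.le)
  have left : ∫⁻ t in Ioo a x0, ENNReal.ofReal ((h t - c) ^ 2 * Real.exp (-ψ t)) ≤
      ∫⁻ t in Ioo a x0, ENNReal.ofReal (q t * Real.exp (-ψ t)) := by
    have refl : ∀ F : ℝ → ℝ≥0∞, ∫⁻ t in Ioo (-x0) (-a), F (-t) = ∫⁻ t in Ioo a x0, F t := by
      intro F
      have := (Measure.measurePreserving_neg (volume : Measure ℝ)).setLIntegral_comp_preimage_emb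
        (MeasurableEquiv.neg ℝ).measurableEmbedding F (Ioo a x0)
      rw [← this]
      congr 2
      simp
    rw [← refl, ← refl]
    refine brascampLieb_Ioo_of_tendsto_zero (h := fun t => h (-t) - c) (h1 := fun t => -h1 (-t))
      (ψ := fun t => ψ (-t)) (ψ1 := fun t => -ψ1 (-t)) (q := fun t => q (-t))
      (ψ2 := fun t => ψ2 (-t)) ?_ (fun t _ => ?_) (fun t _ => ?_) (fun t _ => ?_)
      (by fun_prop) (by fun_prop) (by fun_prop) ?_ (fun t _ l => ?_)
    · have : Tendsto (fun t => h (-t) - c) (𝓝 (-x0)) (𝓝 (h (- -x0) - c)) :=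
        ((c0.comp continuous_neg).sub continuous_const).tendsto (-x0)
      rw [neg_neg, sub_self] at this
      exact this.mono_left nhdsWithin_le_nhds
    · exact (((hh (-t)).scomp t (hasDerivAt_neg t)).sub_const c).congr_deriv (by simp)
    · exact ((hψ (-t)).scomp t (hasDerivAt_neg t)).congr_deriv (by simp)
    · exact (((hψ1 (-t)).scomp t (hasDerivAt_neg t)).neg).congr_deriv (by simp)
    · intro t ht
      have ht1 : a < -t := by linarith [ht.2]
      have ht2 : -t < x0 := by linarith [ht.1]
      obtain ⟨ξ, hξ, hs⟩ := exists_hasDerivAt_eq_slope ψ ψ1 ht2 cψ0.continuousOn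
        (fun x _ => hψ x)
      have h1 : ψ x0 ≤ ψ (-t) := hmin ⟨ht1.le, ht2.le.trans hx0.2⟩
      have h2 : ψ1 ξ ≤ 0 := by
        rw [hs]; exact div_nonpos_of_nonpos_of_nonneg (by linarith) (by linarith)
      have := hmono hξ.1.le
      linarith
    · have := hq (-t) (-l)
      linarith
  have split : ∀ F : ℝ → ℝ≥0∞, ∫⁻ t in Icc a b, F t =
      (∫⁻ t in Ioo a x0, F t) + ∫⁻ t in Ioo x0 b, F t := by
    intro F
    rw [setLIntegral_congr (Ioo_ae_eq_Ioc (μ := volume) (a := a) (b := x0)),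
      setLIntegral_congr (Ioo_ae_eq_Ioc (μ := volume) (a := x0) (b := b)),
      ← lintegral_union measurableSet_Ioc (Ioc_disjoint_Ioc_of_le le_rfl),
      Ioc_union_Ioc_eq_Ioc hx0.1 hx0.2]
    exact setLIntegral_congr Ioc_ae_eq_Icc.symm
  have integ : ∀ g : ℝ → ℝ, Continuous g → Integrable g (volume.restrict (Icc a b)) :=
    fun g hg => hg.continuousOn.integrableOn_compact isCompact_Icc
  have main : ∫ t in Icc a b, (h t - c) ^ 2 * Real.exp (-ψ t) ≤
      ∫ t in Icc a b, q t * Real.exp (-ψ t) := by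
    have hle := add_le_add left right
    rw [← split, ← split, ← ofReal_integral_eq_lintegral_ofReal,
      ← ofReal_integral_eq_lintegral_ofReal, ENNReal.ofReal_le_ofReal_iff] at hle
    · exact hle
    · exact integral_nonneg fun t => mul_nonneg (q0 t) (Real.exp_pos _).le
    · exact integ _ (by fun_prop)
    · exact Eventually.of_forall fun t => mul_nonneg (q0 t) (Real.exp_pos _).le
    · exact integ _ (by fun_prop)
    · exact Eventually.of_forall fun t => mul_nonneg (sq_nonneg _) (Real.exp_pos _).le
  rw [integral_sq_sub_const_expand (integ _ (by fun_prop)) (integ _ (by fun_prop))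
    (integ _ (by fun_prop))] at main
  have Z0 : 0 ≤ ∫ t in Icc a b, Real.exp (-ψ t) :=
    integral_nonneg fun t => (Real.exp_pos _).le
  -- With `Z = ∫ e^{-ψ}`, the product of `Z` and the second moment about `c` exceeds the left side
  -- of the goal by the square `(∫ h e^{-ψ} - c Z)²`.
  have h3 := mul_le_mul_of_nonneg_left main Z0
  nlinarith [sq_nonneg ((∫ t in Icc a b, h t * Real.exp (-ψ t))
    - c * ∫ t in Icc a b, Real.exp (-ψ t))]

/-! ### Tensorization -/

/-- The Brascamp–Lieb inequality for all densities `e^{-W}`, `W ∈ C²`, with respect to `ν`. The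
inverse Hessian form is replaced by an arbitrary continuous majorant `q` of
`sup_u (2 ⟨∇f, u⟩ - ⟨D²W u, u⟩)`; the existence of `q` forces `W` to be convex. -/
def BrascampLiebFor {E : Type*} [NormedAddCommGroup E] [NormedSpace ℝ E] [MeasurableSpace E]
    (ν : Measure E) : Prop :=
  ∀ W f q : E → ℝ, ContDiff ℝ 2 W → ContDiff ℝ 1 f → Continuous q →
    (∀ x u, 2 * fderiv ℝ f x u - fderiv ℝ (fderiv ℝ W) x u u ≤ q x) →
    (∫ x, Real.exp (-W x) ∂ν) * (∫ x, f x ^ 2 * Real.exp (-W x) ∂ν)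
      - (∫ x, f x * Real.exp (-W x) ∂ν) ^ 2 ≤
    (∫ x, q x * Real.exp (-W x) ∂ν) * ∫ x, Real.exp (-W x) ∂ν

section Product

set_option linter.unusedSectionVars false

variable {E : Type*} [NormedAddCommGroup E] [NormedSpace ℝ E] [MeasurableSpace E] [BorelSpace E]
  [SecondCountableTopology E]

theorem integrable_of_continuous_of_compact {ν : Measure E} [IsFiniteMeasure ν] {K : Set E}
    (hK : IsCompact K) (hν : ν Kᶜ = 0) {g : E → ℝ} (hg : Continuous g) : Integrable g ν := by
  have := hg.continuousOn.integrableOn_compact (μ := ν) hK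
  rwa [IntegrableOn, Measure.restrict_eq_self_of_ae_mem (mem_ae_iff.2 hν)] at this

theorem continuous_integral_of_compact {ν : Measure E} [IsFiniteMeasure ν] {K : Set E}
    (hK : IsCompact K) (hν : ν Kᶜ = 0) {g : ℝ × E → ℝ} (hg : Continuous g) :
    Continuous fun t => ∫ x, g (t, x) ∂ν := by
  have := continuous_parametric_integral_of_continuous (μ := ν) (f := fun t x => g (t, x)) hg hK
  rw [Measure.restrict_eq_self_of_ae_mem (mem_ae_iff.2 hν)] at this
  convert this using 1

theorem hasDerivAt_integral_of_compact {ν : Measure E} [IsFiniteMeasure ν] {K : Set E}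
    (hK : IsCompact K) (hν : ν Kᶜ = 0) {g g' : ℝ × E → ℝ} (hg : Continuous g)
    (hg' : Continuous g') (hd : ∀ t x, HasDerivAt (fun s => g (s, x)) (g' (t, x)) t) (t : ℝ) :
    HasDerivAt (fun s => ∫ x, g (s, x) ∂ν) (∫ x, g' (t, x) ∂ν) t := by
  obtain ⟨M, hM⟩ := ((isCompact_Icc (a := t - 1) (b := t + 1)).prod hK).bddAbove_image
    hg'.norm.continuousOn
  refine (hasDerivAt_integral_of_dominated_loc_of_deriv_le (F := fun s x => g (s, x))
    (F' := fun s x => g' (s, x)) (bound := fun _ => M)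
    (Icc_mem_nhds (by linarith : t - 1 < t) (by linarith : t < t + 1))
    (Eventually.of_forall fun s => ?_) ?_ ?_ ?_ (integrable_const _) ?_).2
  · exact (hg.comp (by fun_prop : Continuous fun x : E => (s, x))).aestronglyMeasurable
  · exact integrable_of_continuous_of_compact hK hν
      (hg.comp (by fun_prop : Continuous fun x : E => (t, x)))
  · exact (hg'.comp (by fun_prop : Continuous fun x : E => (t, x))).aestronglyMeasurable
  · filter_upwards [mem_ae_iff.2 hν] with x hx s hs
    exact hM (mem_image_of_mem _ (show (s, x) ∈ _ ×ˢ _ from ⟨hs, hx⟩))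
  · exact Eventually.of_forall fun x s _ => hd s x

set_option maxHeartbeats 1000000 in
-- Integrating out `x` leaves the potential `-log Z(t)` and the conditional mean `F/Z` in the
-- variable `t`. The inequality on the slices, applied to `f - l ∂ₜW`, supplies the majorant that
-- the inequality on the segment needs for this pair; adding conditional variance and variance of
-- the conditional mean finishes the proof.
theorem BrascampLiebFor.prod {ν : Measure E} [IsFiniteMeasure ν] {K : Set E}
    (hK : IsCompact K) (hν : ν Kᶜ = 0) (hBL : BrascampLiebFor ν) {a b : ℝ} (hab : a ≤ b) :
    BrascampLiebFor (((volume : Measure ℝ).restrict (Icc a b)).prod ν) := by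
  intro W f q hW hf hq hmaj
  -- Excluding `ν = 0` makes the marginal `Z` strictly positive.
  rcases eq_or_ne ν 0 with rfl | hν0
  · simp
  have : NeZero ν := ⟨hν0⟩
  -- derivatives in the first variable
  set e : ℝ × E := (1, 0) with he
  set Wt : ℝ × E → ℝ := fun z => fderiv ℝ W z e with hWt
  set Wtt : ℝ × E → ℝ := fun z => fderiv ℝ (fderiv ℝ W) z e e with hWtt
  set ft : ℝ × E → ℝ := fun z => fderiv ℝ f z e with hft
  have hdW : ContDiff ℝ 1 (fderiv ℝ W) := hW.fderiv_right (by norm_num)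
  have hWt1 : ContDiff ℝ 1 Wt := hdW.clm_apply contDiff_const
  have cW : Continuous W := hW.continuous
  have cf : Continuous f := hf.continuous
  have cWt : Continuous Wt := hWt1.continuous
  have cWtt : Continuous Wtt :=
    ((hdW.continuous_fderiv (by norm_num)).clm_apply continuous_const).clm_apply continuous_const
  have cft : Continuous ft := (hf.continuous_fderiv (by norm_num)).clm_apply continuous_const
  have line : ∀ t (x : E), HasDerivAt (fun s : ℝ => (s, x)) e t := fun t x =>
    (hasDerivAt_id t).prodMk (hasDerivAt_const t x)
  have dW : ∀ t x, HasDerivAt (fun s => W (s, x)) (Wt (t, x)) t := fun t x =>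
    ((hW.differentiable (by norm_num) (t, x)).hasFDerivAt).comp_hasDerivAt t (line t x)
  have df : ∀ t x, HasDerivAt (fun s => f (s, x)) (ft (t, x)) t := fun t x =>
    ((hf.differentiable (by norm_num) (t, x)).hasFDerivAt).comp_hasDerivAt t (line t x)
  have dWt : ∀ t x, HasDerivAt (fun s => Wt (s, x)) (Wtt (t, x)) t := fun t x =>
    (((hdW.differentiable (by norm_num) (t, x)).hasFDerivAt).comp_hasDerivAt t
      (line t x)).clm_apply (hasDerivAt_const t e) |>.congr_deriv (by simp [hWtt])
  have dexp : ∀ t x, HasDerivAt (fun s => Real.exp (-W (s, x)))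
      (-Wt (t, x) * Real.exp (-W (t, x))) t := fun t x =>
    ((dW t x).fun_neg.exp).congr_deriv (by ring)
  -- marginals
  have int : ∀ g : ℝ × E → ℝ, Continuous g → ∀ t, Integrable (fun x => g (t, x)) ν :=
    fun g hg t => integrable_of_continuous_of_compact hK hν
      (hg.comp (by fun_prop : Continuous fun x : E => (t, x)))
  set w : ℝ × E → ℝ := fun z => Real.exp (-W z) with hw
  have cw : Continuous w := by fun_prop
  set Z : ℝ → ℝ := fun t => ∫ x, w (t, x) ∂ν with hZ
  set M : ℝ → ℝ := fun t => ∫ x, Wt (t, x) * w (t, x) ∂ν with hM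
  set B : ℝ → ℝ := fun t => ∫ x, Wt (t, x) ^ 2 * w (t, x) ∂ν with hB
  set D : ℝ → ℝ := fun t => ∫ x, Wtt (t, x) * w (t, x) ∂ν with hD
  set F : ℝ → ℝ := fun t => ∫ x, f (t, x) * w (t, x) ∂ν with hF
  set A : ℝ → ℝ := fun t => ∫ x, f (t, x) * Wt (t, x) * w (t, x) ∂ν with hA
  set C : ℝ → ℝ := fun t => ∫ x, ft (t, x) * w (t, x) ∂ν with hC
  set G : ℝ → ℝ := fun t => ∫ x, f (t, x) ^ 2 * w (t, x) ∂ν with hG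
  set Kq : ℝ → ℝ := fun t => ∫ x, q (t, x) * w (t, x) ∂ν with hKq
  have cont : ∀ g : ℝ × E → ℝ, Continuous g → Continuous fun t => ∫ x, g (t, x) ∂ν :=
    fun g hg => continuous_integral_of_compact hK hν hg
  have cZ : Continuous Z := cont w cw
  have cM : Continuous M := cont (fun z => Wt z * w z) (by fun_prop)
  have cB : Continuous B := cont (fun z => Wt z ^ 2 * w z) (by fun_prop)
  have cD : Continuous D := cont (fun z => Wtt z * w z) (by fun_prop)
  have cF : Continuous F := cont (fun z => f z * w z) (by fun_prop)
  have cA : Continuous A := cont (fun z => f z * Wt z * w z) (by fun_prop)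
  have cC : Continuous C := cont (fun z => ft z * w z) (by fun_prop)
  have cG : Continuous G := cont (fun z => f z ^ 2 * w z) (by fun_prop)
  have cK : Continuous Kq := cont (fun z => q z * w z) (by fun_prop)
  have Zpos : ∀ t, 0 < Z t := fun t => integral_exp_pos (int w cw t)
  have dZ : ∀ t, HasDerivAt Z (-M t) t := by
    intro t
    refine (hasDerivAt_integral_of_compact hK hν (g := w) (g' := fun z => -Wt z * w z) cw
      (by fun_prop) dexp t).congr_deriv ?_
    simp only [hM, neg_mul, integral_neg]
  have dM : ∀ t, HasDerivAt M (D t - B t) t := by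
    intro t
    refine (hasDerivAt_integral_of_compact hK hν (g := fun z => Wt z * w z)
      (g' := fun z => Wtt z * w z - Wt z ^ 2 * w z) (by fun_prop) (by fun_prop)
      (fun t x => ((dWt t x).mul (dexp t x)).congr_deriv (by simp only [hw]; ring)) t).congr_deriv
      ?_
    exact integral_sub (int (fun z => Wtt z * w z) (by fun_prop) t)
      (int (fun z => Wt z ^ 2 * w z) (by fun_prop) t)
  have dF : ∀ t, HasDerivAt F (C t - A t) t := by
    intro t
    refine (hasDerivAt_integral_of_compact hK hν (g := fun z => f z * w z)
      (g' := fun z => ft z * w z - f z * Wt z * w z) (by fun_prop) (by fun_prop)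
      (fun t x => ((df t x).mul (dexp t x)).congr_deriv (by simp only [hw]; ring)) t).congr_deriv
      ?_
    exact integral_sub (int (fun z => ft z * w z) (by fun_prop) t)
      (int (fun z => f z * Wt z * w z) (by fun_prop) t)
  -- the inequality on the slices
  have slice : ∀ t l : ℝ, Z t * (G t - 2 * l * A t + l ^ 2 * B t) - (F t - l * M t) ^ 2 ≤
      (Kq t - 2 * l * C t + l ^ 2 * D t) * Z t := by
    intro t l
    have inr : ContDiff ℝ 2 fun x : E => (t, x) := by fun_prop
    have dinr : ∀ x : E, HasFDerivAt (fun x : E => (t, x)) (ContinuousLinearMap.inr ℝ ℝ E) x :=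
      fun x => hasFDerivAt_prodMk_right t x
    have h1 : ∀ x : E, fderiv ℝ (fun x => W (t, x)) x =
        (fderiv ℝ W (t, x)).comp (ContinuousLinearMap.inr ℝ ℝ E) := fun x =>
      (((hW.differentiable (by norm_num) (t, x)).hasFDerivAt).comp x (dinr x)).fderiv
    have h2 : ∀ x u : E, fderiv ℝ (fderiv ℝ fun x => W (t, x)) x u u =
        fderiv ℝ (fderiv ℝ W) (t, x) (0, u) (0, u) := by
      intro x u
      have h3 : HasFDerivAt (fun x => (fderiv ℝ W (t, x)).comp (ContinuousLinearMap.inr ℝ ℝ E))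
          (((ContinuousLinearMap.compL ℝ E (ℝ × E) ℝ).flip (ContinuousLinearMap.inr ℝ ℝ E)).comp
            ((fderiv ℝ (fderiv ℝ W) (t, x)).comp (ContinuousLinearMap.inr ℝ ℝ E))) x :=
        ((ContinuousLinearMap.compL ℝ E (ℝ × E) ℝ).flip
          (ContinuousLinearMap.inr ℝ ℝ E)).hasFDerivAt.comp x
          (((hdW.differentiable (by norm_num) (t, x)).hasFDerivAt).comp x (dinr x))
      rw [funext h1, h3.fderiv]
      simp
    have h4 : ∀ x u : E, fderiv ℝ (fun x => f (t, x) - l * Wt (t, x)) x u =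
        fderiv ℝ f (t, x) (0, u) - l * fderiv ℝ (fderiv ℝ W) (t, x) (0, u) e := by
      intro x u
      have h5 : HasFDerivAt (fun x => f (t, x)) _ x :=
        ((hf.differentiable (by norm_num) (t, x)).hasFDerivAt).comp x (dinr x)
      have h6 : HasFDerivAt Wt ((fderiv ℝ (fderiv ℝ W) (t, x)).flip e) (t, x) := by
        refine (((hdW.differentiable (by norm_num) (t, x)).hasFDerivAt).clm_apply
          (hasFDerivAt_const e (t, x))).congr_fderiv ?_
        ext <;> simp
      have h7 : HasFDerivAt (fun x => Wt (t, x)) _ x := h6.comp x (dinr x)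
      rw [(h5.fun_sub (h7.const_mul l)).fderiv]
      simp
    -- Evaluating the majorant hypothesis at the vector `(l, u)` and moving the terms free of `u` to
    -- the right gives exactly this test function and this majorant.
    have := hBL (fun x => W (t, x)) (fun x => f (t, x) - l * Wt (t, x))
      (fun x => q (t, x) - 2 * l * ft (t, x) + l ^ 2 * Wtt (t, x)) (hW.comp inr)
      ((hf.comp (inr.of_le (by norm_num))).sub
        (contDiff_const.mul (hWt1.comp (inr.of_le (by norm_num))))) (by fun_prop) ?_
    · have e1 : ∫ x, (f (t, x) - l * Wt (t, x)) ^ 2 * Real.exp (-W (t, x)) ∂ν =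
          G t - 2 * l * A t + l ^ 2 * B t := by
        have : ∀ x, (f (t, x) - l * Wt (t, x)) ^ 2 * Real.exp (-W (t, x)) =
          f (t, x) ^ 2 * w (t, x) - 2 * l * (f (t, x) * Wt (t, x) * w (t, x))
            + l ^ 2 * (Wt (t, x) ^ 2 * w (t, x)) := fun x => by simp only [hw]; ring
        have i1 := int (fun z => f z ^ 2 * w z) (by fun_prop) t
        have i2 := int (fun z => f z * Wt z * w z) (by fun_prop) t
        have i3 := int (fun z => Wt z ^ 2 * w z) (by fun_prop) t
        simp_rw [this]
        exact integral_sub_mul_add_mul i1 i2 i3 _ _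
      have e2 : ∫ x, (f (t, x) - l * Wt (t, x)) * Real.exp (-W (t, x)) ∂ν = F t - l * M t := by
        have : ∀ x, (f (t, x) - l * Wt (t, x)) * Real.exp (-W (t, x)) =
          f (t, x) * w (t, x) - l * (Wt (t, x) * w (t, x)) := fun x => by simp only [hw]; ring
        have i1 := int (fun z => f z * w z) (by fun_prop) t
        have i2 := int (fun z => Wt z * w z) (by fun_prop) t
        simp_rw [this]
        rw [integral_sub i1 (i2.const_mul _), integral_const_mul]
      have e3 : ∫ x, (q (t, x) - 2 * l * ft (t, x) + l ^ 2 * Wtt (t, x))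
          * Real.exp (-W (t, x)) ∂ν = Kq t - 2 * l * C t + l ^ 2 * D t := by
        have : ∀ x, (q (t, x) - 2 * l * ft (t, x) + l ^ 2 * Wtt (t, x)) * Real.exp (-W (t, x)) =
          q (t, x) * w (t, x) - 2 * l * (ft (t, x) * w (t, x))
            + l ^ 2 * (Wtt (t, x) * w (t, x)) := fun x => by simp only [hw]; ring
        have i1 := int (fun z => q z * w z) (by fun_prop) t
        have i2 := int (fun z => ft z * w z) (by fun_prop) t
        have i3 := int (fun z => Wtt z * w z) (by fun_prop) t
        simp_rw [this]
        exact integral_sub_mul_add_mul i1 i2 i3 _ _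
      rw [e1, e2, e3] at this
      exact this
    · intro x u
      have hsym : fderiv ℝ (fderiv ℝ W) (t, x) e (0, u) = fderiv ℝ (fderiv ℝ W) (t, x) (0, u) e :=
        (hW.contDiffAt.isSymmSndFDerivAt (by simp)) e (0, u)
      have hv : ((l, u) : ℝ × E) = l • e + (0, u) := by simp [he]
      have h8 := hmaj (t, x) (l, u)
      rw [hv] at h8
      simp only [map_add, map_smul, add_apply, smul_apply,
        smul_eq_mul, hsym] at h8
      rw [h2, h4]
      simp only [hft, hWtt]
      linarith
  -- the one-dimensional inequality for the marginals
  have one := brascampLieb_Icc hab (h := fun t => F t / Z t)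
    (h1 := fun t => ((C t - A t) * Z t + F t * M t) / Z t ^ 2)
    (ψ := fun t => -Real.log (Z t)) (ψ1 := fun t => M t / Z t)
    (ψ2 := fun t => ((D t - B t) * Z t + M t ^ 2) / Z t ^ 2)
    (q := fun t => (Kq t - G t) / Z t + (F t / Z t) ^ 2)
    (fun t => ((dF t).div (dZ t) (Zpos t).ne').congr_deriv (by ring))
    (fun t => (((dZ t).log (Zpos t).ne').fun_neg).congr_deriv (by ring))
    (fun t => ((dM t).div (dZ t) (Zpos t).ne').congr_deriv (by ring))
    (by fun_prop (disch := intro t; exact pow_ne_zero 2 (Zpos t).ne'))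
    (by fun_prop (disch := intro t; exact pow_ne_zero 2 (Zpos t).ne'))
    (by fun_prop (disch := intro t; exact (Zpos t).ne'))
    (by
      intro t l
      have hz := Zpos t
      -- Up to the factor `Z²`, the majorant condition for the marginals is the inequality `slice`.
      have e1 : (Kq t - G t) / Z t + (F t / Z t) ^ 2 -
          (2 * l * (((C t - A t) * Z t + F t * M t) / Z t ^ 2) -
            l ^ 2 * (((D t - B t) * Z t + M t ^ 2) / Z t ^ 2)) =
          ((Kq t - 2 * l * C t + l ^ 2 * D t) * Z t -
            (Z t * (G t - 2 * l * A t + l ^ 2 * B t) - (F t - l * M t) ^ 2)) / Z t ^ 2 := by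
        field_simp
        ring
      rw [← sub_nonneg, e1]
      exact div_nonneg (by linarith [slice t l]) (by positivity))
  have hexp : ∀ t, Real.exp (- -Real.log (Z t)) = Z t := fun t => by
    rw [neg_neg, Real.exp_log (Zpos t)]
  have hF2 : ∀ t, (F t / Z t) ^ 2 * Z t = F t ^ 2 / Z t := fun t => by
    have := (Zpos t).ne'
    field_simp
  have hF1 : ∀ t, F t / Z t * Z t = F t := fun t => div_mul_cancel₀ _ (Zpos t).ne'
  have hQ : ∀ t, ((Kq t - G t) / Z t + (F t / Z t) ^ 2) * Z t
      = Kq t - G t + F t ^ 2 / Z t := fun t => by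
    have := (Zpos t).ne'
    field_simp
  simp only [hexp, hF2, hF1, hQ] at one
  have i1 : ∀ g : ℝ → ℝ, Continuous g → Integrable g (volume.restrict (Icc a b)) :=
    fun g hg => hg.continuousOn.integrableOn_compact isCompact_Icc
  have cFZ : Continuous fun t => F t ^ 2 / Z t :=
    (cF.pow 2).div cZ fun t => (Zpos t).ne'
  -- The term `(∫ F²/Z)(∫ Z)` occurs on both sides and cancels.
  rw [integral_add (i1 (fun t => Kq t - G t) (cK.sub cG)) (i1 _ cFZ),
    integral_sub (i1 _ cK) (i1 _ cG)] at one
  have fub : ∀ g : ℝ × E → ℝ, Continuous g →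
      ∫ z, g z ∂((volume.restrict (Icc a b)).prod ν) = ∫ t in Icc a b, ∫ x, g (t, x) ∂ν := by
    intro g hg
    refine integral_prod g ?_
    refine integrable_of_continuous_of_compact (K := Icc a b ×ˢ K) (isCompact_Icc.prod hK) ?_ hg
    rw [Set.compl_prod_eq_union, measure_union_null_iff, Measure.prod_prod, Measure.prod_prod, hν]
    simp
  rw [fub w cw, fub (fun z => f z ^ 2 * w z) (by fun_prop), fub (fun z => f z * w z) (by fun_prop),
    fub (fun z => q z * w z) (by fun_prop)]
  simp only [hZ, hF, hG, hKq] at one ⊢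
  linarith

end Product

/-! ### Linear changes of variables and cubes -/

theorem fderiv_fderiv_comp_apply {E E' : Type*} [NormedAddCommGroup E] [NormedSpace ℝ E]
    [NormedAddCommGroup E'] [NormedSpace ℝ E'] {W : E' → ℝ} (hW : ContDiff ℝ 2 W)
    (L : E →L[ℝ] E') (x u v : E) :
    fderiv ℝ (fderiv ℝ fun x => W (L x)) x u v = fderiv ℝ (fderiv ℝ W) (L x) (L u) (L v) := by
  have hdW : ContDiff ℝ 1 (fderiv ℝ W) := hW.fderiv_right (by norm_num)
  have h1 : ∀ x : E, fderiv ℝ (fun x => W (L x)) x = (fderiv ℝ W (L x)).comp L := fun x =>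
    (((hW.differentiable (by norm_num) (L x)).hasFDerivAt).comp x L.hasFDerivAt).fderiv
  have h3 : HasFDerivAt (fun x => (fderiv ℝ W (L x)).comp L)
      (((ContinuousLinearMap.compL ℝ E E' ℝ).flip L).comp
        ((fderiv ℝ (fderiv ℝ W) (L x)).comp L)) x :=
    ((ContinuousLinearMap.compL ℝ E E' ℝ).flip L).hasFDerivAt.comp x
      (((hdW.differentiable (by norm_num) (L x)).hasFDerivAt).comp x L.hasFDerivAt)
  rw [funext h1, h3.fderiv]
  simp

theorem BrascampLiebFor.map {E E' : Type*} [NormedAddCommGroup E] [NormedSpace ℝ E]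
    [MeasurableSpace E] [BorelSpace E] [NormedAddCommGroup E'] [NormedSpace ℝ E']
    [MeasurableSpace E'] [BorelSpace E'] {ν : Measure E} {ν' : Measure E'}
    (hν : BrascampLiebFor ν) (L : E ≃L[ℝ] E') (hL : MeasurePreserving L ν ν') :
    BrascampLiebFor ν' := by
  intro W f q hW hf hq hmaj
  have int : ∀ g : E' → ℝ, ∫ y, g y ∂ν' = ∫ x, g (L x) ∂ν := fun g =>
    (hL.integral_comp L.toHomeomorph.measurableEmbedding g).symm
  rw [int, int, int, int]
  refine hν (fun x => W (L x)) (fun x => f (L x)) (fun x => q (L x)) (hW.comp L.contDiff)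
    (hf.comp L.contDiff) (hq.comp L.continuous) fun x u => ?_
  have h1 := fderiv_fderiv_comp_apply hW (L : E →L[ℝ] E') x u u
  have h2 : fderiv ℝ (fun x => f (L x)) x u = fderiv ℝ f (L x) (L u) := by
    have := ((hf.differentiable (by norm_num) (L x)).hasFDerivAt).comp x
      (L : E →L[ℝ] E').hasFDerivAt
    exact DFunLike.congr_fun this.fderiv u
  have h3 := hmaj (L x) (L u)
  simp only [ContinuousLinearEquiv.coe_coe] at h1
  rw [h1, h2]
  exact h3

/-- The closed cube `[-R, R]ⁿ`. -/
def cube (n : ℕ) (R : ℝ) : Set (Rn n) := {x | ∀ i, x i ∈ Icc (-R) R}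

theorem brascampLiebFor_pi (R : ℝ) (hR : 0 ≤ R) (n : ℕ) :
    BrascampLiebFor ((volume : Measure (Fin n → ℝ)).restrict (univ.pi fun _ => Icc (-R) R)) := by
  induction n with
  | zero =>
    intro W f q hW hf hq hmaj
    -- In dimension zero the space is a point and the variance is `0`, so only `q ≥ 0` is needed.
    have hq0 : 0 ≤ q default := by
      have := hmaj default 0
      rw [map_zero, map_zero] at this
      linarith
    have e : ∀ g : (Fin 0 → ℝ) → ℝ, ∫ x in univ.pi fun _ => Icc (-R) R, g x = g default := by
      intro g
      have h1 : (univ.pi fun _ : Fin 0 => Icc (-R) R) = univ := by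
        ext x; simp
      rw [h1, Measure.restrict_univ, volume_pi, Measure.pi_of_empty _ default, integral_dirac]
    rw [e, e, e, e]
    have : 0 ≤ q default * Real.exp (-W default) * Real.exp (-W default) := by positivity
    nlinarith
  | succ n ih =>
    have hK : IsCompact (univ.pi fun _ : Fin n => Icc (-R) R) :=
      isCompact_univ_pi fun _ => isCompact_Icc
    have : IsFiniteMeasure ((volume : Measure (Fin n → ℝ)).restrict
        (univ.pi fun _ => Icc (-R) R)) := ⟨by
      rw [Measure.restrict_apply_univ]; exact hK.measure_lt_top⟩
    have h1 := ih.prod hK (by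
      rw [Measure.restrict_apply hK.isClosed.measurableSet.compl, compl_inter_self]
      simp) (by linarith : -R ≤ R)
    refine h1.map (Fin.consEquivL ℝ fun _ : Fin (n + 1) => ℝ) ?_
    rw [Measure.prod_restrict]
    have h2 : MeasurePreserving (Fin.consEquivL ℝ fun _ : Fin (n + 1) => ℝ)
        ((volume : Measure ℝ).prod (volume : Measure (Fin n → ℝ))) volume := by
      have h3 := (volume_preserving_piFinSuccAbove (fun _ : Fin (n + 1) => ℝ) 0).symm
      have h4 : ((MeasurableEquiv.piFinSuccAbove (fun _ : Fin (n + 1) => ℝ) 0).symm : _ → _) =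
          (Fin.consEquivL ℝ fun _ : Fin (n + 1) => ℝ) := by
        funext z
        simp [MeasurableEquiv.piFinSuccAbove, Fin.insertNthEquiv, Fin.consEquivL,
          Fin.consLinearEquiv, Fin.consEquiv]
      rw [h4] at h3
      exact h3
    have h5 := h2.restrict_preimage_emb
      (Fin.consEquivL ℝ fun _ : Fin (n + 1) => ℝ).toHomeomorph.measurableEmbedding
      (univ.pi fun _ => Icc (-R) R)
    convert h5 using 2
    ext z
    simp only [mem_prod, mem_preimage, mem_univ_pi, Fin.forall_fin_succ]
    rfl

theorem brascampLiebFor_cube (n : ℕ) (R : ℝ) (hR : 0 ≤ R) :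
    BrascampLiebFor ((volume : Measure (Rn n)).restrict (cube n R)) := by
  refine (brascampLiebFor_pi R hR n).map (EuclideanSpace.equiv (Fin n) ℝ).symm ?_
  have h5 := (PiLp.volume_preserving_toLp (Fin n)).restrict_preimage_emb
    (EuclideanSpace.equiv (Fin n) ℝ).symm.toHomeomorph.measurableEmbedding (cube n R)
  have h6 : WithLp.toLp 2 ⁻¹' cube n R = univ.pi fun _ => Icc (-R) R := by
    ext z
    simp only [cube, mem_preimage, mem_ofPred_eq, mem_univ_pi]
  rw [← h6]
  exact h5

theorem isCompact_cube (n : ℕ) (R : ℝ) : IsCompact (cube n R) := by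
  have h := (isCompact_univ_pi fun _ : Fin n => isCompact_Icc (a := -R) (b := R)).image
    (EuclideanSpace.equiv (Fin n) ℝ).symm.continuous
  convert h using 1
  ext z
  constructor
  · intro hz
    exact ⟨z, fun i _ => hz i, rfl⟩
  · rintro ⟨y, hy, rfl⟩ i
    exact hy i trivial

/-! ### Reflections in the coordinate hyperplanes -/

/-- The reflection changing the signs of the coordinates marked by `s`. -/
def flip {n : ℕ} (s : Fin n → Bool) : Rn n ≃ₗᵢ[ℝ] Rn n :=
  LinearIsometryEquiv.piLpCongrRight 2 fun i =>
    if s i then LinearIsometryEquiv.neg ℝ else LinearIsometryEquiv.refl ℝ ℝ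

theorem flip_apply {n : ℕ} (s : Fin n → Bool) (x : Rn n) (i : Fin n) :
    flip s x i = if s i then -x i else x i := by
  simp only [flip, LinearIsometryEquiv.piLpCongrRight_apply]
  split_ifs <;> simp

theorem flip_flip {n : ℕ} (s : Fin n → Bool) (x : Rn n) : flip s (flip s x) = x := by
  ext i
  simp only [flip_apply]
  split_ifs <;> simp

theorem flip_symm {n : ℕ} (s : Fin n → Bool) : (flip s).symm = flip s := by
  ext1 x
  rw [LinearIsometryEquiv.symm_apply_eq, flip_flip]

theorem IsUnconditional.flip {n : ℕ} {f : Rn n → ℝ} (hf : IsUnconditional f) (s : Fin n → Bool)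
    (x : Rn n) : f (flip s x) = f x := by
  rw [← hf (fun i => if s i then -1 else 1) (fun i => by split_ifs <;> simp) x]
  congr 1
  ext i
  simp only [flip_apply]
  split_ifs <;> simp

/-- The open orthant. -/
def posOrthant (n : ℕ) : Set (Rn n) := {x | ∀ i, 0 < x i}

theorem isOpen_posOrthant (n : ℕ) : IsOpen (posOrthant n) := by
  have : posOrthant n = ⋂ i, {x : Rn n | 0 < x i} := by
    ext x; simp [posOrthant]
  rw [this]
  exact isOpen_iInter_of_finite fun i => isOpen_lt continuous_const (by fun_prop)

theorem measurableSet_posOrthant (n : ℕ) : MeasurableSet (posOrthant n) :=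
  (isOpen_posOrthant n).measurableSet

theorem volume_coord_eq_zero {n : ℕ} (i : Fin n) : volume {x : Rn n | x i = 0} = 0 := by
  have h := Measure.addHaar_submodule (volume : Measure (Rn n))
    (LinearMap.ker (EuclideanSpace.proj i : Rn n →L[ℝ] ℝ).toLinearMap) ?_
  · exact h
  · intro h
    have : EuclideanSpace.single i (1 : ℝ) ∈
        LinearMap.ker (EuclideanSpace.proj i : Rn n →L[ℝ] ℝ).toLinearMap := by
      rw [h]; trivial
    simp at this

theorem ae_coord_ne_zero (n : ℕ) : ∀ᵐ x : Rn n, ∀ i, x i ≠ 0 :=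
  ae_all_iff.2 fun i => by
    rw [ae_iff]
    simp [volume_coord_eq_zero i]

/-- The integral of a function that is invariant under the reflections. -/
theorem lintegral_of_flip_invariant {n : ℕ} (g : Rn n → ℝ≥0∞)
    (hg : ∀ s x, g (flip s x) = g x) :
    ∫⁻ x, g x = 2 ^ n * ∫⁻ x in posOrthant n, g x := by
  -- The `2 ^ n` reflected copies of the open orthant are disjoint and cover everything but the
  -- coordinate hyperplanes.
  have hU : (⋃ s : Fin n → Bool, flip s ⁻¹' posOrthant n) =ᵐ[volume] univ := by
    filter_upwards [ae_coord_ne_zero n] with x hx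
    refine propext ⟨fun _ => trivial, fun _ => ?_⟩
    refine mem_iUnion.2 ⟨fun i => decide (x i < 0), fun i => ?_⟩
    rw [flip_apply]
    by_cases h : x i < 0
    · simp [h]
    · have : 0 < x i := lt_of_le_of_ne (not_lt.1 h) (hx i).symm
      simpa [h] using this
  have hd : Pairwise (Function.onFun Disjoint fun s : Fin n → Bool => flip s ⁻¹' posOrthant n) := by
    intro s t hst
    refine Set.disjoint_left.2 fun x hx hx' => hst ?_
    ext i
    have h1 := hx i
    have h2 := hx' i
    rw [flip_apply] at h1 h2
    rcases hs : s i <;> rcases ht : t i <;> simp [hs, ht] at h1 h2 ⊢ <;> linarith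
  have hs : ∀ s : Fin n → Bool, ∫⁻ x in flip s ⁻¹' posOrthant n, g x =
      ∫⁻ x in posOrthant n, g x := by
    intro s
    have := (flip s).measurePreserving.setLIntegral_comp_preimage_emb
      (flip s).toHomeomorph.measurableEmbedding g (posOrthant n)
    rw [← this]
    exact lintegral_congr fun x => (hg s x).symm
  rw [← setLIntegral_univ g, ← setLIntegral_congr hU, lintegral_iUnion
    (fun s => (flip s).continuous.measurable (measurableSet_posOrthant n)) hd, tsum_fintype]
  simp [hs]

/-! ### Gradients, Hessians and linear isometries -/

theorem gradient_comp_isometry {n : ℕ} (L : Rn n ≃ₗᵢ[ℝ] Rn n) (f : Rn n → ℝ) (x : Rn n) :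
    gradient (fun y => f (L y)) x = L.symm (gradient f (L x)) := by
  refine ext_inner_right ℝ fun v => ?_
  rw [inner_gradient_left, ← L.inner_map_map, L.apply_symm_apply, inner_gradient_left]
  have := (L.toContinuousLinearEquiv).comp_right_fderiv (f := f) (x := x)
  exact DFunLike.congr_fun this v

theorem hess_comp_isometry {n : ℕ} (L : Rn n ≃ₗᵢ[ℝ] Rn n) {V : Rn n → ℝ}
    (hV : ∀ x, V (L x) = V x) (x u : Rn n) : hess V (L x) (L u) = L (hess V x u) := by
  have h1 : gradient V = fun y => L.symm.toContinuousLinearEquiv (gradient V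
      (L.toContinuousLinearEquiv y)) := by
    funext y
    conv_lhs => rw [show V = fun y => V (L y) from funext fun y => (hV y).symm]
    exact gradient_comp_isometry L V y
  have h2 : fderiv ℝ (gradient V) x =
      (L.symm.toContinuousLinearEquiv : Rn n →L[ℝ] Rn n).comp
        ((fderiv ℝ (gradient V) (L x)).comp (L.toContinuousLinearEquiv : Rn n →L[ℝ] Rn n)) := by
    conv_lhs => rw [h1]
    have h3 := (L.symm.toContinuousLinearEquiv).comp_fderiv
      (f := fun y => gradient V (L.toContinuousLinearEquiv y)) (x := x)
    have h4 := (L.toContinuousLinearEquiv).comp_right_fderiv (f := gradient V) (x := x)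
    refine Eq.trans h3 ?_
    congr 1
  rw [hess, hess, h2]
  simp

theorem invForm_comp_isometry {n : ℕ} (L : Rn n ≃ₗᵢ[ℝ] Rn n) {V : Rn n → ℝ}
    (hV : ∀ x, V (L x) = V x) (f : Rn n → ℝ) (x : Rn n) :
    invForm (hess V (L x)) (gradient f (L x)) =
      invForm (hess V x) (gradient (fun y => f (L y)) x) := by
  rw [gradient_comp_isometry]
  apply le_antisymm
  · refine le_iInf₂ fun η hη => ?_
    refine (iInf₂_le (L η) ?_).trans ?_
    · rw [hess_comp_isometry L hV, hη, L.apply_symm_apply]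
    · rw [← L.inner_map_map η, L.apply_symm_apply]
  · refine le_iInf₂ fun η hη => ?_
    refine (iInf₂_le (L.symm η) ?_).trans ?_
    · apply L.injective
      rw [← hess_comp_isometry L hV, L.apply_symm_apply, L.apply_symm_apply, hη]
    · rw [L.symm.inner_map_map]

theorem contDiffAt_gradient_of_contDiffAt {n : ℕ} {U : Rn n → ℝ} {x : Rn n}
    (hU : ContDiffAt ℝ 2 U x) : ContDiffAt ℝ 1 (gradient U) x := by
  have h1 : ContDiffAt ℝ 1 (fderiv ℝ U) x := hU.fderiv_right (by norm_num)
  exact ((InnerProductSpace.toDual ℝ (Rn n)).symm.contDiff.contDiffAt).comp x h1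

theorem inner_hess_of_contDiffAt {n : ℕ} {U : Rn n → ℝ} {x : Rn n} (hU : ContDiffAt ℝ 2 U x)
    (u v : Rn n) : ⟪hess U x u, v⟫ = fderiv ℝ (fderiv ℝ U) x u v := by
  have h1 : (fun y => fderiv ℝ U y v) = fun y => ⟪gradient U y, v⟫ :=
    funext fun y => inner_gradient_left.symm
  have hd : DifferentiableAt ℝ (fderiv ℝ U) x :=
    (hU.fderiv_right (m := 1) (by norm_num)).differentiableAt (by norm_num)
  have h2 : HasFDerivAt (fun y => fderiv ℝ U y v) ((fderiv ℝ (fderiv ℝ U) x).flip v) x := by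
    refine (hd.hasFDerivAt.clm_apply (hasFDerivAt_const v x)).congr_fderiv ?_
    ext w
    simp
  have h3 := ((contDiffAt_gradient_of_contDiffAt hU).differentiableAt
    (by norm_num)).hasFDerivAt.inner ℝ (hasFDerivAt_const v x)
  rw [h1] at h2
  have h4 := DFunLike.congr_fun (h2.unique h3) u
  simpa [hess] using h4.symm

/-! ### Homogeneous strictly convex potentials -/

/-- The standing assumptions on the potential. -/
structure IsPotential {n : ℕ} (p : ℝ) (V : Rn n → ℝ) : Prop where
  one_lt : 1 < p
  even : ∀ x, V (-x) = V x
  conv : StrictConvexOn ℝ univ V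
  hom : IsHomogeneousOfDegree p V
  reg : ContDiffOn ℝ 2 V {0}ᶜ
  unc : IsUnconditional V

/-- The derivative of a convex function is monotone, so its difference quotients are nonnegative.
Stated with a second derivative at one point only, it serves both `hess_nonneg` and `hess_le`. -/
theorem nonneg_of_hasDerivAt_of_convexOn {a b t c : ℝ} {g g1 : ℝ → ℝ}
    (hg : ConvexOn ℝ (Ioo a b) g) (ht : t ∈ Ioo a b) (hd : ∀ s ∈ Ioo a b, HasDerivAt g (g1 s) s)
    (hd1 : HasDerivAt g1 c t) : 0 ≤ c := by
  have hmono : MonotoneOn g1 (Ioo a b) := by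
    have := hg.monotoneOn_deriv fun x hx => (hd x hx).differentiableAt
    intro x hx y hy hxy
    have h := this hx hy hxy
    rwa [(hd x hx).deriv, (hd y hy).deriv] at h
  have hlim := (hasDerivAt_iff_tendsto_slope.1 hd1).mono_left
    (nhdsWithin_mono t (fun x (hx : t < x) => hx.ne') : 𝓝[>] t ≤ 𝓝[≠] t)
  refine ge_of_tendsto hlim ?_
  filter_upwards [Ioo_mem_nhdsGT ht.2] with y hy
  rw [slope_def_field]
  exact div_nonneg (by linarith [hmono ht ⟨ht.1.trans hy.1, hy.2⟩ hy.1.le])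
    (by linarith [hy.1])

namespace IsPotential

variable {n : ℕ} {p : ℝ} {V : Rn n → ℝ} (hV : IsPotential p V)

include hV

theorem map_zero' : V 0 = 0 := by
  have h := hV.hom 2 (by norm_num) 0
  rw [smul_zero] at h
  have h2 : (1 : ℝ) < 2 ^ p := Real.one_lt_rpow (by norm_num) (by linarith [hV.one_lt])
  nlinarith

theorem pos {x : Rn n} (hx : x ≠ 0) : 0 < V x := by
  have hne : x ≠ -x := fun h => by
    have h2 : (2 : ℝ) • x = 0 := by
      rw [two_smul]
      nth_rw 2 [h]
      exact add_neg_cancel x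
    exact hx ((smul_eq_zero.1 h2).resolve_left two_ne_zero)
  have := hV.conv.2 (mem_univ x) (mem_univ (-x)) hne (by norm_num : (0 : ℝ) < 1 / 2)
    (by norm_num : (0 : ℝ) < 1 / 2) (by norm_num)
  rw [smul_neg, add_neg_cancel, hV.map_zero', hV.even, smul_eq_mul] at this
  linarith

theorem continuous : Continuous V := by
  have := hV.conv.convexOn.continuousOn_interior
  rwa [interior_univ, continuousOn_univ] at this

/-- Take the minimum of `V` over the unit sphere and extend by homogeneity. -/
theorem exists_growth : ∃ m : ℝ, 0 < m ∧ ∀ x, m * ‖x‖ ^ p ≤ V x := by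
  have hp0 : p ≠ 0 := by linarith [hV.one_lt]
  -- The sphere is empty in dimension zero.
  rcases (Metric.sphere (0 : Rn n) 1).eq_empty_or_nonempty with h | h
  · refine ⟨1, one_pos, fun x => ?_⟩
    have hx : x = 0 := by
      by_contra hx
      have : (‖x‖⁻¹ • x) ∈ Metric.sphere (0 : Rn n) 1 := by
        simp [norm_smul, norm_ne_zero_iff.2 hx]
      rw [h] at this
      exact this
    rw [hx, norm_zero, Real.zero_rpow hp0, hV.map_zero', mul_zero]
  · obtain ⟨y, hy, hmin⟩ := (isCompact_sphere (0 : Rn n) 1).exists_isMinOn h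
      hV.continuous.continuousOn
    refine ⟨V y, hV.pos ?_, fun x => ?_⟩
    · rintro rfl
      simp at hy
    · rcases eq_or_ne x 0 with rfl | hx
      · rw [norm_zero, Real.zero_rpow hp0, hV.map_zero', mul_zero]
      · have hx' : 0 < ‖x‖ := norm_pos_iff.2 hx
        have hs : (‖x‖⁻¹ • x) ∈ Metric.sphere (0 : Rn n) 1 := by
          simp [norm_smul, norm_ne_zero_iff.2 hx]
        have h1 := hmin hs
        have h2 := hV.hom ‖x‖ hx' (‖x‖⁻¹ • x)
        rw [smul_smul, mul_inv_cancel₀ hx'.ne', one_smul] at h2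
        rw [h2, mul_comm]
        exact mul_le_mul_of_nonneg_left h1 (by positivity)

theorem lintegral_exp_neg_lt_top : ∫⁻ x, ENNReal.ofReal (Real.exp (-V x)) < ∞ := by
  obtain ⟨m, hm, hgrow⟩ := hV.exists_growth
  -- Any `N > n` makes `(1 + ‖x‖)^{-N}` integrable, and `e^{-V}` decays at least like `e^{-m‖x‖}`.
  set N : ℕ := n + 1
  have hN : (Module.finrank ℝ (Rn n) : ℝ) < N := by simp [N]
  have hfin := (integrable_one_add_norm (E := Rn n) (μ := volume) hN).const_mul
    (Real.exp (2 * m) * (N.factorial / m ^ N))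
  refine lt_of_le_of_lt (lintegral_mono fun x => ENNReal.ofReal_le_ofReal ?_)
    hfin.lintegral_lt_top
  have hr : 0 < 1 + ‖x‖ := by positivity
  have h1 : m * (‖x‖ - 1) ≤ V x := by
    refine le_trans ?_ (hgrow x)
    refine mul_le_mul_of_nonneg_left ?_ hm.le
    rcases le_or_gt 1 ‖x‖ with h | h
    · have := Real.rpow_le_rpow_of_exponent_le h hV.one_lt.le
      rw [Real.rpow_one] at this
      linarith
    · have : 0 ≤ ‖x‖ ^ p := by positivity
      linarith
  have h2 : Real.exp (-V x) ≤ Real.exp (2 * m) * Real.exp (-(m * (1 + ‖x‖))) := by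
    rw [← Real.exp_add]
    exact Real.exp_le_exp.2 (by linarith)
  have h3 : Real.exp (-(m * (1 + ‖x‖))) ≤ (N.factorial / m ^ N) * (1 + ‖x‖) ^ (-(N : ℝ)) := by
    have h4 := Real.pow_div_factorial_le_exp (m * (1 + ‖x‖)) (by positivity) N
    rw [Real.exp_neg, Real.rpow_neg hr.le, Real.rpow_natCast]
    rw [div_mul_eq_mul_div, ← div_eq_mul_inv, div_div, ← one_div]
    rw [div_le_div_iff₀ (Real.exp_pos _) (by positivity)]
    rw [div_le_iff₀ (by positivity), mul_pow] at h4
    linarith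
  calc Real.exp (-V x) ≤ _ := h2
    _ ≤ Real.exp (2 * m) * ((N.factorial / m ^ N) * (1 + ‖x‖) ^ (-(N : ℝ))) := by gcongr
    _ = _ := by ring

theorem lintegral_exp_neg_ne_zero : ∫⁻ x, ENNReal.ofReal (Real.exp (-V x)) ≠ 0 := by
  have hm : Measurable fun x => ENNReal.ofReal (Real.exp (-V x)) := by
    have := hV.continuous.measurable
    fun_prop
  rw [Ne, lintegral_eq_zero_iff hm]
  intro h
  have h2 : ∀ᵐ _ : Rn n, False := by
    filter_upwards [h] with x hx
    simp only [Pi.zero_apply, ENNReal.ofReal_eq_zero] at hx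
    exact absurd hx (not_le.2 (Real.exp_pos _))
  rw [eventually_false_iff_eq_bot, ae_eq_bot] at h2
  exact NeZero.ne _ h2

theorem lintegral_gibbs (g : Rn n → ℝ≥0∞) : ∫⁻ x, g x ∂(gibbs V) =
    (∫⁻ x : Rn n, ENNReal.ofReal (Real.exp (-V x)))⁻¹ *
      ∫⁻ x, ENNReal.ofReal (Real.exp (-V x)) * g x := by
  have hm : Measurable fun x => ENNReal.ofReal (Real.exp (-V x)) := by
    have := hV.continuous.measurable
    fun_prop
  rw [gibbs, lintegral_smul_measure, lintegral_withDensity_eq_lintegral_mul_non_measurable _ hm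
    (Eventually.of_forall fun x => ENNReal.ofReal_lt_top)]
  rfl

theorem isProbabilityMeasure_gibbs : IsProbabilityMeasure (gibbs V) := by
  constructor
  rw [← lintegral_one, hV.lintegral_gibbs]
  simp only [mul_one]
  exact ENNReal.inv_mul_cancel hV.lintegral_exp_neg_ne_zero hV.lintegral_exp_neg_lt_top.ne

/-! Derivatives away from the origin. -/

theorem contDiffAt {x : Rn n} (hx : x ≠ 0) : ContDiffAt ℝ 2 V x :=
  hV.reg.contDiffAt (isOpen_compl_singleton.mem_nhds hx)

theorem hasFDerivAt {x : Rn n} (hx : x ≠ 0) : HasFDerivAt V (fderiv ℝ V x) x :=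
  ((hV.contDiffAt hx).differentiableAt (by norm_num)).hasFDerivAt

theorem contDiffAt_gradient {x : Rn n} (hx : x ≠ 0) : ContDiffAt ℝ 1 (gradient V) x :=
  contDiffAt_gradient_of_contDiffAt (hV.contDiffAt hx)

theorem hasFDerivAt_gradient {x : Rn n} (hx : x ≠ 0) :
    HasFDerivAt (gradient V) (hess V x) x :=
  ((hV.contDiffAt_gradient hx).differentiableAt (by norm_num)).hasFDerivAt

theorem continuousAt_hess {x : Rn n} (hx : x ≠ 0) : ContinuousAt (hess V) x :=
  ((hV.contDiffAt_gradient hx).fderiv_right (m := 0) (by norm_num)).continuousAt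

theorem inner_hess {x : Rn n} (hx : x ≠ 0) (u v : Rn n) :
    ⟪hess V x u, v⟫ = fderiv ℝ (fderiv ℝ V) x u v :=
  inner_hess_of_contDiffAt (hV.contDiffAt hx) u v

theorem hess_symm {x : Rn n} (hx : x ≠ 0) (u v : Rn n) :
    ⟪hess V x u, v⟫ = ⟪hess V x v, u⟫ := by
  rw [hV.inner_hess hx, hV.inner_hess hx]
  exact ((hV.contDiffAt hx).isSymmSndFDerivAt (by simp)) u v

theorem hasDerivAt_line {x : Rn n} (v : Rn n) {s : ℝ} (hx : x + s • v ≠ 0) :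
    HasDerivAt (fun s : ℝ => V (x + s • v)) ⟪gradient V (x + s • v), v⟫ s := by
  have hl : HasDerivAt (fun s : ℝ => x + s • v) v s := by
    simpa using ((hasDerivAt_id s).smul_const v).const_add x
  rw [inner_gradient_left]
  exact (hV.hasFDerivAt hx).comp_hasDerivAt s hl

theorem hasDerivAt_gradient_line {x : Rn n} (v : Rn n) {s : ℝ} (hx : x + s • v ≠ 0) :
    HasDerivAt (fun s : ℝ => gradient V (x + s • v)) (hess V (x + s • v) v) s := by
  have hl : HasDerivAt (fun s : ℝ => x + s • v) v s := by
    simpa using ((hasDerivAt_id s).smul_const v).const_add x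
  exact (hV.hasFDerivAt_gradient hx).comp_hasDerivAt s hl

theorem convexOn_line (x v : Rn n) : ConvexOn ℝ univ fun s : ℝ => V (x + s • v) := by
  refine ⟨convex_univ, fun s _ t _ a b ha hb hab => ?_⟩
  have := hV.conv.convexOn.2 (mem_univ (x + s • v)) (mem_univ (x + t • v)) ha hb hab
  refine le_trans (le_of_eq (congrArg V ?_)) this
  obtain rfl : b = 1 - a := by linarith
  simp only [smul_eq_mul]
  module

theorem hess_nonneg {x : Rn n} (hx : x ≠ 0) (v : Rn n) : 0 ≤ ⟪hess V x v, v⟫ := by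
  have hopen : {s : ℝ | x + s • v ≠ 0} ∈ 𝓝 (0 : ℝ) := by
    refine (isOpen_ne_fun (by fun_prop) continuous_const).mem_nhds ?_
    simpa using hx
  obtain ⟨ε, hε, hball⟩ := Metric.mem_nhds_iff.1 hopen
  rw [Real.ball_eq_Ioo, zero_sub, zero_add] at hball
  have hconv : ConvexOn ℝ (Ioo (-ε) ε) fun s : ℝ => V (x + s • v) :=
    (hV.convexOn_line x v).subset (subset_univ _) (convex_Ioo _ _)
  refine nonneg_of_hasDerivAt_of_convexOn hconv (t := 0) ⟨by linarith, hε⟩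
    (fun s hs => hV.hasDerivAt_line v (hball hs)) ?_
  have h := (hV.hasDerivAt_gradient_line (x := x) v (s := 0) (by simpa using hx)).inner ℝ
    (hasDerivAt_const (0 : ℝ) v)
  simpa using h

/-- The weak tangent inequality at the midpoint, combined with strict convexity on the segment,
becomes strict at the end point. -/
theorem lt_of_ne {x y : Rn n} (hx : x ≠ 0) (hxy : y ≠ x) :
    V x + ⟪gradient V x, y - x⟫ < V y := by
  have key : ∀ z : Rn n, V x + ⟪gradient V x, z - x⟫ ≤ V z := by
    intro z
    have hd := hV.hasDerivAt_line (x := x) (z - x) (s := 0) (by simpa using hx)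
    have := (hV.convexOn_line x (z - x)).le_slope_of_hasDerivAt (mem_univ 0) (mem_univ 1)
      one_pos hd
    rw [slope_def_field, zero_smul, one_smul, add_zero, add_sub_cancel] at this
    linarith
  have hmid := hV.conv.2 (mem_univ x) (mem_univ y) hxy.symm (by norm_num : (0 : ℝ) < 1 / 2)
    (by norm_num : (0 : ℝ) < 1 / 2) (by norm_num)
  have h1 := key ((1 / 2 : ℝ) • x + (1 / 2 : ℝ) • y)
  have h2 : (1 / 2 : ℝ) • x + (1 / 2 : ℝ) • y - x = (1 / 2 : ℝ) • (y - x) := by module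
  rw [h2, inner_smul_right] at h1
  simp only [smul_eq_mul] at hmid
  linarith

/-- Euler's identity: differentiate `V((1 + s)x) = (1 + s)^p V(x)` at `s = 0`. -/
theorem inner_gradient_self {x : Rn n} (hx : x ≠ 0) : ⟪gradient V x, x⟫ = p * V x := by
  have h1 : HasDerivAt (fun s : ℝ => V (x + s • x)) ⟪gradient V (x + (0 : ℝ) • x), x⟫ 0 :=
    hV.hasDerivAt_line x (by simpa using hx)
  have h2 : HasDerivAt (fun s : ℝ => (1 + s) ^ p * V x) (p * V x) 0 := by
    have := (((hasDerivAt_id (0 : ℝ)).const_add 1).rpow_const (p := p)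
      (Or.inl (by norm_num))).mul_const (V x)
    simpa using this
  have h3 : (fun s : ℝ => V (x + s • x)) =ᶠ[𝓝 0] fun s : ℝ => (1 + s) ^ p * V x := by
    filter_upwards [lt_mem_nhds (by norm_num : (-1 : ℝ) < 0)] with s hs
    rw [← hV.hom (1 + s) (by linarith) x, add_smul, one_smul]
  have := h1.unique (h2.congr_of_eventuallyEq h3)
  simpa using this

theorem flip_eq (s : Fin n → Bool) (x : Rn n) : V (flip s x) = V x := hV.unc.flip s x

/-- The gradient points away from the coordinate hyperplanes. -/
theorem coord_mul_gradient_pos {x : Rn n} {i : Fin n} (hi : x i ≠ 0) :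
    0 < x i * gradient V x i := by
  have hx : x ≠ 0 := fun h => hi (by rw [h]; rfl)
  -- The mirror image `y` of `x` has `V y = V x`, so the strict tangent inequality reads `-2 xᵢ
  -- ∂ᵢV(x) < 0`.
  set y := flip (fun j => decide (j = i)) x
  have hy : y - x = (-2 * x i) • EuclideanSpace.single i (1 : ℝ) := by
    ext j
    simp only [y, PiLp.sub_apply, flip_apply, PiLp.smul_apply, smul_eq_mul,
      PiLp.single_apply]
    by_cases h : j = i
    · subst h; simp; ring
    · simp [h]
  have hne : y ≠ x := by
    intro h
    rw [h, sub_self] at hy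
    have := congrArg (fun z : Rn n => z i) hy
    simp at this
    exact hi this
  have := hV.lt_of_ne hx hne
  rw [hV.flip_eq, hy, inner_smul_right, EuclideanSpace.inner_single_right] at this
  simp at this
  linarith

theorem gradient_coord_eq_zero {x : Rn n} {i : Fin n} (hi : x i = 0) : gradient V x i = 0 := by
  set s : Fin n → Bool := fun j => decide (j = i)
  have h1 := gradient_comp_isometry (flip s) V x
  have h2 : (fun y => V (flip s y)) = V := funext fun y => hV.flip_eq s y
  have h3 : flip s x = x := by
    ext j
    rw [flip_apply]
    by_cases h : j = i
    · subst h; simp [s, hi]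
    · simp [s, h]
  rw [h2, h3, flip_symm] at h1
  have h4 := congrArg (fun z : Rn n => z i) h1
  simp only [flip_apply, s, decide_true, if_true] at h4
  linarith

end IsPotential

/-- The variance is the least second moment about a constant. -/
theorem evariance_le_lintegral_sq_sub {α : Type*} [MeasurableSpace α] {μ : Measure α}
    [IsProbabilityMeasure μ] {f : α → ℝ} (hf : AEStronglyMeasurable f μ) (c : ℝ) :
    evariance f μ ≤ ∫⁻ x, ENNReal.ofReal ((f x - c) ^ 2) ∂μ := by
  by_cases h : MemLp f 2 μ
  · have h2 : MemLp (fun x => f x - c) 2 μ := h.sub (memLp_const c)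
    rw [← ofReal_variance h, ← variance_sub_const hf c,
      ← ofReal_integral_eq_lintegral_ofReal h2.integrable_sq
        (Eventually.of_forall fun x => sq_nonneg _)]
    exact ENNReal.ofReal_le_ofReal (variance_le_expectation_sq h2.1)
  · have h2 : ¬ MemLp (fun x => f x - c) 2 μ := by
      intro h2
      apply h
      have := h2.add (memLp_const c)
      refine this.congr_norm hf (Eventually.of_forall fun x => ?_)
      simp
    have h3 : ∫⁻ x, ENNReal.ofReal ((f x - c) ^ 2) ∂μ = ∞ := by
      by_contra h4
      apply h2
      rw [memLp_two_iff_integrable_sq (f := fun x => f x - c) (hf.sub aestronglyMeasurable_const)]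
      refine ⟨(hf.sub aestronglyMeasurable_const).pow 2, ?_⟩
      rw [hasFiniteIntegral_iff_ofReal (Eventually.of_forall fun x => sq_nonneg _)]
      exact lt_top_iff_ne_top.2 h4
    rw [h3]
    exact le_top

/-! ### Positive definite operators -/

theorem exists_equiv_of_inner_pos {n : ℕ} {A : Rn n →L[ℝ] Rn n}
    (hA : ∀ u, u ≠ 0 → 0 < ⟪A u, u⟫) : ∃ e : Rn n ≃L[ℝ] Rn n, (e : Rn n →L[ℝ] Rn n) = A := by
  have hinj : Function.Injective A.toLinearMap := by
    rw [← LinearMap.ker_eq_bot, LinearMap.ker_eq_bot']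
    intro u hu
    by_contra hne
    have := hA u hne
    rw [show A u = 0 from hu, inner_zero_left] at this
    exact lt_irrefl _ this
  refine ⟨(LinearEquiv.ofInjectiveEndo A.toLinearMap hinj).toContinuousLinearEquiv, ?_⟩
  ext u
  simp

theorem inverse_apply_self {n : ℕ} {A : Rn n →L[ℝ] Rn n}
    (hA : ∀ u, u ≠ 0 → 0 < ⟪A u, u⟫) (ξ : Rn n) :
    A (ContinuousLinearMap.inverse A ξ) = ξ := by
  obtain ⟨e, rfl⟩ := exists_equiv_of_inner_pos hA
  simp

theorem invForm_eq_of_inner_pos {n : ℕ} {A : Rn n →L[ℝ] Rn n}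
    (hA : ∀ u, u ≠ 0 → 0 < ⟪A u, u⟫) (ξ : Rn n) :
    invForm A ξ = ENNReal.ofReal ⟪ContinuousLinearMap.inverse A ξ, ξ⟫ := by
  obtain ⟨e, rfl⟩ := exists_equiv_of_inner_pos hA
  rw [invForm_of_equiv, ContinuousLinearMap.inverse_equiv]
  rfl

theorem continuousAt_inverse_of_inner_pos {X : Type*} [TopologicalSpace X] {n : ℕ}
    {A : X → Rn n →L[ℝ] Rn n} {x : X} (hc : ContinuousAt A x)
    (hA : ∀ u, u ≠ 0 → 0 < ⟪A x u, u⟫) :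
    ContinuousAt (fun y => ContinuousLinearMap.inverse (A y)) x := by
  obtain ⟨e, he⟩ := exists_equiv_of_inner_pos hA
  have h := (contDiffAt_map_inverse (𝕜 := ℝ) (n := 0) e).continuousAt
  rw [he] at h
  exact h.comp hc

/-! ### The Brascamp–Lieb inequality on the whole space -/

/-- If the means over larger and larger cubes give uniformly bounded centred second moments, some
constant works on the whole space. -/
theorem exists_const_of_forall_cube {n : ℕ} {g w : Rn n → ℝ} (hg : Continuous g)
    (hw : Continuous w) (hw0 : ∀ x, 0 < w x) (K : ℝ≥0∞)
    (h : ∀ k : ℕ, ∃ m : ℝ, ∫⁻ x in cube n k, ENNReal.ofReal ((g x - m) ^ 2 * w x) ≤ K) :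
    ∃ c : ℝ, ∫⁻ x, ENNReal.ofReal ((g x - c) ^ 2 * w x) ≤ K := by
  rcases eq_or_ne K ∞ with rfl | hK
  · exact ⟨0, le_top⟩
  choose m hm using h
  have hfin : ∀ u : Rn n → ℝ, Continuous u →
      ∫⁻ x in cube n 1, ENNReal.ofReal (u x) < ∞ := fun u hu =>
    (hu.continuousOn.integrableOn_compact (isCompact_cube n 1)).lintegral_lt_top
  set M := ∫⁻ x in cube n 1, ENNReal.ofReal (w x) with hM
  have hM0 : M ≠ 0 := by
    rw [hM, Ne, setLIntegral_eq_zero_iff' (isCompact_cube n 1).isClosed.measurableSet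
      (by fun_prop)]
    intro hae
    have h0 : volume (cube n 1) = 0 := by
      rw [← compl_compl (cube n 1), ← mem_ae_iff]
      filter_upwards [hae] with x hx hx1
      exact absurd (ENNReal.ofReal_eq_zero.1 (hx hx1)) (not_le.2 (hw0 x))
    have hnhds : cube n 1 ∈ 𝓝 (0 : Rn n) := by
      have : ∀ᶠ x : Rn n in 𝓝 0, ∀ i, x i ∈ Icc (-1 : ℝ) 1 := by
        rw [eventually_all]
        intro i
        have hc : ContinuousAt (fun x : Rn n => x i) 0 := by fun_prop
        exact hc (Icc_mem_nhds (by simp) (by simp))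
      exact this
    exact (Measure.measure_pos_of_mem_nhds volume hnhds).ne' h0
  have hMtop : M ≠ ∞ := (hfin w hw).ne
  set K' := 2 * K + ∫⁻ x in cube n 1, ENNReal.ofReal (2 * g x ^ 2 * w x) with hK'
  have hK'top : K' ≠ ∞ :=
    ENNReal.add_ne_top.2 ⟨ENNReal.mul_ne_top (by simp) hK, (hfin _ (by fun_prop)).ne⟩
  -- The constants `m k` cannot escape: `m² ≤ 2(g - m)² + 2g²`, integrated over the fixed cube `cube
  -- n 1` of positive mass `M`.
  have hbound : ∀ k, 1 ≤ k → ENNReal.ofReal (m k ^ 2) * M ≤ K' := by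
    intro k hk
    have hsub : cube n 1 ⊆ cube n k := by
      intro x hx i
      have : (1 : ℝ) ≤ k := by exact_mod_cast hk
      exact ⟨by linarith [(hx i).1], by linarith [(hx i).2]⟩
    calc ENNReal.ofReal (m k ^ 2) * M
        = ∫⁻ x in cube n 1, ENNReal.ofReal (m k ^ 2 * w x) := by
          rw [hM, ← lintegral_const_mul' _ _ ENNReal.ofReal_ne_top]
          exact lintegral_congr fun x => (ENNReal.ofReal_mul (sq_nonneg _)).symm
      _ ≤ ∫⁻ x in cube n 1, (2 * ENNReal.ofReal ((g x - m k) ^ 2 * w x) +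
            ENNReal.ofReal (2 * g x ^ 2 * w x)) := by
          refine lintegral_mono fun x => ?_
          rw [show (2 : ℝ≥0∞) = ENNReal.ofReal 2 by simp, ← ENNReal.ofReal_mul (by norm_num),
            ← ENNReal.ofReal_add (by have := hw0 x; positivity) (by have := hw0 x; positivity)]
          refine ENNReal.ofReal_le_ofReal ?_
          nlinarith [hw0 x, mul_nonneg (sq_nonneg (2 * g x - m k)) (hw0 x).le]
      _ = (2 * ∫⁻ x in cube n 1, ENNReal.ofReal ((g x - m k) ^ 2 * w x)) +
            ∫⁻ x in cube n 1, ENNReal.ofReal (2 * g x ^ 2 * w x) := by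
          rw [lintegral_add_right _ (by fun_prop), lintegral_const_mul' _ _ (by simp)]
      _ ≤ K' := by
          rw [hK']
          gcongr
          exact (lintegral_mono_set hsub).trans (hm k)
  have hbdd : ∀ k, m (k + 1) ∈ Metric.closedBall (0 : ℝ) (Real.sqrt (K' / M).toReal) := by
    intro k
    have h1 := hbound (k + 1) (by omega)
    rw [← ENNReal.le_div_iff_mul_le (Or.inl hM0) (Or.inl hMtop)] at h1
    have h2 : m (k + 1) ^ 2 ≤ (K' / M).toReal :=
      (ENNReal.ofReal_le_iff_le_toReal (ENNReal.div_ne_top hK'top hM0)).1 h1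
    rw [mem_closedBall_zero_iff, Real.norm_eq_abs]
    exact Real.abs_le_sqrt h2
  -- The constant is the limit of a subsequence of the `m k`; Fatou's lemma passes the bound to the
  -- whole space.
  obtain ⟨c, -, φ, hφ, hc⟩ := tendsto_subseq_of_bounded Metric.isBounded_closedBall hbdd
  refine ⟨c, ?_⟩
  set F : ℕ → Rn n → ℝ≥0∞ := fun k => (cube n ((φ k + 1 : ℕ) : ℝ)).indicator fun x =>
    ENNReal.ofReal ((g x - m (φ k + 1)) ^ 2 * w x) with hF
  have hFm : ∀ k, Measurable (F k) := fun k =>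
    (by fun_prop : Measurable fun x => ENNReal.ofReal ((g x - m (φ k + 1)) ^ 2 * w x)).indicator
      (isCompact_cube n _).isClosed.measurableSet
  have hlim : ∀ x, Tendsto (fun k => F k x) atTop (𝓝 (ENNReal.ofReal ((g x - c) ^ 2 * w x))) := by
    intro x
    have h1 : Tendsto (fun k => ENNReal.ofReal ((g x - m (φ k + 1)) ^ 2 * w x)) atTop
        (𝓝 (ENNReal.ofReal ((g x - c) ^ 2 * w x))) :=
      (ENNReal.continuous_ofReal.tendsto _).comp (((tendsto_const_nhds.sub hc).pow 2).mul_const _)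
    refine h1.congr' ?_
    obtain ⟨N, hN⟩ := exists_nat_gt ‖x‖
    filter_upwards [eventually_ge_atTop N] with k hk
    refine (indicator_of_mem (s := cube n ((φ k + 1 : ℕ) : ℝ)) (fun i => ?_)
      fun x => ENNReal.ofReal ((g x - m (φ k + 1)) ^ 2 * w x)).symm
    have h2 : |x i| ≤ ‖x‖ := by simpa using PiLp.norm_apply_le x i
    have h3 : (N : ℝ) ≤ ((φ k + 1 : ℕ) : ℝ) := by
      exact_mod_cast (hk.trans (hφ.id_le k)).trans (Nat.le_succ _)
    exact abs_le.1 (by linarith)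
  calc ∫⁻ x, ENNReal.ofReal ((g x - c) ^ 2 * w x)
      = ∫⁻ x, liminf (fun k => F k x) atTop := lintegral_congr fun x => (hlim x).liminf_eq.symm
    _ ≤ liminf (fun k => ∫⁻ x, F k x) atTop := lintegral_liminf_le hFm
    _ ≤ K := by
        refine liminf_le_of_le (by isBoundedDefault) fun b hb => ?_
        obtain ⟨k, hk⟩ := hb.exists
        refine hk.trans ?_
        rw [hF, lintegral_indicator (isCompact_cube n _).isClosed.measurableSet]
        exact hm _

/-- The Brascamp–Lieb inequality on `ℝⁿ`. -/
theorem exists_const_brascampLieb {n : ℕ} {W f : Rn n → ℝ} (hW : ContDiff ℝ 2 W)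
    (hf : ContDiff ℝ 1 f) (hpos : ∀ x u, u ≠ 0 → 0 < ⟪hess W x u, u⟫) :
    ∃ c : ℝ, ∫⁻ x, ENNReal.ofReal ((f x - c) ^ 2 * Real.exp (-W x)) ≤
      ∫⁻ x, ENNReal.ofReal (⟪ContinuousLinearMap.inverse (hess W x) (gradient f x),
        gradient f x⟫ * Real.exp (-W x)) := by
  have cf : Continuous f := hf.continuous
  have cW : Continuous W := hW.continuous
  have chess : Continuous (hess W) := continuous_iff_continuousAt.2 fun x =>
    ((contDiffAt_gradient_of_contDiffAt hW.contDiffAt).fderiv_right (m := 0)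
      (by norm_num)).continuousAt
  have cgrad : Continuous (gradient f) :=
    (InnerProductSpace.toDual ℝ (Rn n)).symm.continuous.comp (hf.continuous_fderiv (by norm_num))
  have cinv : Continuous fun x => ContinuousLinearMap.inverse (hess W x) :=
    continuous_iff_continuousAt.2 fun x =>
      continuousAt_inverse_of_inner_pos chess.continuousAt (hpos x)
  set q : Rn n → ℝ := fun x => ⟪ContinuousLinearMap.inverse (hess W x) (gradient f x),
    gradient f x⟫ with hq
  have cq : Continuous q := (cinv.clm_apply cgrad).inner cgrad
  have sym : ∀ x u v, ⟪hess W x u, v⟫ = ⟪hess W x v, u⟫ := by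
    intro x u v
    rw [inner_hess_of_contDiffAt hW.contDiffAt, inner_hess_of_contDiffAt hW.contDiffAt]
    exact (hW.contDiffAt.isSymmSndFDerivAt (by simp)) u v
  have psd : ∀ x u, 0 ≤ ⟪hess W x u, u⟫ := by
    intro x u
    rcases eq_or_ne u 0 with rfl | hu
    · simp
    · exact (hpos x u hu).le
  -- Complete the square: with `η = (D²W)⁻¹∇f` the difference of the two sides is `⟨D²W(η - u), η -
  -- u⟩ ≥ 0`.
  have hmaj : ∀ x u, 2 * fderiv ℝ f x u - fderiv ℝ (fderiv ℝ W) x u u ≤ q x := by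
    intro x u
    rw [← inner_hess_of_contDiffAt hW.contDiffAt, ← inner_gradient_left]
    set η := ContinuousLinearMap.inverse (hess W x) (gradient f x) with hη
    have h1 : hess W x η = gradient f x := inverse_apply_self (hpos x) _
    have h2 := psd x (η - u)
    rw [map_sub, inner_sub_left, inner_sub_right, inner_sub_right, sym x u η, h1] at h2
    have h3 : q x = ⟪gradient f x, η⟫ := by rw [hq, real_inner_comm]
    linarith
  have q0 : ∀ x, 0 ≤ q x := fun x => by simpa using hmaj x 0
  refine exists_const_of_forall_cube (w := fun x => Real.exp (-W x)) cf (by fun_prop)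
    (fun x => Real.exp_pos _) _ fun k => ?_
  have hBL := brascampLiebFor_cube n k (by positivity) W f q hW hf cq hmaj
  have int : ∀ u : Rn n → ℝ, Continuous u → Integrable u (volume.restrict (cube n k)) :=
    fun u hu => hu.continuousOn.integrableOn_compact (isCompact_cube n k)
  set Z := ∫ x in cube n k, Real.exp (-W x) with hZ
  set F := ∫ x in cube n k, f x * Real.exp (-W x) with hF
  refine ⟨F / Z, ?_⟩
  have key : ∫ x in cube n k, (f x - F / Z) ^ 2 * Real.exp (-W x) ≤
      ∫ x in cube n k, q x * Real.exp (-W x) := by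
    rw [integral_sq_sub_const_expand (int _ (by fun_prop)) (int _ (by fun_prop))
      (int _ (by fun_prop)), ← hZ, ← hF]
    have hZ0 : 0 ≤ Z := integral_nonneg fun x => (Real.exp_pos _).le
    -- `Z = 0` can happen only if the restricted measure is zero, and then both sides vanish.
    rcases hZ0.eq_or_lt with h0 | h0
    · have hae : volume.restrict (cube n k) = 0 := by
        have h1 := (integral_eq_zero_iff_of_nonneg (fun x => (Real.exp_pos (-W x)).le)
          (int _ (by fun_prop))).1 h0.symm
        have h2 : ∀ᵐ _ ∂(volume.restrict (cube n k)), False := by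
          filter_upwards [h1] with x hx
          exact (Real.exp_pos _).ne' hx
        rwa [eventually_false_iff_eq_bot, ae_eq_bot] at h2
      rw [← h0, hF, hae]
      simp
    · have e : (∫ x in cube n k, f x ^ 2 * Real.exp (-W x)) - 2 * (F / Z) * F + (F / Z) ^ 2 * Z =
          (Z * (∫ x in cube n k, f x ^ 2 * Real.exp (-W x)) - F ^ 2) / Z := by
        field_simp
        ring
      rw [e, div_le_iff₀ h0]
      exact hBL
  rw [← ofReal_integral_eq_lintegral_ofReal (int _ (by fun_prop))
    (Eventually.of_forall fun x => mul_nonneg (sq_nonneg _) (Real.exp_pos _).le)]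
  refine (ENNReal.ofReal_le_ofReal key).trans ?_
  rw [ofReal_integral_eq_lintegral_ofReal (int _ (by fun_prop))
    (Eventually.of_forall fun x => mul_nonneg (q0 x) (Real.exp_pos _).le)]
  exact setLIntegral_le_lintegral _ _

/-! ### Logarithmic coordinates -/

/-- The linear map multiplying the coordinates. -/
def diagL {n : ℕ} (a : Rn n) : Rn n →L[ℝ] Rn n :=
  LinearMap.toContinuousLinearMap
    { toFun := fun u => WithLp.toLp 2 fun i => a i * u i
      map_add' := fun u v => by ext i; simp [mul_add]
      map_smul' := fun c u => by ext i; simp; ring }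

@[simp]
theorem diagL_apply {n : ℕ} (a u : Rn n) (i : Fin n) : diagL a u i = a i * u i := rfl

theorem det_diagL {n : ℕ} (a : Rn n) : (diagL a).det = ∏ i, a i := by
  rw [ContinuousLinearMap.det, ← LinearMap.det_toMatrix (EuclideanSpace.basisFun (Fin n) ℝ).toBasis,
    show LinearMap.toMatrix (EuclideanSpace.basisFun (Fin n) ℝ).toBasis
      (EuclideanSpace.basisFun (Fin n) ℝ).toBasis (diagL a).toLinearMap =
      Matrix.diagonal fun i => a i from ?_, Matrix.det_diagonal]
  ext i j
  rw [LinearMap.toMatrix_apply]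
  by_cases h : i = j
  · subst h; simp
  · simp [h]

/-- The map `t ↦ (e^{t₁}, …, e^{tₙ})`. -/
def expMap {n : ℕ} (t : Rn n) : Rn n := WithLp.toLp 2 fun i => Real.exp (t i)

@[simp]
theorem expMap_apply {n : ℕ} (t : Rn n) (i : Fin n) : expMap t i = Real.exp (t i) := rfl

theorem contDiff_expMap {n : ℕ} {k : WithTop ℕ∞} : ContDiff ℝ k (expMap (n := n)) :=
  contDiff_euclidean.2 fun i => by simp only [expMap_apply]; fun_prop

theorem hasFDerivAt_expMap {n : ℕ} (t : Rn n) : HasFDerivAt expMap (diagL (expMap t)) t := by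
  rw [← hasFDerivWithinAt_univ, hasFDerivWithinAt_euclidean]
  intro i
  rw [hasFDerivWithinAt_univ]
  have h : HasFDerivAt (fun t : Rn n => Real.exp (t i)) _ t :=
    ((EuclideanSpace.proj i : Rn n →L[ℝ] ℝ).hasFDerivAt).exp
  refine h.congr_fderiv ?_
  ext u
  simp

theorem expMap_injective {n : ℕ} : Function.Injective (expMap (n := n)) := by
  intro s t h
  ext i
  have := congrArg (fun x : Rn n => x i) h
  simpa using this

theorem range_expMap {n : ℕ} : range (expMap (n := n)) = posOrthant n := by
  ext x
  constructor
  · rintro ⟨t, rfl⟩ i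
    exact Real.exp_pos _
  · intro hx
    refine ⟨WithLp.toLp 2 fun i => Real.log (x i), ?_⟩
    ext i
    simp [Real.exp_log (hx i)]

theorem setLIntegral_posOrthant_eq {n : ℕ} (g : Rn n → ℝ≥0∞) :
    ∫⁻ x in posOrthant n, g x =
      ∫⁻ t, ENNReal.ofReal (Real.exp (∑ i, t i)) * g (expMap t) := by
  have h := lintegral_image_eq_lintegral_abs_det_fderiv_mul (volume : Measure (Rn n))
    MeasurableSet.univ (fun t _ => (hasFDerivAt_expMap t).hasFDerivWithinAt)
    (expMap_injective.injOn) g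
  rw [image_univ, range_expMap, Measure.restrict_univ] at h
  rw [h]
  refine lintegral_congr fun t => ?_
  rw [det_diagL]
  simp only [expMap_apply]
  rw [abs_of_pos (Finset.prod_pos fun i _ => Real.exp_pos (t i)), Real.exp_sum]

theorem hasDerivAt_toLp {n : ℕ} {c : Fin n → ℝ → ℝ} {c' : Fin n → ℝ} {s : ℝ}
    (h : ∀ i, HasDerivAt (c i) (c' i) s) :
    HasDerivAt (fun s => (WithLp.toLp 2 fun i => c i s : Rn n)) (WithLp.toLp 2 c') s := by
  have h1 : HasDerivAt (fun s i => c i s) c' s := hasDerivAt_pi.2 h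
  exact ((EuclideanSpace.equiv (Fin n) ℝ).symm : (Fin n → ℝ) →L[ℝ] Rn n).hasFDerivAt.comp_hasDerivAt
    s h1

theorem inner_eq_sum {n : ℕ} (x y : Rn n) : ⟪x, y⟫ = ∑ i, x i * y i := by
  rw [PiLp.inner_apply]
  exact Finset.sum_congr rfl fun i _ => by simp [mul_comm]

theorem ne_zero_of_mem_posOrthant {n : ℕ} (hn : n ≠ 0) {x : Rn n} (hx : x ∈ posOrthant n) :
    x ≠ 0 := by
  rintro rfl
  obtain ⟨k, rfl⟩ := Nat.exists_eq_succ_of_ne_zero hn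
  exact lt_irrefl (0 : ℝ) (hx 0)

namespace IsPotential

variable {n : ℕ} {p : ℝ} {V : Rn n → ℝ} (hV : IsPotential p V)

include hV

theorem gradient_pos {x : Rn n} (hx : x ∈ posOrthant n) (i : Fin n) : 0 < gradient V x i :=
  pos_of_mul_pos_right (hV.coord_mul_gradient_pos (hx i).ne') (hx i).le

/-- The concavity of `x ↦ V (x ^ (1 / p))` as an upper bound for the Hessian. -/
theorem hess_le (hn : n ≠ 0)
    (hVconc : ConcaveOn ℝ (orthant n) fun x => V (coordPow (1 / p) x))
    {x : Rn n} (hx : x ∈ posOrthant n) (v : Rn n) :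
    ⟪hess V x v, v⟫ ≤ (p - 1) * ∑ i, gradient V x i * v i ^ 2 / x i := by
  have hp0 : 0 < p := by linarith [hV.one_lt]
  -- The line `y + s w` is chosen so that its coordinatewise `1/p`-th power passes through `x` at `s
  -- = 0` with velocity `v`; along it `V` is concave.
  set y : Rn n := WithLp.toLp 2 fun i => x i ^ p with hy
  set w : Rn n := WithLp.toLp 2 fun i => p * x i ^ (p - 1) * v i with hw
  have hy0 : ∀ i, 0 < y i := fun i => Real.rpow_pos_of_pos (hx i) p
  have hnear : ∀ᶠ s : ℝ in 𝓝 0, ∀ i, 0 < y i + s * w i := by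
    rw [eventually_all]
    intro i
    have hc : ContinuousAt (fun s : ℝ => y i + s * w i) 0 := by fun_prop
    exact hc.eventually (lt_mem_nhds (by simpa using hy0 i))
  obtain ⟨ε, hε, hball⟩ := Metric.eventually_nhds_iff_ball.1 hnear
  rw [Real.ball_eq_Ioo, zero_sub, zero_add] at hball
  -- the curve and its derivatives
  set c : ℝ → Rn n := fun s => coordPow (1 / p) (y + s • w) with hc
  set c1 : ℝ → Rn n := fun s => WithLp.toLp 2 fun i =>
    w i * (1 / p) * (y i + s * w i) ^ (1 / p - 1) with hc1
  have hlin : ∀ i s, HasDerivAt (fun s : ℝ => y i + s * w i) (w i) s := fun i s => by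
    simpa using ((hasDerivAt_id s).mul_const (w i)).const_add (y i)
  have dc : ∀ s ∈ Ioo (-ε) ε, HasDerivAt c (c1 s) s := fun s hs =>
    hasDerivAt_toLp fun i => (hlin i s).rpow_const (p := 1 / p) (Or.inl (hball s hs i).ne')
  have h0 : (0 : ℝ) ∈ Ioo (-ε) ε := ⟨by linarith, hε⟩
  -- The acceleration of the curve at `s = 0` produces the gradient term of the bound.
  have dc1 : HasDerivAt c1 (WithLp.toLp 2 fun i => (1 - p) * v i ^ 2 / x i) 0 := by
    refine hasDerivAt_toLp fun i => ?_
    have h1 := ((hlin i 0).rpow_const (p := 1 / p - 1) (Or.inl (hball 0 h0 i).ne')).const_mul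
      (w i * (1 / p))
    refine h1.congr_deriv ?_
    simp only [zero_mul, add_zero, hy, hw]
    rw [← Real.rpow_mul (hx i).le]
    have e1 : p * (1 / p - 1 - 1) = 1 - 2 * p := by field_simp; ring
    have e2 : x i ^ (1 - 2 * p) * (x i ^ (p - 1) * x i ^ (p - 1)) = 1 / x i := by
      rw [← Real.rpow_add (hx i), ← Real.rpow_add (hx i), one_div, ← Real.rpow_neg_one]
      congr 1
      ring
    rw [e1]
    have e3 : p * x i ^ (p - 1) * v i * (1 / p) *
        (p * x i ^ (p - 1) * v i * (1 / p - 1) * x i ^ (1 - 2 * p)) =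
        p * (1 / p) * (p * (1 / p - 1)) * v i ^ 2 *
          (x i ^ (1 - 2 * p) * (x i ^ (p - 1) * x i ^ (p - 1))) := by ring
    rw [e3, e2]
    field_simp
  have hcx : c 0 = x := by
    ext i
    simp only [hc, zero_smul, add_zero, coordPow, hy]
    rw [← Real.rpow_mul (hx i).le, mul_one_div_cancel hp0.ne', Real.rpow_one]
  have hc1v : c1 0 = v := by
    ext i
    simp only [hc1, zero_mul, add_zero, hy, hw]
    rw [← Real.rpow_mul (hx i).le]
    have e1 : p * (1 / p - 1) = 1 - p := by field_simp
    rw [e1]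
    have e2 : x i ^ (p - 1) * x i ^ (1 - p) = 1 := by
      rw [← Real.rpow_add (hx i)]; simp
    have e3 : p * x i ^ (p - 1) * v i * (1 / p) * x i ^ (1 - p) =
      (p * (1 / p)) * (x i ^ (p - 1) * x i ^ (1 - p)) * v i := by ring
    rw [e3, e2, mul_one_div_cancel hp0.ne']
    ring
  have hcpos : ∀ s ∈ Ioo (-ε) ε, c s ∈ posOrthant n := fun s hs i =>
    Real.rpow_pos_of_pos (hball s hs i) _
  have hconv : ConvexOn ℝ (Ioo (-ε) ε) fun s => -V (c s) := by
    refine ⟨convex_Ioo _ _, fun s hs t ht a b ha hb hab => ?_⟩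
    have hmem : ∀ s ∈ Ioo (-ε) ε, y + s • w ∈ orthant n := fun s hs i => (hball s hs i).le
    have h1 := hVconc.2 (hmem s hs) (hmem t ht) ha hb hab
    have h2 : a • (y + s • w) + b • (y + t • w) = y + (a • s + b • t) • w := by
      obtain rfl : b = 1 - a := by linarith
      simp only [smul_eq_mul]
      module
    rw [h2] at h1
    simp only [smul_eq_mul, hc] at h1 ⊢
    linarith
  have hd : ∀ s ∈ Ioo (-ε) ε, HasDerivAt (fun s => -V (c s)) (-⟪gradient V (c s), c1 s⟫) s := by
    intro s hs
    rw [inner_gradient_left]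
    exact ((hV.hasFDerivAt (ne_zero_of_mem_posOrthant hn (hcpos s hs))).comp_hasDerivAt s
      (dc s hs)).neg
  have hx0 := ne_zero_of_mem_posOrthant hn hx
  have hgrad : HasDerivAt (fun s => gradient V (c s)) (hess V x v) 0 := by
    have h1 : HasFDerivAt (gradient V) (hess V x) (c 0) := by
      rw [hcx]; exact hV.hasFDerivAt_gradient hx0
    have h2 := h1.comp_hasDerivAt 0 (dc 0 h0)
    rwa [hc1v] at h2
  have hd1 := (hgrad.inner ℝ dc1).neg
  have := nonneg_of_hasDerivAt_of_convexOn hconv h0 hd hd1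
  rw [hcx, hc1v, inner_eq_sum (gradient V x)] at this
  have e : ∑ i, gradient V x i * ((1 - p) * v i ^ 2 / x i) =
      -((p - 1) * ∑ i, gradient V x i * v i ^ 2 / x i) := by
    rw [Finset.mul_sum, ← Finset.sum_neg_distrib]
    exact Finset.sum_congr rfl fun i _ => by ring
  rw [e] at this
  linarith

/-- The potential in logarithmic coordinates. -/
theorem contDiff_logPotential (hn : n ≠ 0) :
    ContDiff ℝ 2 fun t : Rn n => V (expMap t) - ∑ i, t i := by
  refine ContDiff.sub ?_ (by fun_prop)
  refine contDiff_iff_contDiffAt.2 fun t => ?_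
  exact (hV.contDiffAt (ne_zero_of_mem_posOrthant hn
    (range_expMap ▸ mem_range_self t))).comp t contDiff_expMap.contDiffAt

/-- Both expressions for the first derivative along `t + s u` are differentiated at `s = 0`. The sum
over `i` comes from the second derivative of the exponential; the linear term `∑ tᵢ` drops out. -/
theorem hess_logPotential (hn : n ≠ 0) (t u : Rn n) :
    ⟪hess (fun t : Rn n => V (expMap t) - ∑ i, t i) t u, u⟫ =
      ⟪hess V (expMap t) (diagL (expMap t) u), diagL (expMap t) u⟫ +
        ∑ i, gradient V (expMap t) i * (Real.exp (t i) * u i ^ 2) := by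
  set W : Rn n → ℝ := fun t => V (expMap t) - ∑ i, t i with hW
  have hWc : ContDiff ℝ 2 W := hV.contDiff_logPotential hn
  have hmem : ∀ t : Rn n, expMap t ≠ 0 := fun t =>
    ne_zero_of_mem_posOrthant hn (range_expMap ▸ mem_range_self t)
  have hl : ∀ s : ℝ, HasDerivAt (fun s : ℝ => t + s • u) u s := fun s => by
    simpa using ((hasDerivAt_id s).smul_const u).const_add t
  have dE : ∀ s : ℝ, HasDerivAt (fun s : ℝ => expMap (t + s • u)) (diagL (expMap (t + s • u)) u) s :=
    fun s => (hasFDerivAt_expMap _).comp_hasDerivAt s (hl s)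
  have hW1 : ∀ s : ℝ, HasDerivAt (fun s : ℝ => W (t + s • u)) ⟪gradient W (t + s • u), u⟫ s := by
    intro s
    rw [inner_gradient_left]
    exact ((hWc.differentiable (by norm_num) _).hasFDerivAt).comp_hasDerivAt s (hl s)
  have hV1 : ∀ s : ℝ, HasDerivAt (fun s : ℝ => W (t + s • u))
      (⟪gradient V (expMap (t + s • u)), diagL (expMap (t + s • u)) u⟫ - ∑ i, u i) s := by
    intro s
    rw [inner_gradient_left]
    refine ((hV.hasFDerivAt (hmem _)).comp_hasDerivAt s (dE s)).sub ?_
    exact HasDerivAt.fun_sum fun i _ => by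
      simpa using ((hasDerivAt_id s).mul_const (u i)).const_add (t i)
  have heq : (fun s : ℝ => ⟪gradient W (t + s • u), u⟫) =
      fun s => ⟪gradient V (expMap (t + s • u)), diagL (expMap (t + s • u)) u⟫ - ∑ i, u i :=
    funext fun s => (hW1 s).unique (hV1 s)
  have d1 : HasDerivAt (fun s : ℝ => ⟪gradient W (t + s • u), u⟫) ⟪hess W t u, u⟫ 0 := by
    have h1 : HasFDerivAt (gradient W) (hess W t) (t + (0 : ℝ) • u) := by
      rw [zero_smul, add_zero]
      exact ((contDiffAt_gradient_of_contDiffAt hWc.contDiffAt).differentiableAt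
        (by norm_num)).hasFDerivAt
    have h2 := (h1.comp_hasDerivAt 0 (hl 0)).inner ℝ (hasDerivAt_const (0 : ℝ) u)
    simpa using h2
  have d2 : HasDerivAt (fun s : ℝ => diagL (expMap (t + s • u)) u)
      (WithLp.toLp 2 fun i => Real.exp (t i) * u i ^ 2) 0 := by
    refine hasDerivAt_toLp fun i => ?_
    have h1 : HasDerivAt (fun s : ℝ => t i + s * u i) (u i) 0 := by
      simpa using ((hasDerivAt_id (0 : ℝ)).mul_const (u i)).const_add (t i)
    refine (h1.exp.mul_const (u i)).congr_deriv ?_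
    rw [zero_mul, add_zero]
    ring
  have d3 : HasDerivAt (fun s : ℝ => gradient V (expMap (t + s • u)))
      (hess V (expMap t) (diagL (expMap t) u)) 0 := by
    have h1 := (hV.hasFDerivAt_gradient (hmem (t + (0 : ℝ) • u))).comp_hasDerivAt 0 (dE 0)
    simp only [zero_smul, add_zero] at h1
    exact h1
  rw [heq] at d1
  have := d1.unique ((d3.inner ℝ d2).sub_const (∑ i, u i))
  rw [this]
  simp only [zero_smul, add_zero]
  rw [inner_eq_sum (gradient V (expMap t)), add_comm]

/-- The inequality for unconditional functions. -/
theorem exists_const_of_unconditional (hVconc : ConcaveOn ℝ (orthant n) fun x =>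
    V (coordPow (1 / p) x)) {f : Rn n → ℝ} (hf : ContDiff ℝ 1 f) (hfu : IsUnconditional f) :
    ∃ c : ℝ, ∫⁻ x, ENNReal.ofReal (Real.exp (-V x)) * ENNReal.ofReal ((f x - c) ^ 2) ≤
      ENNReal.ofReal (1 - 1 / p) *
        ∫⁻ x, ENNReal.ofReal (Real.exp (-V x)) * invForm (hess V x) (gradient f x) := by
  rcases eq_or_ne n 0 with rfl | hn
  · refine ⟨f 0, ?_⟩
    have : ∀ x : Rn 0, f x - f 0 = 0 := fun x => by rw [Subsingleton.elim x 0, sub_self]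
    simp [this]
  have hp1 := hV.one_lt
  have hp0 : 0 < p := by linarith
  set W : Rn n → ℝ := fun t => V (expMap t) - ∑ i, t i with hW
  have hO : ∀ t : Rn n, expMap t ∈ posOrthant n := fun t => range_expMap ▸ mem_range_self t
  have h0 : ∀ t : Rn n, expMap t ≠ 0 := fun t => ne_zero_of_mem_posOrthant hn (hO t)
  have hsum : ∀ t u : Rn n, ∑ i, gradient V (expMap t) i * (diagL (expMap t) u i) ^ 2 /
      expMap t i = ∑ i, gradient V (expMap t) i * (Real.exp (t i) * u i ^ 2) := fun t u =>
    Finset.sum_congr rfl fun i _ => by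
      have := (Real.exp_pos (t i)).ne'
      simp only [diagL_apply, expMap_apply]
      field_simp
  have hpos : ∀ t u, u ≠ 0 → 0 < ⟪hess W t u, u⟫ := by
    intro t u hu
    rw [hV.hess_logPotential hn]
    refine add_pos_of_nonneg_of_pos (hV.hess_nonneg (h0 t) _) ?_
    obtain ⟨i, hi⟩ : ∃ i, u i ≠ 0 := by
      by_contra! h
      exact hu (by ext i; simpa using h i)
    refine Finset.sum_pos' (fun j _ => ?_) ⟨i, Finset.mem_univ _, ?_⟩
    · have := hV.gradient_pos (hO t) j
      positivity
    · have := hV.gradient_pos (hO t) i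
      positivity
  obtain ⟨c, hc⟩ := exists_const_brascampLieb (hV.contDiff_logPotential hn)
    (hf.comp contDiff_expMap) hpos
  refine ⟨c, ?_⟩
  have hq : ∀ t, ENNReal.ofReal ⟪ContinuousLinearMap.inverse (hess W t)
      (gradient (f ∘ expMap) t), gradient (f ∘ expMap) t⟫ ≤
      ENNReal.ofReal (1 - 1 / p) * invForm (hess V (expMap t)) (gradient f (expMap t)) := by
    intro t
    have hc0 : 0 < 1 - 1 / p := by
      rw [sub_pos, div_lt_one hp0]; exact hp1
    rw [mul_comm, ← ENNReal.div_le_iff_le_mul (Or.inl (ENNReal.ofReal_pos.2 hc0).ne')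
      (Or.inl ENNReal.ofReal_ne_top), ← ENNReal.ofReal_div_of_pos hc0]
    -- `η` is any solution of `D²V η = ∇f`, so no invertibility of `D²V` is required.
    refine le_iInf₂ fun η hη => ENNReal.ofReal_le_ofReal ?_
    rw [div_le_iff₀ hc0]
    set ξ := gradient (f ∘ expMap) t with hξ
    set u := ContinuousLinearMap.inverse (hess W t) ξ with hu
    set v := diagL (expMap t) u with hv
    have h1 : hess W t u = ξ := inverse_apply_self (hpos t) ξ
    have h2 : ⟪ξ, u⟫ = ⟪gradient f (expMap t), v⟫ := by
      rw [hξ, inner_gradient_left, inner_gradient_left]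
      have := ((hf.differentiable (by norm_num) (expMap t)).hasFDerivAt).comp t
        (hasFDerivAt_expMap t)
      rw [this.fderiv]
      rfl
    have h3 : ⟪hess W t u, u⟫ = ⟪hess V (expMap t) v, v⟫ +
      ∑ i, gradient V (expMap t) i * (Real.exp (t i) * u i ^ 2) := hV.hess_logPotential hn t u
    have h4 := hV.hess_le hn hVconc (hO t) v
    rw [hsum] at h4
    rw [h1, h2] at h3
    -- With `r = p/(p-1)` and `a`, `b`, `d` as set below, this reads `d ≥ 2rb - r²a`. Since `ra ≤
    -- b`, it follows that `d ≥ rb`, which is the factor `1 - 1/p`.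
    have h5 := hV.hess_nonneg (h0 t) (η - (p / (p - 1)) • v)
    rw [map_sub, map_smul, hη] at h5
    simp only [inner_sub_left, inner_sub_right, inner_smul_left, inner_smul_right] at h5
    have h6 : ⟪hess V (expMap t) v, η⟫ = ⟪gradient f (expMap t), v⟫ := by
      rw [hV.hess_symm (h0 t), hη]
    rw [h6] at h5
    simp only [conj_trivial] at h5
    rw [real_inner_comm, h2, real_inner_comm (gradient f (expMap t)) η]
    set S := ∑ i, gradient V (expMap t) i * (Real.exp (t i) * u i ^ 2)
    set a := ⟪hess V (expMap t) v, v⟫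
    set b := ⟪gradient f (expMap t), v⟫
    set d := ⟪gradient f (expMap t), η⟫
    have hp2 : 0 < p - 1 := by linarith
    have e1 : (p / (p - 1)) * a ≤ b := by
      rw [div_mul_eq_mul_div, div_le_iff₀ hp2]
      nlinarith
    have hr : 0 < p / (p - 1) := by positivity
    have e2 : p / (p - 1) * b ≤ d := by nlinarith
    have e3 : b = (p / (p - 1) * b) * (1 - 1 / p) := by
      field_simp
    rw [e3]
    exact mul_le_mul_of_nonneg_right e2 hc0.le
  have inv1 : ∀ s x, ENNReal.ofReal (Real.exp (-V (flip s x))) *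
      ENNReal.ofReal ((f (flip s x) - c) ^ 2) =
      ENNReal.ofReal (Real.exp (-V x)) * ENNReal.ofReal ((f x - c) ^ 2) := fun s x => by
    rw [hV.flip_eq, hfu.flip]
  have inv2 : ∀ s x, ENNReal.ofReal (Real.exp (-V (flip s x))) *
      invForm (hess V (flip s x)) (gradient f (flip s x)) =
      ENNReal.ofReal (Real.exp (-V x)) * invForm (hess V x) (gradient f x) := fun s x => by
    rw [hV.flip_eq, invForm_comp_isometry (flip s) (hV.flip_eq s)]
    simp only [hfu.flip]
  rw [lintegral_of_flip_invariant _ inv1, lintegral_of_flip_invariant _ inv2, mul_left_comm]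
  gcongr
  rw [setLIntegral_posOrthant_eq, setLIntegral_posOrthant_eq,
    ← lintegral_const_mul' _ _ ENNReal.ofReal_ne_top]
  -- The Jacobian `e^{∑ tᵢ}` is absorbed into the potential; this is the origin of the term `-∑ tᵢ`
  -- in `W`.
  have hexp : ∀ t : Rn n, ENNReal.ofReal (Real.exp (∑ i, t i)) *
      ENNReal.ofReal (Real.exp (-V (expMap t))) = ENNReal.ofReal (Real.exp (-W t)) := fun t => by
    rw [← ENNReal.ofReal_mul (Real.exp_pos _).le, ← Real.exp_add]
    congr 2
    simp only [hW]
    ring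
  calc ∫⁻ t : Rn n, ENNReal.ofReal (Real.exp (∑ i, t i)) *
        (ENNReal.ofReal (Real.exp (-V (expMap t))) * ENNReal.ofReal ((f (expMap t) - c) ^ 2))
      = ∫⁻ t : Rn n, ENNReal.ofReal (((f ∘ expMap) t - c) ^ 2 * Real.exp (-W t)) := by
        refine lintegral_congr fun t => ?_
        rw [← mul_assoc, hexp, ENNReal.ofReal_mul (sq_nonneg _), mul_comm]
        rfl
    _ ≤ _ := hc
    _ ≤ _ := by
        refine lintegral_mono fun t => ?_
        rw [← mul_assoc (ENNReal.ofReal (Real.exp _)), hexp, mul_left_comm,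
          mul_comm (inner ℝ _ _) (Real.exp _), ENNReal.ofReal_mul (Real.exp_pos _).le]
        gcongr
        exact hq t

/-- The normalising constant multiplies both sides alike, and the variance is at most the second
moment about any `c`. -/
theorem strongBrascampLieb_of_exists_const {f : Rn n → ℝ} (hf : Continuous f)
    (h : ∃ c : ℝ, ∫⁻ x, ENNReal.ofReal (Real.exp (-V x)) * ENNReal.ofReal ((f x - c) ^ 2) ≤
      ENNReal.ofReal (1 - 1 / p) *
        ∫⁻ x, ENNReal.ofReal (Real.exp (-V x)) * invForm (hess V x) (gradient f x)) :
    StrongBrascampLieb p V f := by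
  obtain ⟨c, hc⟩ := h
  have := hV.isProbabilityMeasure_gibbs
  refine (evariance_le_lintegral_sq_sub hf.aestronglyMeasurable c).trans ?_
  rw [hV.lintegral_gibbs, hV.lintegral_gibbs, mul_left_comm]
  gcongr

end IsPotential

/-! ### The Legendre transform and its gradient -/

namespace IsPotential

variable {n : ℕ} {p : ℝ} {V : Rn n → ℝ} (hV : IsPotential p V)

include hV

/-- Superlinear growth of `V` confines the maximizers of `⟨y, z⟩ - V y` to one ball for all `z` in a
bounded set. -/
theorem exists_radius (B : ℝ) :
    ∃ R : ℝ, 0 < R ∧ ∀ z y : Rn n, ‖z‖ ≤ B → V y ≤ ⟪y, z⟫ → ‖y‖ ≤ R := by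
  obtain ⟨m, hm, hgrow⟩ := hV.exists_growth
  have hp1 : 0 < p - 1 := by linarith [hV.one_lt]
  have hev := (tendsto_rpow_atTop hp1).eventually_gt_atTop (B / m)
  obtain ⟨R, hR, hR0⟩ := (hev.and (eventually_gt_atTop 0)).exists
  refine ⟨R, hR0, fun z y hz hy => ?_⟩
  by_contra! hlt
  have hy0 : 0 < ‖y‖ := hR0.trans hlt
  have h1 : m * ‖y‖ ^ p ≤ ‖y‖ * B :=
    (hgrow y).trans (hy.trans ((real_inner_le_norm y z).trans
      (mul_le_mul_of_nonneg_left hz (norm_nonneg y))))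
  have h2 : ‖y‖ ^ p = ‖y‖ ^ (p - 1) * ‖y‖ := by
    rw [← Real.rpow_add_one hy0.ne']; congr 1; ring
  rw [h2] at h1
  have h3 : m * ‖y‖ ^ (p - 1) ≤ B := by
    have : m * ‖y‖ ^ (p - 1) * ‖y‖ ≤ B * ‖y‖ := by linarith
    exact le_of_mul_le_mul_right this hy0
  have h4 : R ^ (p - 1) ≤ ‖y‖ ^ (p - 1) := Real.rpow_le_rpow hR0.le hlt.le hp1.le
  rw [div_lt_iff₀ hm] at hR
  nlinarith

theorem exists_maximizer (z : Rn n) : ∃ x : Rn n, ∀ y, ⟪y, z⟫ - V y ≤ ⟪x, z⟫ - V x := by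
  obtain ⟨R, hR0, hR⟩ := hV.exists_radius ‖z‖
  have hc : Continuous fun y : Rn n => ⟪y, z⟫ - V y := by
    have := hV.continuous
    fun_prop
  obtain ⟨x, -, hx⟩ := (isCompact_closedBall (0 : Rn n) R).exists_isMaxOn
    ⟨0, Metric.mem_closedBall_self hR0.le⟩ hc.continuousOn
  refine ⟨x, fun y => ?_⟩
  by_cases hy : ‖y‖ ≤ R
  · exact hx (mem_closedBall_zero_iff.2 hy)
  · have h1 : ⟪y, z⟫ < V y := by
      by_contra! h
      exact hy (hR z y le_rfl h)
    have h2 : ⟪(0 : Rn n), z⟫ - V 0 ≤ ⟪x, z⟫ - V x := hx (Metric.mem_closedBall_self hR0.le)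
    rw [inner_zero_left, hV.map_zero'] at h2
    linarith

theorem maximizer_unique {z x x' : Rn n} (hx : ∀ y, ⟪y, z⟫ - V y ≤ ⟪x, z⟫ - V x)
    (hx' : ∀ y, ⟪y, z⟫ - V y ≤ ⟪x', z⟫ - V x') : x = x' := by
  by_contra hne
  have hmid := hV.conv.2 (mem_univ x) (mem_univ x') hne (by norm_num : (0 : ℝ) < 1 / 2)
    (by norm_num : (0 : ℝ) < 1 / 2) (by norm_num)
  have h1 := hx ((1 / 2 : ℝ) • x + (1 / 2 : ℝ) • x')
  have h2 := hx x'
  have h3 := hx' x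
  rw [inner_add_left, real_inner_smul_left, real_inner_smul_left] at h1
  simp only [smul_eq_mul] at hmid
  linarith

end IsPotential

open Classical in
/-- The point at which the supremum defining the Legendre transform is attained (`0` if there is
none). -/
def dualPoint {n : ℕ} (V : Rn n → ℝ) (z : Rn n) : Rn n :=
  if h : ∃ x : Rn n, ∀ y, ⟪y, z⟫ - V y ≤ ⟪x, z⟫ - V x then h.choose else 0

namespace IsPotential

variable {n : ℕ} {p : ℝ} {V : Rn n → ℝ} (hV : IsPotential p V)

include hV

theorem dualPoint_spec (z y : Rn n) : ⟪y, z⟫ - V y ≤ ⟪dualPoint V z, z⟫ - V (dualPoint V z) := by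
  have h := hV.exists_maximizer z
  rw [dualPoint, dif_pos h]
  exact h.choose_spec y

theorem dualPoint_eq {z x : Rn n} (hx : ∀ y, ⟪y, z⟫ - V y ≤ ⟪x, z⟫ - V x) :
    dualPoint V z = x :=
  hV.maximizer_unique (hV.dualPoint_spec z) hx

theorem legendre_eq (z : Rn n) : legendre V z = ⟪dualPoint V z, z⟫ - V (dualPoint V z) :=
  le_antisymm (ciSup_le (hV.dualPoint_spec z))
    (le_ciSup (f := fun x : Rn n => ⟪x, z⟫ - V x)
      ⟨_, forall_mem_range.2 (hV.dualPoint_spec z)⟩ (dualPoint V z))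

/-- Near `z` the maximizers stay in a compact ball, and every cluster point is a maximizer for `z`,
hence the unique one. -/
theorem continuous_dualPoint : Continuous (dualPoint V) := by
  rw [continuous_iff_continuousAt]
  intro z
  obtain ⟨R, -, hR⟩ := hV.exists_radius (‖z‖ + 1)
  refine (isCompact_closedBall (0 : Rn n) R).tendsto_nhds_of_unique_mapClusterPt ?_ ?_
  · filter_upwards [Metric.ball_mem_nhds z one_pos] with w hw
    rw [mem_closedBall_zero_iff]
    refine hR w _ ?_ ?_
    · have h1 : ‖w - z‖ < 1 := by rwa [← dist_eq_norm]
      have h2 := norm_add_le (w - z) z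
      rw [sub_add_cancel] at h2
      linarith
    · have := hV.dualPoint_spec w 0
      rw [inner_zero_left, hV.map_zero'] at this
      linarith
  · intro x _ hx
    obtain ⟨U, hU, hUx⟩ := mapClusterPt_iff_ultrafilter.1 hx
    refine (hV.dualPoint_eq fun y => ?_).symm
    have hid : Tendsto (fun w : Rn n => w) U (𝓝 z) := hU
    have cV := hV.continuous
    refine le_of_tendsto_of_tendsto' (b := (U : Filter (Rn n)))
      (((continuous_const.inner continuous_id).tendsto z |>.comp hid).sub_const (V y))
      ((hUx.inner hid).sub ((cV.tendsto x).comp hUx)) fun w => hV.dualPoint_spec w y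

/-- Write `x(z)` for the maximizer at `z`. Testing each supremum with the other maximizer gives `0 ≤
V*(w) - V*(z) - ⟨x(z), w - z⟩ ≤ ⟨x(w) - x(z), w - z⟩`, which is `o(‖w - z‖)` by continuity of `x`.
-/
theorem hasGradientAt_legendre (z : Rn n) :
    HasGradientAt (legendre V) (dualPoint V z) z := by
  rw [hasGradientAt_iff_isLittleO, Asymptotics.isLittleO_iff]
  intro ε hε
  have hc := Metric.tendsto_nhds.1 (hV.continuous_dualPoint.tendsto z) ε hε
  filter_upwards [hc] with w hw
  have h1 := hV.dualPoint_spec w (dualPoint V z)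
  have h2 := hV.dualPoint_spec z (dualPoint V w)
  rw [← hV.legendre_eq] at h1 h2
  have e1 := hV.legendre_eq z
  have e2 := hV.legendre_eq w
  have e3 : ⟪dualPoint V z, w - z⟫ = ⟪dualPoint V z, w⟫ - ⟪dualPoint V z, z⟫ := inner_sub_right _ _ _
  have e4 : ⟪dualPoint V w - dualPoint V z, w - z⟫ =
      ⟪dualPoint V w, w⟫ - ⟪dualPoint V w, z⟫ - ⟪dualPoint V z, w⟫ + ⟪dualPoint V z, z⟫ := by
    simp only [inner_sub_left, inner_sub_right]; ring
  have h3 := real_inner_le_norm (dualPoint V w - dualPoint V z) (w - z)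
  rw [dist_eq_norm] at hw
  have h4 : ‖dualPoint V w - dualPoint V z‖ * ‖w - z‖ ≤ ε * ‖w - z‖ :=
    mul_le_mul_of_nonneg_right hw.le (norm_nonneg _)
  rw [Real.norm_eq_abs, abs_le]
  constructor
  · have : 0 ≤ ε * ‖w - z‖ := by positivity
    linarith
  · linarith

theorem gradient_legendre : gradient (legendre V) = dualPoint V :=
  gradient_eq hV.hasGradientAt_legendre

theorem dualPoint_gradient {x : Rn n} (hx : x ≠ 0) : dualPoint V (gradient V x) = x := by
  refine hV.dualPoint_eq fun y => ?_
  rcases eq_or_ne y x with rfl | hy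
  · exact le_rfl
  · have := hV.lt_of_ne hx hy
    rw [inner_sub_right, real_inner_comm y, real_inner_comm x] at this
    linarith

theorem gradient_dualPoint {z : Rn n} (hz : dualPoint V z ≠ 0) :
    gradient V (dualPoint V z) = z := by
  have hmax : IsLocalMax (fun y : Rn n => ⟪z, y⟫ - V y) (dualPoint V z) :=
    Eventually.of_forall fun y => by
      have := hV.dualPoint_spec z y
      simp only [real_inner_comm _ z]
      exact this
  have hd : HasFDerivAt (fun y : Rn n => ⟪z, y⟫ - V y)
      (innerSL ℝ z - fderiv ℝ V (dualPoint V z)) (dualPoint V z) :=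
    (innerSL ℝ z).hasFDerivAt.sub (hV.hasFDerivAt hz)
  have h0 := hmax.hasFDerivAt_eq_zero hd
  refine ext_inner_right ℝ fun v => ?_
  have := DFunLike.congr_fun h0 v
  rw [inner_gradient_left]
  simp at this
  linarith

/-- Since `p > 1`, `V(rz) = r^p V(z)` is `o(r)` as `r → 0`, so moving from the origin along `z`
increases `⟨·, z⟩ - V`. -/
theorem dualPoint_ne_zero {z : Rn n} (hz : z ≠ 0) : dualPoint V z ≠ 0 := by
  intro h0
  -- the difference quotient at the origin along `z`
  have key : ∀ r : ℝ, 0 < r → ‖z‖ ^ 2 ≤ r ^ (p - 1) * V z := by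
    intro r hr
    have h1 := hV.dualPoint_spec z (r • z)
    rw [h0, inner_zero_left, hV.map_zero', hV.hom r hr, real_inner_smul_left,
      real_inner_self_eq_norm_sq] at h1
    have h2 : r ^ p = r ^ (p - 1) * r := by
      rw [← Real.rpow_add_one hr.ne']; congr 1; ring
    rw [h2] at h1
    have h3 : r * ‖z‖ ^ 2 ≤ r * (r ^ (p - 1) * V z) := by linarith
    exact le_of_mul_le_mul_left h3 hr
  have hp1 : 0 < p - 1 := by linarith [hV.one_lt]
  have hlim : Tendsto (fun r : ℝ => r ^ (p - 1) * V z) (𝓝[>] 0) (𝓝 0) := by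
    have h1 := (Real.continuousAt_rpow_const 0 (p - 1) (Or.inr hp1.le)).tendsto.mul_const (V z)
    rw [Real.zero_rpow hp1.ne', zero_mul] at h1
    exact h1.mono_left nhdsWithin_le_nhds
  have h2 : ‖z‖ ^ 2 ≤ 0 :=
    ge_of_tendsto hlim (by filter_upwards [self_mem_nhdsWithin] with r hr using key r hr)
  have := norm_pos_iff.2 hz
  nlinarith

theorem dualPoint_coord_pos {z : Rn n} {i : Fin n} (hi : 0 < z i) : 0 < dualPoint V z i := by
  have hz : z ≠ 0 := by rintro rfl; exact lt_irrefl (0 : ℝ) hi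
  have hg := hV.gradient_dualPoint (hV.dualPoint_ne_zero hz)
  have hne : dualPoint V z i ≠ 0 := by
    intro h
    have := hV.gradient_coord_eq_zero h
    rw [hg] at this
    exact hi.ne' this
  have := hV.coord_mul_gradient_pos hne
  rw [hg] at this
  exact pos_of_mul_pos_left this hi.le

theorem dualPoint_coord_eq_zero {z : Rn n} {i : Fin n} (hi : z i = 0) : dualPoint V z i = 0 := by
  by_contra hne
  have h0 : dualPoint V z ≠ 0 := fun h => hne (by rw [h]; rfl)
  have := hV.coord_mul_gradient_pos hne
  rw [hV.gradient_dualPoint h0, hi, mul_zero] at this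
  exact lt_irrefl _ this

theorem dualPoint_mem_posOrthant {z : Rn n} (hz : z ∈ posOrthant n) :
    dualPoint V z ∈ posOrthant n := fun i => hV.dualPoint_coord_pos (hz i)

theorem image_dualPoint : dualPoint V '' posOrthant n = posOrthant n := by
  rcases eq_or_ne n 0 with rfl | hn
  · have h : posOrthant 0 = univ := by ext x; simp [posOrthant]
    rw [h, image_univ]
    ext x
    exact ⟨fun _ => trivial, fun _ => ⟨0, Subsingleton.elim _ _⟩⟩
  · ext x
    constructor
    · rintro ⟨z, hz, rfl⟩
      exact hV.dualPoint_mem_posOrthant hz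
    · intro hx
      exact ⟨gradient V x, hV.gradient_pos hx,
        hV.dualPoint_gradient (ne_zero_of_mem_posOrthant hn hx)⟩

theorem injOn_dualPoint : InjOn (dualPoint V) {z | z ≠ 0} := by
  intro z hz w hw h
  rw [← hV.gradient_dualPoint (hV.dualPoint_ne_zero hz), h,
    hV.gradient_dualPoint (hV.dualPoint_ne_zero hw)]

/-- Euler's identity at the maximizer. It makes `V` in the dual variable a multiple of `V*`, which
is the source of the constant `p - 1` in `lintegral_sq_le_dual`. -/
theorem legendre_eq_mul {z : Rn n} (hz : z ≠ 0) :
    legendre V z = (p - 1) * V (dualPoint V z) := by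
  have h0 := hV.dualPoint_ne_zero hz
  have h1 := hV.inner_gradient_self h0
  rw [hV.gradient_dualPoint h0, real_inner_comm] at h1
  rw [hV.legendre_eq, h1]
  ring

/-- Where the Hessian is not positive definite, it is singular. -/
theorem exists_ker_of_not_pos {x : Rn n} (hx : x ≠ 0)
    (h : ¬ ∀ u, u ≠ 0 → 0 < ⟪hess V x u, u⟫) : ∃ u, u ≠ 0 ∧ hess V x u = 0 := by
  push Not at h
  obtain ⟨u, hu, hle⟩ := h
  refine ⟨u, hu, ?_⟩
  have h0 : ⟪hess V x u, u⟫ = 0 := le_antisymm hle (hV.hess_nonneg hx u)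
  set w := hess V x u with hw
  -- Positivity at `u + s w` for all real `s` forces the linear coefficient `2⟨w, w⟩` to vanish.
  have hd := discrim_le_zero (a := ⟪hess V x w, w⟫) (b := 2 * ⟪w, w⟫) (c := 0) fun s => by
    have h1 := hV.hess_nonneg hx (u + s • w)
    rw [map_add, map_smul] at h1
    simp only [inner_add_left, inner_add_right, inner_smul_left, inner_smul_right, ← hw,
      conj_trivial, h0, hV.hess_symm hx w u] at h1
    linarith
  rw [discrim] at hd
  have h2 : ⟪w, w⟫ = 0 := by nlinarith [sq_nonneg (⟪w, w⟫ : ℝ)]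
  exact inner_self_eq_zero.1 h2

/-- `dualPoint V` is continuous and is locally inverted by `∇V`, whose derivative is invertible
there. -/
theorem hasFDerivAt_dualPoint {z : Rn n} (hz : z ≠ 0)
    (hpos : ∀ u, u ≠ 0 → 0 < ⟪hess V (dualPoint V z) u, u⟫) :
    HasFDerivAt (dualPoint V) (ContinuousLinearMap.inverse (hess V (dualPoint V z))) z := by
  obtain ⟨e, he⟩ := exists_equiv_of_inner_pos hpos
  have h1 := hV.hasFDerivAt_gradient (hV.dualPoint_ne_zero hz)
  rw [← he] at h1 ⊢
  rw [ContinuousLinearMap.inverse_equiv]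
  refine h1.of_local_left_inverse hV.continuous_dualPoint.continuousAt ?_
  filter_upwards [isOpen_ne.mem_nhds hz] with w hw
  exact hV.gradient_dualPoint (hV.dualPoint_ne_zero hw)

/-- If `V*` were twice differentiable at `z`, the chain rule for `∇V ∘ ∇V* = id` would exclude a
kernel vector of `D²V`. So the value `⊤` marks exactly the images of degenerate points. -/
theorem detHess_legendre_eq_top_iff {z : Rn n} (hz : z ≠ 0) :
    detHess (legendre V) z = ⊤ ↔ ¬ ∀ u, u ≠ 0 → 0 < ⟪hess V (dualPoint V z) u, u⟫ := by
  rw [detHess, hV.gradient_legendre]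
  constructor
  · intro h hpos
    rw [if_pos (hV.hasFDerivAt_dualPoint hz hpos).differentiableAt] at h
    exact ENNReal.ofReal_ne_top h
  · intro h
    have h0 := hV.dualPoint_ne_zero hz
    rw [if_neg]
    intro hd
    obtain ⟨u, hu, hAu⟩ := hV.exists_ker_of_not_pos h0 h
    have h1 := (hV.hasFDerivAt_gradient h0).comp z hd.hasFDerivAt
    have h2 : gradient V ∘ dualPoint V =ᶠ[𝓝 z] id := by
      filter_upwards [isOpen_ne.mem_nhds hz] with w hw
      exact hV.gradient_dualPoint (hV.dualPoint_ne_zero hw)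
    have h3 := (h1.congr_of_eventuallyEq h2.symm).unique (hasFDerivAt_id z)
    have h4 := DFunLike.congr_fun h3 u
    have h5 : ⟪hess V (dualPoint V z) (fderiv ℝ (dualPoint V) z u), u⟫ = ⟪u, u⟫ :=
      congrArg (fun y => ⟪y, u⟫) h4
    rw [hV.hess_symm h0, hAu, inner_zero_left] at h5
    exact hu (inner_self_eq_zero.1 h5.symm)

/-- Under the monotonicity assumption on `det D²V*`, the Hessian of `V` is nondegenerate off the
coordinate hyperplanes. -/
theorem hess_pos_of_antitone
    (H : ∀ (i : Fin n) (x' : Rn n), x' i = 0 → AntitoneOn (fun t : ℝ =>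
      detHess (legendre V) (x' + t • EuclideanSpace.single i (1 : ℝ))) (Ici 0))
    (hn : n ≠ 0) {x : Rn n} (hx : x ∈ posOrthant n) (u : Rn n) (hu : u ≠ 0) :
    0 < ⟪hess V x u, u⟫ := by
  by_contra hcon
  have h0 := ne_zero_of_mem_posOrthant hn hx
  set z := gradient V x with hz
  have hzO : z ∈ posOrthant n := hV.gradient_pos hx
  have htop : detHess (legendre V) z = ⊤ := by
    rw [hV.detHess_legendre_eq_top_iff (ne_zero_of_mem_posOrthant hn hzO), hz,
      hV.dualPoint_gradient h0]
    exact fun h => hcon (h u hu)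
  -- Lowering the coordinates of `z` one at a time keeps the value `⊤`, by monotonicity along each
  -- axis; `T` lists the coordinates allowed to differ from those of `z`.
  have hbox : ∀ T : Finset (Fin n), ∀ w ∈ posOrthant n, (∀ i, w i ≤ z i) →
      (∀ i, i ∉ T → w i = z i) → detHess (legendre V) w = ⊤ := by
    intro T
    induction T using Finset.induction_on with
    | empty =>
      intro w _ _ hw
      have : w = z := by ext i; exact hw i (Finset.notMem_empty i)
      rw [this, htop]
    | insert a T _ ih =>
      intro w hwO hle hw
      set x' : Rn n := WithLp.toLp 2 fun k => if k = a then 0 else w k with hx'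
      have e : ∀ t : ℝ, ∀ k, (x' + t • EuclideanSpace.single a (1 : ℝ) : Rn n) k =
          if k = a then t else w k := by
        intro t k
        simp only [hx', PiLp.add_apply, PiLp.smul_apply, smul_eq_mul, PiLp.single_apply]
        split_ifs <;> simp
      have h1 : detHess (legendre V) (x' + z a • EuclideanSpace.single a (1 : ℝ)) = ⊤ := by
        refine ih _ (fun k => ?_) (fun k => ?_) (fun k hk => ?_)
        · rw [e]; split_ifs with h
          · exact hzO a
          · exact hwO k
        · rw [e]; split_ifs with h
          · rw [h]
          · exact hle k
        · rw [e]; split_ifs with h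
          · rw [h]
          · exact hw k (by simp [h, hk])
      have h2 := H a x' (by simp [hx']) (hwO a).le (hzO a).le (hle a)
      have h3 : x' + w a • EuclideanSpace.single a (1 : ℝ) = w := by
        ext k
        rw [e]
        split_ifs with h
        · rw [h]
        · rfl
      simp only [h1, h3, top_le_iff] at h2
      exact h2
  set S : Set (Rn n) := {y | y ∈ posOrthant n ∧ (hess V y).det = 0} with hS
  -- Sard: the critical values of `∇V` are null, yet they contain the nonempty open box `B`.
  have hSnull : volume (gradient V '' S) = 0 := by
    refine addHaar_image_eq_zero_of_det_fderivWithin_eq_zero volume (f' := hess V) (fun y hy => ?_)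
      (fun y hy => hy.2)
    exact (hV.hasFDerivAt_gradient (ne_zero_of_mem_posOrthant hn hy.1)).hasFDerivWithinAt
  set B : Set (Rn n) := {w | ∀ i, w i ∈ Ioo 0 (z i)} with hB
  have hBsub : B ⊆ gradient V '' S := by
    intro w hw
    have hwO : w ∈ posOrthant n := fun i => (hw i).1
    have hw0 := ne_zero_of_mem_posOrthant hn hwO
    have h1 := hbox Finset.univ w hwO (fun i => (hw i).2.le)
      (fun i hi => absurd (Finset.mem_univ i) hi)
    rw [hV.detHess_legendre_eq_top_iff hw0] at h1
    obtain ⟨v, hv, hAv⟩ := hV.exists_ker_of_not_pos (hV.dualPoint_ne_zero hw0) h1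
    refine ⟨dualPoint V w, ⟨hV.dualPoint_mem_posOrthant hwO, ?_⟩,
      hV.gradient_dualPoint (hV.dualPoint_ne_zero hw0)⟩
    by_contra hdet
    have hinj := (LinearMap.equivOfDetNeZero _ hdet).injective
    exact hv (hinj (by simpa using hAv))
  have hBopen : IsOpen B := by
    have : B = ⋂ i, {w : Rn n | w i ∈ Ioo 0 (z i)} := by
      ext w; simp [hB]
    rw [this]
    exact isOpen_iInter_of_finite fun i => isOpen_Ioo.preimage (by fun_prop)
  have hBne : B.Nonempty := ⟨(1 / 2 : ℝ) • z, fun i => by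
    have := hzO i
    simp only [PiLp.smul_apply, smul_eq_mul]
    constructor <;> linarith⟩
  exact (hBopen.measure_pos volume hBne).ne' (measure_mono_null hBsub hSnull)

end IsPotential

/-! ### Estimates along coordinate lines, primal and dual -/

theorem det_nonneg_of_symm {n : ℕ} {A : Rn n →L[ℝ] Rn n} (hs : ∀ u v, ⟪A u, v⟫ = ⟪A v, u⟫)
    (hA : ∀ u, 0 ≤ ⟪A u, u⟫) : 0 ≤ A.det := by
  have hpos : A.toLinearMap.IsPositive := by
    refine ⟨fun u v => ?_, fun u => by simpa using hA u⟩
    change ⟪A u, v⟫ = ⟪u, A v⟫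
    rw [hs, real_inner_comm]
  have h := (LinearMap.posSemidef_toMatrix_iff (EuclideanSpace.basisFun (Fin n) ℝ)).2 hpos
  have h2 := h.det_nonneg
  rwa [LinearMap.det_toMatrix] at h2

/-- Integration over the open orthant along the lines parallel to a coordinate axis. -/
theorem setLIntegral_posOrthant_mono_of_lines {n : ℕ} (i : Fin n) {F₁ F₂ : Rn n → ℝ≥0∞}
    (m₁ : AEMeasurable F₁ (volume.restrict (posOrthant n)))
    (m₂ : AEMeasurable F₂ (volume.restrict (posOrthant n)))
    (h : ∀ x : Rn n, x i = 0 → (∀ k, k ≠ i → 0 < x k) →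
      ∫⁻ t in Ioi (0 : ℝ), F₁ (x + t • EuclideanSpace.single i (1 : ℝ)) ≤
        ∫⁻ t in Ioi (0 : ℝ), F₂ (x + t • EuclideanSpace.single i (1 : ℝ))) :
    ∫⁻ x in posOrthant n, F₁ x ≤ ∫⁻ x in posOrthant n, F₂ x := by
  obtain ⟨m, rfl⟩ : ∃ m, n = m + 1 := ⟨n - 1, by have := i.pos; omega⟩
  set e : ℝ × (Fin m → ℝ) ≃ᵐ Rn (m + 1) :=
    (MeasurableEquiv.piFinSuccAbove (fun _ : Fin (m + 1) => ℝ) i).symm.trans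
      (MeasurableEquiv.toLp 2 (Fin (m + 1) → ℝ)) with he
  have hmp : MeasurePreserving e (volume.prod volume) volume :=
    (volume_preserving_piFinSuccAbove (fun _ : Fin (m + 1) => ℝ) i).symm.trans
      (PiLp.volume_preserving_toLp (Fin (m + 1)))
  have hei : ∀ t y, e (t, y) i = t := fun t y =>
    Fin.insertNth_apply_same (α := fun _ => ℝ) i t y
  have hek : ∀ t y k, e (t, y) (i.succAbove k) = y k := fun t y k =>
    Fin.insertNth_apply_succAbove (α := fun _ => ℝ) i t y k
  have hline : ∀ t y, e (t, y) = e (0, y) + t • EuclideanSpace.single i (1 : ℝ) := by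
    intro t y
    ext k
    rcases Fin.eq_self_or_eq_succAbove i k with rfl | ⟨k, rfl⟩
    · simp [hei]
    · simp [hek, Fin.succAbove_ne]
  have hmem : ∀ t y, e (t, y) ∈ posOrthant (m + 1) ↔ 0 < t ∧ ∀ k, 0 < y k := by
    intro t y
    constructor
    · intro ht
      exact ⟨hei t y ▸ ht i, fun k => hek t y k ▸ ht (i.succAbove k)⟩
    · rintro ⟨h1, h2⟩ k
      rcases Fin.eq_self_or_eq_succAbove i k with rfl | ⟨k, rfl⟩
      · rwa [hei]
      · rw [hek]; exact h2 k
  have key : ∀ F : Rn (m + 1) → ℝ≥0∞,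
      AEMeasurable F (volume.restrict (posOrthant (m + 1))) →
      ∫⁻ x in posOrthant (m + 1), F x = ∫⁻ y : Fin m → ℝ, {y | ∀ k, 0 < y k}.indicator
        (fun y => ∫⁻ t in Ioi (0 : ℝ), F (e (0, y) + t • EuclideanSpace.single i (1 : ℝ))) y := by
    intro F mF
    have mI : AEMeasurable ((posOrthant (m + 1)).indicator F) volume :=
      (aemeasurable_indicator_iff (measurableSet_posOrthant _)).2 mF
    rw [← lintegral_indicator (measurableSet_posOrthant _),
      ← hmp.lintegral_comp_emb e.measurableEmbedding, lintegral_prod_symm]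
    · refine lintegral_congr fun y => ?_
      by_cases hy : ∀ k, 0 < y k
      · rw [indicator_of_mem (by exact hy), ← lintegral_indicator measurableSet_Ioi]
        refine lintegral_congr fun t => ?_
        by_cases ht : 0 < t
        · rw [indicator_of_mem ((hmem t y).2 ⟨ht, hy⟩), indicator_of_mem (mem_Ioi.2 ht), hline]
        · rw [indicator_of_notMem fun h' => ht ((hmem t y).1 h').1,
            indicator_of_notMem (by exact ht)]
      · rw [indicator_of_notMem (by exact hy)]
        refine (lintegral_congr fun t => ?_).trans lintegral_zero
        exact indicator_of_notMem (fun h' => hy ((hmem t y).1 h').2) _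
    · exact mI.comp_quasiMeasurePreserving hmp.quasiMeasurePreserving
  rw [key F₁ m₁, key F₂ m₂]
  refine lintegral_mono fun y => ?_
  by_cases hy : ∀ k, 0 < y k
  · rw [indicator_of_mem (by exact hy), indicator_of_mem (by exact hy)]
    refine h _ (hei 0 y) fun k hk => ?_
    rcases Fin.eq_self_or_eq_succAbove i k with rfl | ⟨k, rfl⟩
    · exact absurd rfl hk
    · rw [hek]; exact hy k
  · rw [indicator_of_notMem (by exact hy)]
    exact zero_le

/-- A lower bound for the inverse quadratic form by two orthogonal one-dimensional pieces. -/
theorem inverse_form_ge {n : ℕ} {A : Rn n →L[ℝ] Rn n} (hs : ∀ u v, ⟪A u, v⟫ = ⟪A v, u⟫)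
    (hA : ∀ u, u ≠ 0 → 0 < ⟪A u, u⟫) {d e : Rn n} (hd : d ≠ 0) (he : e ≠ 0) (hde : ⟪d, e⟫ = 0)
    (ξ : Rn n) :
    ⟪ξ, d⟫ ^ 2 / ⟪A d, d⟫ + ⟪ξ, ContinuousLinearMap.inverse A e⟫ ^ 2 /
      ⟪ContinuousLinearMap.inverse A e, e⟫ ≤ ⟪ContinuousLinearMap.inverse A ξ, ξ⟫ := by
  set η := ContinuousLinearMap.inverse A ξ
  set a := ContinuousLinearMap.inverse A e
  have hη : A η = ξ := inverse_apply_self hA ξ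
  have ha : A a = e := inverse_apply_self hA e
  have ha0 : a ≠ 0 := by
    intro h
    rw [h, map_zero] at ha
    exact he ha.symm
  have h1 := hA d hd
  have h2 := hA a ha0
  have hpsd : ∀ w, 0 ≤ ⟪A w, w⟫ := fun w => by
    rcases eq_or_ne w 0 with rfl | hw
    · simp
    · exact (hA w hw).le
  rw [ha, real_inner_comm] at h2
  set x := ⟪ξ, d⟫ / ⟪A d, d⟫ with hx
  set y := ⟪ξ, a⟫ / ⟪a, e⟫ with hy
  -- `d` and `a = A⁻¹e` are orthogonal for `A`, and `x`, `y` are the coefficients of the projection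
  -- of `η`; this is Bessel's inequality.
  have h3 := hpsd (η - x • d - y • a)
  have e1 : ⟪A d, η⟫ = ⟪ξ, d⟫ := by rw [hs, hη]
  have e2 : ⟪A d, a⟫ = 0 := by rw [hs, ha, real_inner_comm, hde]
  simp only [map_sub, map_smul, hη, ha, inner_sub_left, inner_sub_right, inner_smul_left,
    inner_smul_right, conj_trivial, e1, e2, real_inner_comm d e, hde, real_inner_comm a e] at h3
  have e3 : ⟪e, η⟫ = ⟪ξ, a⟫ := by rw [← ha, hs, hη]
  have e4 : ⟪η, ξ⟫ = ⟪ξ, η⟫ := real_inner_comm _ _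
  simp only [e3] at h3
  have e7 : ⟪ξ, d⟫ ^ 2 / ⟪A d, d⟫ = 2 * x * ⟪ξ, d⟫ - x ^ 2 * ⟪A d, d⟫ := by
    rw [hx]; field_simp; ring
  have e8 : ⟪ξ, a⟫ ^ 2 / ⟪a, e⟫ = 2 * y * ⟪ξ, a⟫ - y ^ 2 * ⟪a, e⟫ := by
    rw [hy]; field_simp; ring
  rw [e7, e8, e4]
  nlinarith

/-- The coordinate `i` stays positive along the line, which therefore avoids the only point where
`V` may fail to be `C²`. -/
theorem line_ne_zero {n : ℕ} {i j : Fin n} (hij : i ≠ j) {x : Rn n} (hx : ∀ k, k ≠ j → 0 < x k) (t : ℝ) :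
    x + t • EuclideanSpace.single j (1 : ℝ) ≠ 0 := by
  intro h
  have h1 := congrArg (fun z : Rn n => z i) h
  simp [hij] at h1
  exact (hx i hij).ne' h1

theorem inverse_inner_pos {n : ℕ} {A : Rn n →L[ℝ] Rn n} (hpos : ∀ u, u ≠ 0 → 0 < ⟪A u, u⟫)
    (u : Rn n) (hu : u ≠ 0) : 0 < ⟪ContinuousLinearMap.inverse (A) u, u⟫ := by
  have h1 := inverse_apply_self hpos u
  have h2 : ContinuousLinearMap.inverse (A) u ≠ 0 := by
    intro h
    rw [h, map_zero] at h1
    exact hu h1.symm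
  have h3 := hpos _ h2
  rw [h1] at h3
  rwa [real_inner_comm]

namespace IsPotential

variable {n : ℕ} {p : ℝ} {V : Rn n → ℝ} (hV : IsPotential p V)

include hV

/-- The one-dimensional inequality on lines parallel to a coordinate axis. -/
theorem lintegral_sq_le_primal {i j : Fin n} (hij : i ≠ j)
    (hpos : ∀ x ∈ posOrthant n, ∀ u, u ≠ 0 → 0 < ⟪hess V x u, u⟫)
    {f : Rn n → ℝ} (hf : ContDiff ℝ 1 f) (hodd : ∀ x : Rn n, x j = 0 → f x = 0) :
    ∫⁻ x in posOrthant n, ENNReal.ofReal (f x ^ 2 * Real.exp (-V x)) ≤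
      ∫⁻ x in posOrthant n, ENNReal.ofReal
        (⟪gradient f x, EuclideanSpace.single j (1 : ℝ)⟫ ^ 2 /
          ⟪hess V x (EuclideanSpace.single j (1 : ℝ)), EuclideanSpace.single j (1 : ℝ)⟫ *
            Real.exp (-V x)) := by
  have hn : n ≠ 0 := by rintro rfl; exact i.elim0
  set d : Rn n := EuclideanSpace.single j (1 : ℝ) with hd
  have hd0 : d ≠ 0 := by simp [hd]
  have cV := hV.continuous
  have cf := hf.continuous
  have cgrad : Continuous (gradient f) :=
    (InnerProductSpace.toDual ℝ (Rn n)).symm.continuous.comp (hf.continuous_fderiv (by norm_num))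
  have chess : ContinuousOn (hess V) (posOrthant n) := fun x hx =>
    (hV.continuousAt_hess (ne_zero_of_mem_posOrthant hn hx)).continuousWithinAt
  have cq : ContinuousOn (fun x => ⟪gradient f x, d⟫ ^ 2 / ⟪hess V x d, d⟫) (posOrthant n) :=
    ((cgrad.continuousOn.inner continuousOn_const).pow 2).div
      ((chess.clm_apply continuousOn_const).inner continuousOn_const)
      fun x hx => (hpos x hx d hd0).ne'
  refine setLIntegral_posOrthant_mono_of_lines j ?_ ?_ fun x hxj hx => ?_
  · fun_prop
  · exact ((cq.mul (by fun_prop)).aemeasurable (measurableSet_posOrthant n)).ennreal_ofReal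
  · have hne := line_ne_zero hij hx
    have hmem : ∀ t : ℝ, 0 < t → x + t • d ∈ posOrthant n := by
      intro t ht k
      by_cases hk : k = j
      · subst hk; simp [hd, hxj, ht]
      · simpa [hd, hk] using hx k hk
    refine setLIntegral_Ioi_le_of_forall _ _ fun b hb => ?_
    refine le_trans ?_ (lintegral_mono_set (Ioo_subset_Ioi_self : Ioo 0 b ⊆ Ioi (0 : ℝ)))
    have cline : Continuous fun t : ℝ => x + t • d := by fun_prop
    have clineOn : ∀ {Y : Type} [TopologicalSpace Y] {g : Rn n → Y},
        ContinuousOn g (posOrthant n) → ContinuousOn (fun t : ℝ => g (x + t • d)) (Ioo 0 b) :=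
      fun hg => hg.comp cline.continuousOn fun t ht => hmem t ht.1
    refine brascampLieb_Ioo_of_tendsto_zero (h := fun t => f (x + t • d))
      (h1 := fun t => ⟪gradient f (x + t • d), d⟫) (ψ := fun t => V (x + t • d))
      (ψ1 := fun t => ⟪gradient V (x + t • d), d⟫)
      (ψ2 := fun t => ⟪hess V (x + t • d) d, d⟫)
      (q := fun t => ⟪gradient f (x + t • d), d⟫ ^ 2 / ⟪hess V (x + t • d) d, d⟫)
      ?_ (fun t _ => ?_) (fun t _ => hV.hasDerivAt_line d (hne t)) (fun t _ => ?_)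
      (by fun_prop) ?_ (clineOn cq) (fun t ht => ?_) (fun t ht l => ?_)
    · have h1 : Tendsto (fun t : ℝ => f (x + t • d)) (𝓝 0) (𝓝 (f (x + (0 : ℝ) • d))) :=
        (cf.comp cline).tendsto 0
      rw [zero_smul, add_zero, hodd x hxj] at h1
      exact h1.mono_left nhdsWithin_le_nhds
    · have hl : HasDerivAt (fun s : ℝ => x + s • d) d t := by
        simpa using ((hasDerivAt_id t).smul_const d).const_add x
      rw [inner_gradient_left]
      exact (hf.differentiable (by norm_num) _).hasFDerivAt.comp_hasDerivAt t hl
    · have h1 := (hV.hasDerivAt_gradient_line d (hne t)).inner ℝ (hasDerivAt_const t d)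
      simpa using h1
    · exact ((clineOn chess).clm_apply continuousOn_const).inner continuousOn_const
    · have h1 := hV.gradient_pos (hmem t ht.1) j
      have h2 : ⟪gradient V (x + t • d), d⟫ = gradient V (x + t • d) j := by
        rw [hd, EuclideanSpace.inner_single_right]; simp
      rw [h2]; exact h1.le
    · have h1 := hpos _ (hmem t ht.1) d hd0
      -- The best majorant on the line is the square of the derivative of `f` over the second
      -- derivative of `V`.
      rw [le_div_iff₀ h1]
      nlinarith [sq_nonneg (⟪gradient f (x + t • d), d⟫ - l * ⟪hess V (x + t • d) d, d⟫)]

theorem hess_legendre {z : Rn n} (hz : z ≠ 0)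
    (hpos : ∀ u, u ≠ 0 → 0 < ⟪hess V (dualPoint V z) u, u⟫) :
    hess (legendre V) z = ContinuousLinearMap.inverse (hess V (dualPoint V z)) := by
  rw [hess, hV.gradient_legendre, (hV.hasFDerivAt_dualPoint hz hpos).fderiv]

theorem inverse_hess_symm {x : Rn n} (hx : x ≠ 0) (hpos : ∀ u, u ≠ 0 → 0 < ⟪hess V x u, u⟫)
    (u v : Rn n) : ⟪ContinuousLinearMap.inverse (hess V x) u, v⟫ =
      ⟪ContinuousLinearMap.inverse (hess V x) v, u⟫ := by
  conv_lhs => rw [← inverse_apply_self hpos v]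
  conv_rhs => rw [← inverse_apply_self hpos u]
  rw [real_inner_comm, hV.hess_symm hx, real_inner_comm]

set_option maxHeartbeats 2000000 in
/-- The one-dimensional inequality on lines parallel to a coordinate axis in the dual space. -/
theorem lintegral_sq_le_dual {i j : Fin n} (hij : i ≠ j)
    (H : ∀ (i : Fin n) (x' : Rn n), x' i = 0 → AntitoneOn (fun t : ℝ =>
      detHess (legendre V) (x' + t • EuclideanSpace.single i (1 : ℝ))) (Ici 0))
    (hpos : ∀ x ∈ posOrthant n, ∀ u, u ≠ 0 → 0 < ⟪hess V x u, u⟫)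
    {f : Rn n → ℝ} (hf : ContDiff ℝ 1 f) (hodd : ∀ x : Rn n, x i = 0 → f x = 0) :
    ∫⁻ x in posOrthant n, ENNReal.ofReal (f x ^ 2 * Real.exp (-V x)) ≤
      ENNReal.ofReal (p - 1) * ∫⁻ x in posOrthant n, ENNReal.ofReal
        (⟪gradient f x, ContinuousLinearMap.inverse (hess V x)
            (EuclideanSpace.single i (1 : ℝ))⟫ ^ 2 /
          ⟪ContinuousLinearMap.inverse (hess V x) (EuclideanSpace.single i (1 : ℝ)),
            EuclideanSpace.single i (1 : ℝ)⟫ * Real.exp (-V x)) := by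
  have hn : n ≠ 0 := by rintro rfl; exact i.elim0
  have hp1 : 0 < p - 1 := by linarith [hV.one_lt]
  set d : Rn n := EuclideanSpace.single i (1 : ℝ) with hd
  have hd0 : d ≠ 0 := by simp [hd]
  have cV := hV.continuous
  have cf := hf.continuous
  have cD := hV.continuous_dualPoint
  have cgrad : Continuous (gradient f) :=
    (InnerProductSpace.toDual ℝ (Rn n)).symm.continuous.comp (hf.continuous_fderiv (by norm_num))
  set Inv : Rn n → Rn n →L[ℝ] Rn n := fun x => ContinuousLinearMap.inverse (hess V x) with hInv
  have cInv : ContinuousOn Inv (posOrthant n) := fun x hx =>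
    (continuousAt_inverse_of_inner_pos
      (hV.continuousAt_hess (ne_zero_of_mem_posOrthant hn hx)) (hpos x hx)).continuousWithinAt
  have hO : MapsTo (dualPoint V) (posOrthant n) (posOrthant n) := fun z hz =>
    hV.dualPoint_mem_posOrthant hz
  have cInvD : ContinuousOn (fun z => Inv (dualPoint V z)) (posOrthant n) :=
    cInv.comp cD.continuousOn hO
  set r : Rn n → ℝ := fun z => (Inv (dualPoint V z)).det with hr
  have cr : ContinuousOn r (posOrthant n) :=
    ContinuousLinearMap.continuous_det.comp_continuousOn cInvD
  have r0 : ∀ z ∈ posOrthant n, 0 ≤ r z := fun z hz =>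
    det_nonneg_of_symm
      (hV.inverse_hess_symm (ne_zero_of_mem_posOrthant hn (hO hz)) (hpos _ (hO hz))) fun u => by
        rcases eq_or_ne u 0 with rfl | hu
        · simp
        · exact (inverse_inner_pos (hpos _ (hO hz)) u hu).le
  have hdet : ∀ z ∈ posOrthant n, detHess (legendre V) z = ENNReal.ofReal (r z) := by
    intro z hz
    have hz0 := ne_zero_of_mem_posOrthant hn hz
    rw [detHess, if_pos, hV.hess_legendre hz0 (hpos _ (hO hz))]
    rw [hV.gradient_legendre]
    exact (hV.hasFDerivAt_dualPoint hz0 (hpos _ (hO hz))).differentiableAt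
  -- Change of variables `x = ∇V*(z)`, which maps the open orthant onto itself with Jacobian `r =
  -- det D²V*`.
  have change : ∀ g : Rn n → ℝ≥0∞, ∫⁻ x in posOrthant n, g x =
      ∫⁻ z in posOrthant n, g (dualPoint V z) * ENNReal.ofReal (r z) := by
    intro g
    have h1 := lintegral_image_eq_lintegral_abs_det_fderiv_mul (volume : Measure (Rn n))
      (measurableSet_posOrthant n) (f := dualPoint V) (f' := fun z => Inv (dualPoint V z))
      (fun z hz => (hV.hasFDerivAt_dualPoint (ne_zero_of_mem_posOrthant hn hz)
        (hpos _ (hO hz))).hasFDerivWithinAt)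
      (hV.injOn_dualPoint.mono fun z hz => ne_zero_of_mem_posOrthant hn hz) g
    rw [hV.image_dualPoint] at h1
    rw [h1]
    refine setLIntegral_congr_fun (measurableSet_posOrthant n) fun z hz => ?_
    change ENNReal.ofReal |r z| * _ = _
    rw [abs_of_nonneg (r0 z hz), mul_comm]
  set q : Rn n → ℝ := fun x => (p - 1) * (⟪gradient f x, Inv x d⟫ ^ 2 / ⟪Inv x d, d⟫) with hq
  have cq : ContinuousOn q (posOrthant n) :=
    continuousOn_const.mul (((cgrad.continuousOn.inner (cInv.clm_apply continuousOn_const)).pow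
      2).div ((cInv.clm_apply continuousOn_const).inner continuousOn_const)
        fun x hx => (inverse_inner_pos (hpos x hx) d hd0).ne')
  have cqD : ContinuousOn (fun z => q (dualPoint V z)) (posOrthant n) := cq.comp cD.continuousOn hO
  rw [← lintegral_const_mul' _ _ ENNReal.ofReal_ne_top]
  simp_rw [← ENNReal.ofReal_mul hp1.le, ← mul_assoc (p - 1)]
  change _ ≤ ∫⁻ x in posOrthant n, ENNReal.ofReal (q x * Real.exp (-V x))
  rw [change fun x => ENNReal.ofReal (f x ^ 2 * Real.exp (-V x)),
    change fun x => ENNReal.ofReal (q x * Real.exp (-V x))]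
  have cx : Continuous fun z => Real.exp (-V (dualPoint V z)) := by fun_prop
  have c1 : Continuous fun z => f (dualPoint V z) ^ 2 * Real.exp (-V (dualPoint V z)) := by fun_prop
  refine setLIntegral_posOrthant_mono_of_lines i ?_ ?_ fun z hzi hz => ?_
  · exact c1.measurable.ennreal_ofReal.aemeasurable.mul
      ((cr.aemeasurable (measurableSet_posOrthant n)).ennreal_ofReal)
  · exact ((cqD.mul cx.continuousOn).aemeasurable
      (measurableSet_posOrthant n)).ennreal_ofReal.mul
        ((cr.aemeasurable (measurableSet_posOrthant n)).ennreal_ofReal)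
  · have hne : ∀ t : ℝ, z + t • d ≠ 0 := line_ne_zero hij.symm hz
    have hmem : ∀ t : ℝ, 0 < t → z + t • d ∈ posOrthant n := by
      intro t ht k
      by_cases hk : k = i
      · subst hk; simp [hd, hzi, ht]
      · simpa [hd, hk] using hz k hk
    have cline : Continuous fun t : ℝ => z + t • d := by fun_prop
    have clineOn : ∀ {s : Set ℝ}, (∀ t ∈ s, 0 < t) → ∀ {Y : Type} [TopologicalSpace Y]
        {g : Rn n → Y}, ContinuousOn g (posOrthant n) →
        ContinuousOn (fun t : ℝ => g (z + t • d)) s :=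
      fun hs _ _ _ hg => hg.comp cline.continuousOn fun t ht => hmem t (hs t ht)
    -- `r` decreases along the line, so it suffices to prove the inequality without `r` on every
    -- interval `(0, b)`.
    refine setLIntegral_mul_antitone_le
      (F₁ := fun t => ENNReal.ofReal (f (dualPoint V (z + t • d)) ^ 2 *
        Real.exp (-V (dualPoint V (z + t • d)))))
      (F₂ := fun t => ENNReal.ofReal (q (dualPoint V (z + t • d)) *
        Real.exp (-V (dualPoint V (z + t • d)))))
      (r := fun t => r (z + t • d)) (by fun_prop) ?_ ?_ ?_ fun b hb => ?_
    · exact (((clineOn (fun t ht => ht) cqD).mul (by fun_prop)).aemeasurable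
        measurableSet_Ioi).ennreal_ofReal
    · intro s hs t ht hst
      have h1 := H i z hzi (mem_Ici.2 (le_of_lt hs)) (mem_Ici.2 (le_of_lt ht)) hst
      simp only at h1
      rw [hdet _ (hmem s hs), hdet _ (hmem t ht),
        ENNReal.ofReal_le_ofReal_iff (r0 _ (hmem s hs))] at h1
      exact h1
    · exact fun t ht => r0 _ (hmem t ht)
    -- On the line the potential is `V*/(p-1)`, with explicit first and second derivatives.
    · have hψ : ∀ t : ℝ, V (dualPoint V (z + t • d)) = legendre V (z + t • d) / (p - 1) := by
        intro t
        rw [hV.legendre_eq_mul (hne t)]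
        field_simp
      have hl : ∀ t : ℝ, HasDerivAt (fun s : ℝ => z + s • d) d t := fun t => by
        simpa using ((hasDerivAt_id t).smul_const d).const_add z
      have dx : ∀ t ∈ Ioo 0 b, HasDerivAt (fun s : ℝ => dualPoint V (z + s • d))
          (Inv (dualPoint V (z + t • d)) d) t := fun t ht => by
        have h1 := hV.hasFDerivAt_dualPoint (hne t) (hpos _ (hO (hmem t ht.1)))
        exact h1.comp_hasDerivAt t (hl t)
      refine brascampLieb_Ioo_of_tendsto_zero
        (h := fun t => f (dualPoint V (z + t • d)))
        (h1 := fun t => ⟪gradient f (dualPoint V (z + t • d)), Inv (dualPoint V (z + t • d)) d⟫)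
        (ψ := fun t => V (dualPoint V (z + t • d)))
        (ψ1 := fun t => ⟪dualPoint V (z + t • d), d⟫ / (p - 1))
        (ψ2 := fun t => ⟪Inv (dualPoint V (z + t • d)) d, d⟫ / (p - 1))
        (q := fun t => q (dualPoint V (z + t • d)))
        ?_ (fun t ht => ?_) (fun t _ => ?_) (fun t ht => ?_) ?_ ?_
        (clineOn (fun t ht => ht.1) cqD) (fun t ht => ?_) (fun t ht l => ?_)
      · have h1 : Tendsto (fun t : ℝ => f (dualPoint V (z + t • d))) (𝓝 0)
            (𝓝 (f (dualPoint V (z + (0 : ℝ) • d)))) :=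
          (cf.comp (cD.comp cline)).tendsto 0
        rw [zero_smul, add_zero, hodd _ (hV.dualPoint_coord_eq_zero hzi)] at h1
        exact h1.mono_left nhdsWithin_le_nhds
      · rw [inner_gradient_left]
        exact (hf.differentiable (by norm_num) _).hasFDerivAt.comp_hasDerivAt t (dx t ht)
      · simp_rw [hψ]
        refine HasDerivAt.div_const ?_ _
        have h1 := hV.hasGradientAt_legendre (z + t • d)
        exact (hasGradientAt_iff_hasFDerivAt.1 h1).comp_hasDerivAt t (hl t)
      · have h1 := ((dx t ht).inner ℝ (hasDerivAt_const t d)).div_const (p - 1)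
        simpa using h1
      · exact (cgrad.comp (cD.comp cline)).continuousOn.inner
          ((clineOn (fun t ht => ht.1) cInvD).clm_apply continuousOn_const)
      · exact (((clineOn (fun t ht => ht.1) cInvD).clm_apply continuousOn_const).inner
          continuousOn_const).div_const _
      · have h1 := hO (hmem t ht.1) i
        have h2 : ⟪dualPoint V (z + t • d), d⟫ = dualPoint V (z + t • d) i := by
          rw [hd, EuclideanSpace.inner_single_right]; simp
        rw [h2]
        positivity
      · have h1 := inverse_inner_pos (hpos _ (hO (hmem t ht.1))) d hd0
        simp only [hq]
        set a := ⟪Inv (dualPoint V (z + t • d)) d, d⟫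
        set c := ⟪gradient f (dualPoint V (z + t • d)), Inv (dualPoint V (z + t • d)) d⟫
        -- Completing the square in `l`; the second derivative `a/(p-1)` of the potential yields the
        -- factor `p - 1`.
        have h2 : (p - 1) * (c ^ 2 / a) - (2 * l * c - l ^ 2 * (a / (p - 1))) =
            ((p - 1) * c - l * a) ^ 2 / ((p - 1) * a) := by
          have : a ≠ 0 := ne_of_gt h1
          field_simp
          ring
        have h3 : 0 ≤ ((p - 1) * c - l * a) ^ 2 / ((p - 1) * a) :=
          div_nonneg (sq_nonneg _) (mul_pos hp1 h1).le
        linarith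

/-- The inequality for functions that are odd in two coordinates, on the open orthant. -/
theorem lintegral_sq_le_of_odd_odd {i j : Fin n} (hij : i ≠ j)
    (H : ∀ (i : Fin n) (x' : Rn n), x' i = 0 → AntitoneOn (fun t : ℝ =>
      detHess (legendre V) (x' + t • EuclideanSpace.single i (1 : ℝ))) (Ici 0))
    {f : Rn n → ℝ} (hf : ContDiff ℝ 1 f) (hi : ∀ x : Rn n, x i = 0 → f x = 0)
    (hj : ∀ x : Rn n, x j = 0 → f x = 0) :
    ∫⁻ x in posOrthant n, ENNReal.ofReal (f x ^ 2 * Real.exp (-V x)) ≤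
      ENNReal.ofReal (1 - 1 / p) * ∫⁻ x in posOrthant n,
        ENNReal.ofReal (Real.exp (-V x)) * invForm (hess V x) (gradient f x) := by
  have hn : n ≠ 0 := by rintro rfl; exact i.elim0
  have hp1 : 0 < p - 1 := by linarith [hV.one_lt]
  have hp0 : 0 < p := by linarith
  have hpos : ∀ x ∈ posOrthant n, ∀ u, u ≠ 0 → 0 < ⟪hess V x u, u⟫ := fun x hx u hu =>
    hV.hess_pos_of_antitone H hn hx u hu
  have h1 := hV.lintegral_sq_le_primal hij hpos hf hj
  have h2 := hV.lintegral_sq_le_dual hij H hpos hf hi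
  set ei : Rn n := EuclideanSpace.single i (1 : ℝ) with hei
  set ej : Rn n := EuclideanSpace.single j (1 : ℝ) with hej
  have hei0 : ei ≠ 0 := by simp [hei]
  have hej0 : ej ≠ 0 := by simp [hej]
  have hort : ⟪ej, ei⟫ = 0 := by
    rw [hei, hej, EuclideanSpace.inner_single_right]
    simp [hij]
  set I := ∫⁻ x in posOrthant n, ENNReal.ofReal (f x ^ 2 * Real.exp (-V x))
  set X := ∫⁻ x in posOrthant n, ENNReal.ofReal
    (⟪gradient f x, ej⟫ ^ 2 / ⟪hess V x ej, ej⟫ * Real.exp (-V x))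
  set Y := ∫⁻ x in posOrthant n, ENNReal.ofReal
    (⟪gradient f x, ContinuousLinearMap.inverse (hess V x) ei⟫ ^ 2 /
      ⟪ContinuousLinearMap.inverse (hess V x) ei, ei⟫ * Real.exp (-V x))
  -- Superadditivity of the lower integral, then `inverse_form_ge` pointwise with `d = ej` and `e =
  -- ei`.
  have hXY : X + Y ≤ ∫⁻ x in posOrthant n,
      ENNReal.ofReal (Real.exp (-V x)) * invForm (hess V x) (gradient f x) := by
    refine (le_lintegral_add _ _).trans ?_
    refine setLIntegral_mono' (measurableSet_posOrthant n) fun x hx => ?_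
    have hx0 := ne_zero_of_mem_posOrthant hn hx
    have a1 := hpos x hx ej hej0
    have a2 := inverse_inner_pos (hpos x hx) ei hei0
    rw [invForm_eq_of_inner_pos (hpos x hx), ← ENNReal.ofReal_add (by positivity) (by positivity),
      ← ENNReal.ofReal_mul (Real.exp_pos _).le, ← add_mul, mul_comm]
    refine ENNReal.ofReal_le_ofReal (mul_le_mul_of_nonneg_left ?_ (Real.exp_pos _).le)
    exact inverse_form_ge (hV.hess_symm hx0) (hpos x hx) hej0 hei0 hort _
  have c0 : 0 ≤ 1 - 1 / p := by
    rw [sub_nonneg, div_le_one hp0]; linarith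
  -- The weights are chosen so that `(1/p)(p - 1) = 1 - 1/p`, which gives `X` and `Y` the same
  -- coefficient.
  calc I = ENNReal.ofReal (1 - 1 / p) * I + ENNReal.ofReal (1 / p) * I := by
        rw [← add_mul, ← ENNReal.ofReal_add c0 (by positivity), sub_add_cancel,
          ENNReal.ofReal_one, one_mul]
    _ ≤ ENNReal.ofReal (1 - 1 / p) * X + ENNReal.ofReal (1 / p) *
          (ENNReal.ofReal (p - 1) * Y) := by gcongr
    _ = ENNReal.ofReal (1 - 1 / p) * (X + Y) := by
        rw [mul_add, ← mul_assoc (ENNReal.ofReal (1 / p)), ← ENNReal.ofReal_mul (by positivity)]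
        congr 3
        field_simp
    _ ≤ _ := by gcongr

end IsPotential

/-! ### Functions with parities in the coordinates -/

/-- The reflection in the `k`-th coordinate hyperplane. -/
def reflect {n : ℕ} (k : Fin n) : Rn n ≃ₗᵢ[ℝ] Rn n := flip fun i => decide (i = k)

theorem reflect_apply {n : ℕ} (k : Fin n) (x : Rn n) (i : Fin n) :
    reflect k x i = if i = k then -x i else x i := by
  simp [reflect, flip_apply]

theorem reflect_reflect {n : ℕ} (k : Fin n) (x : Rn n) : reflect k (reflect k x) = x :=
  flip_flip _ x

theorem reflect_comm {n : ℕ} (k l : Fin n) (x : Rn n) :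
    reflect k (reflect l x) = reflect l (reflect k x) := by
  ext i
  simp only [reflect_apply]
  split_ifs <;> rfl

theorem apply_flip_of_parity {n : ℕ} {f : Rn n → ℝ} {ε : Fin n → ℝ}
    (h : ∀ k x, f (reflect k x) = ε k * f x) (S : Finset (Fin n)) (x : Rn n) :
    f (flip (fun i => decide (i ∈ S)) x) = (∏ k ∈ S, ε k) * f x := by
  induction S using Finset.induction_on with
  | empty =>
    rw [Finset.prod_empty, one_mul]
    congr 1
  | insert a S ha ih =>
    rw [Finset.prod_insert ha, mul_assoc, ← ih, ← h]
    congr 1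
    ext i
    simp only [flip_apply, reflect_apply, Finset.mem_insert, decide_eq_true_eq]
    by_cases hi : i = a
    · subst hi; simp [ha]
    · simp [hi]

theorem invForm_neg {n : ℕ} (A : Rn n →L[ℝ] Rn n) (ξ : Rn n) : invForm A (-ξ) = invForm A ξ := by
  have h : ∀ ξ, invForm A (-ξ) ≤ invForm A ξ := fun ξ =>
    le_iInf₂ fun η hη => (iInf₂_le (-η) (by rw [map_neg, hη])).trans (by rw [inner_neg_neg])
  refine le_antisymm (h ξ) ?_
  have := h (-ξ)
  rwa [neg_neg] at this

theorem gradient_neg {n : ℕ} (f : Rn n → ℝ) (x : Rn n) :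
    gradient (fun y => -f y) x = -gradient f x := by
  simp [gradient, fderiv_fun_neg]

theorem gradient_half_add {n : ℕ} {f g : Rn n → ℝ} {x : Rn n} (hf : DifferentiableAt ℝ f x)
    (hg : DifferentiableAt ℝ g x) :
    gradient (fun y => (1 / 2) * (f y + g y)) x = (1 / 2 : ℝ) • (gradient f x + gradient g x) := by
  rw [gradient, fderiv_const_mul (hf.fun_add hg), fderiv_fun_add hf hg, map_smulₛₗ, map_add]
  rfl

theorem two_mul_ofReal (a : ℝ) : 2 * ENNReal.ofReal a = ENNReal.ofReal (2 * a) := by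
  rw [ENNReal.ofReal_mul zero_le_two, ENNReal.ofReal_ofNat]

/-- The parallelogram law. -/
theorem invForm_half_add {n : ℕ} {A : Rn n →L[ℝ] Rn n} (hA : ∀ u, u ≠ 0 → 0 < ⟪A u, u⟫)
    (a b : Rn n) : 2 * (invForm A ((1 / 2 : ℝ) • (a + b)) + invForm A ((1 / 2 : ℝ) • (a + -b))) =
      invForm A a + invForm A b := by
  have hnn : ∀ ξ, 0 ≤ ⟪ContinuousLinearMap.inverse A ξ, ξ⟫ := fun ξ => by
    rcases eq_or_ne ξ 0 with rfl | h
    · simp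
    · exact (inverse_inner_pos hA ξ h).le
  simp only [invForm_eq_of_inner_pos hA]
  rw [← ENNReal.ofReal_add (hnn _) (hnn _), ← ENNReal.ofReal_add (hnn _) (hnn _),
    two_mul_ofReal]
  congr 1
  simp only [map_smul, map_add, map_neg, inner_smul_left, inner_smul_right, inner_add_left,
    inner_add_right, inner_neg_left, inner_neg_right, conj_trivial]
  ring

namespace IsPotential

variable {n : ℕ} {p : ℝ} {V : Rn n → ℝ} (hV : IsPotential p V)

include hV

theorem inner_hess_pos_of_antitone
    (H : ∀ (i : Fin n) (x' : Rn n), x' i = 0 → AntitoneOn (fun t : ℝ =>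
      detHess (legendre V) (x' + t • EuclideanSpace.single i (1 : ℝ))) (Ici 0))
    (hn : n ≠ 0) {x : Rn n} (hx : ∀ i, x i ≠ 0) (u : Rn n) (hu : u ≠ 0) :
    0 < ⟪hess V x u, u⟫ := by
  set s : Fin n → Bool := fun i => decide (x i < 0)
  have hy : flip s x ∈ posOrthant n := by
    intro i
    rw [flip_apply]
    by_cases h : x i < 0
    · simp [s, h]
    · have : 0 < x i := lt_of_le_of_ne (not_lt.1 h) (hx i).symm
      simpa [s, h] using this
  have h := hV.hess_pos_of_antitone H hn hy (flip s u) (by simpa using hu)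
  rwa [hess_comp_isometry (flip s) (hV.flip_eq s), (flip s).inner_map_map] at h

/-- `invForm` is an uncountable infimum; off the null coordinate hyperplanes it equals a continuous
expression in the inverse Hessian. -/
theorem aemeasurable_energy
    (hpos : ∀ x : Rn n, (∀ i, x i ≠ 0) → ∀ u, u ≠ 0 → 0 < ⟪hess V x u, u⟫) (hn : n ≠ 0)
    {f : Rn n → ℝ} (hf : ContDiff ℝ 1 f) :
    AEMeasurable fun x => ENNReal.ofReal (Real.exp (-V x)) *
      invForm (hess V x) (gradient f x) := by
  set O : Set (Rn n) := {x | ∀ i, x i ≠ 0}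
  have hO : IsOpen O := by
    have : O = ⋂ i, {x : Rn n | x i ≠ 0} := by
      ext x; simp [O]
    rw [this]
    exact isOpen_iInter_of_finite fun i => isOpen_ne_fun (by fun_prop) continuous_const
  have h0 : ∀ x ∈ O, x ≠ 0 := by
    rintro x hx rfl
    exact hx ⟨0, Nat.pos_of_ne_zero hn⟩ rfl
  have cgrad : Continuous (gradient f) :=
    (InnerProductSpace.toDual ℝ (Rn n)).symm.continuous.comp (hf.continuous_fderiv (by norm_num))
  have cInv : ContinuousOn (fun x => ContinuousLinearMap.inverse (hess V x)) O := fun x hx =>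
    (continuousAt_inverse_of_inner_pos (hV.continuousAt_hess (h0 x hx))
      (hpos x hx)).continuousWithinAt
  have h1 : AEMeasurable (fun x => ENNReal.ofReal
      ⟪ContinuousLinearMap.inverse (hess V x) (gradient f x), gradient f x⟫)
      (volume.restrict O) :=
    (((cInv.clm_apply cgrad.continuousOn).inner cgrad.continuousOn).aemeasurable
      hO.measurableSet).ennreal_ofReal
  rw [Measure.restrict_eq_self_of_ae_mem (show ∀ᵐ x, x ∈ O from ae_coord_ne_zero n)] at h1
  have cV := hV.continuous
  refine AEMeasurable.mul (by fun_prop) (h1.congr ?_)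
  filter_upwards [ae_coord_ne_zero n] with x hx
  rw [invForm_eq_of_inner_pos (hpos x hx)]

/-- The inequality passes from the even and the odd part, with respect to a coordinate, of a
function to the function. -/
theorem exists_const_of_parts
    (hpos : ∀ x : Rn n, (∀ i, x i ≠ 0) → ∀ u, u ≠ 0 → 0 < ⟪hess V x u, u⟫) {C : ℝ≥0∞}
    (k : Fin n) {f : Rn n → ℝ} (hf : ContDiff ℝ 1 f)
    (h1 : ∃ c : ℝ, ∫⁻ x, ENNReal.ofReal (Real.exp (-V x)) *
        ENNReal.ofReal (((1 / 2) * (f x + f (reflect k x)) - c) ^ 2) ≤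
      C * ∫⁻ x, ENNReal.ofReal (Real.exp (-V x)) *
        invForm (hess V x) (gradient (fun x => (1 / 2) * (f x + f (reflect k x))) x))
    (h2 : ∃ c : ℝ, ∫⁻ x, ENNReal.ofReal (Real.exp (-V x)) *
        ENNReal.ofReal (((1 / 2) * (f x + -f (reflect k x)) - c) ^ 2) ≤
      C * ∫⁻ x, ENNReal.ofReal (Real.exp (-V x)) *
        invForm (hess V x) (gradient (fun x => (1 / 2) * (f x + -f (reflect k x))) x)) :
    ∃ c : ℝ, ∫⁻ x, ENNReal.ofReal (Real.exp (-V x)) * ENNReal.ofReal ((f x - c) ^ 2) ≤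
      C * ∫⁻ x, ENNReal.ofReal (Real.exp (-V x)) * invForm (hess V x) (gradient f x) := by
  have hn : n ≠ 0 := by rintro rfl; exact k.elim0
  obtain ⟨c, hc⟩ := h1
  obtain ⟨c', hc'⟩ := h2
  refine ⟨c, ?_⟩
  have cV := hV.continuous
  have cf := hf.continuous
  have hVk : ∀ x, V (reflect k x) = V x := hV.flip_eq _
  have cr : Continuous (reflect k : Rn n → Rn n) := (reflect k).continuous
  have cfr : Continuous fun x => f (reflect k x) := cf.comp cr
  have inv : ∀ F : Rn n → ℝ≥0∞, ∫⁻ x, F (reflect k x) = ∫⁻ x, F x := fun F =>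
    (reflect k).measurePreserving.lintegral_comp_emb
      (reflect k).toHomeomorph.measurableEmbedding F
  set w : Rn n → ℝ≥0∞ := fun x => ENNReal.ofReal (Real.exp (-V x)) with hw
  have mw : Measurable w := by fun_prop
  have hwk : ∀ x, w (reflect k x) = w x := fun x => by simp only [hw, hVk]
  -- For the odd part the constant `0` is at least as good as `c'`: averaging over the reflection
  -- replaces the integrand by the square plus `c'²`.
  have hodd : ∫⁻ x, w x * ENNReal.ofReal (((1 / 2) * (f x + -f (reflect k x))) ^ 2) ≤
      ∫⁻ x, w x * ENNReal.ofReal (((1 / 2) * (f x + -f (reflect k x)) - c') ^ 2) := by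
    rw [← ENNReal.mul_le_mul_iff_right two_ne_zero ENNReal.ofNat_ne_top,
      two_mul (∫⁻ x, w x * ENNReal.ofReal (((1 / 2) * (f x + -f (reflect k x)) - c') ^ 2))]
    nth_rw 2 [← inv fun x => w x *
      ENNReal.ofReal (((1 / 2) * (f x + -f (reflect k x)) - c') ^ 2)]
    rw [← lintegral_add_left (by fun_prop), ← lintegral_const_mul' _ _ ENNReal.ofNat_ne_top]
    refine lintegral_mono fun x => ?_
    simp only [hwk, reflect_reflect]
    rw [← mul_add, ← ENNReal.ofReal_add (sq_nonneg _) (sq_nonneg _), mul_left_comm,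
      two_mul_ofReal]
    gcongr
    nlinarith [sq_nonneg c']
  -- Averaging over the reflection cancels the product of the even and the odd part.
  have hsq : 2 * (∫⁻ x, w x * ENNReal.ofReal ((f x - c) ^ 2)) =
      2 * ((∫⁻ x, w x * ENNReal.ofReal (((1 / 2) * (f x + f (reflect k x)) - c) ^ 2)) +
        ∫⁻ x, w x * ENNReal.ofReal (((1 / 2) * (f x + -f (reflect k x))) ^ 2)) := by
    rw [two_mul (∫⁻ x, w x * ENNReal.ofReal ((f x - c) ^ 2))]
    nth_rw 2 [← inv]
    rw [← lintegral_add_left (by fun_prop), ← lintegral_add_left (by fun_prop),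
      ← lintegral_const_mul' _ _ ENNReal.ofNat_ne_top]
    refine lintegral_congr fun x => ?_
    rw [hwk, ← mul_add, ← mul_add, ← ENNReal.ofReal_add (sq_nonneg _) (sq_nonneg _),
      ← ENNReal.ofReal_add (sq_nonneg _) (sq_nonneg _), mul_left_comm,
      two_mul_ofReal]
    congr 2
    ring
  -- The same cancellation for the energy, by the parallelogram law for the inverse form at almost
  -- every point.
  have hen : 2 * ((∫⁻ x, w x * invForm (hess V x)
        (gradient (fun x => (1 / 2) * (f x + f (reflect k x))) x)) +
      ∫⁻ x, w x * invForm (hess V x)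
        (gradient (fun x => (1 / 2) * (f x + -f (reflect k x))) x)) ≤
      2 * ∫⁻ x, w x * invForm (hess V x) (gradient f x) := by
    rw [two_mul (∫⁻ x, w x * invForm (hess V x) (gradient f x))]
    nth_rw 2 [← inv fun x => w x * invForm (hess V x) (gradient f x)]
    rw [← lintegral_add_left' (hV.aemeasurable_energy hpos hn hf)]
    refine (mul_le_mul_right (le_lintegral_add _ _) 2).trans ?_
    rw [← lintegral_const_mul' _ _ ENNReal.ofNat_ne_top]
    refine lintegral_mono_ae ?_
    filter_upwards [ae_coord_ne_zero n] with x hx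
    have d1 : DifferentiableAt ℝ f x := hf.differentiable (by norm_num) x
    have d2 : DifferentiableAt ℝ (fun y => f (reflect k y)) x :=
      (hf.differentiable (by norm_num) _).comp x (reflect k).differentiableAt
    rw [hwk, invForm_comp_isometry (reflect k) hVk, ← mul_add, ← mul_add, mul_left_comm,
      gradient_half_add d1 d2, gradient_half_add d1 d2.fun_neg, gradient_neg,
      invForm_half_add (hpos x hx)]
  rw [← ENNReal.mul_le_mul_iff_right two_ne_zero ENNReal.ofNat_ne_top, hsq]
  calc _ ≤ 2 * (C * _ + C * _) := mul_le_mul_right (add_le_add hc (hodd.trans hc')) 2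
    _ = C * (2 * (_ + _)) := by rw [← mul_add C, mul_left_comm]
    _ ≤ C * (2 * _) := mul_le_mul_right hen C
    _ = _ := mul_left_comm _ _ _

/-- The inequality for even functions that are even or odd in each of the coordinates. -/
theorem exists_const_of_parity (hVconc : ConcaveOn ℝ (orthant n) fun x => V (coordPow (1 / p) x))
    (H : ∀ (i : Fin n) (x' : Rn n), x' i = 0 → AntitoneOn (fun t : ℝ =>
      detHess (legendre V) (x' + t • EuclideanSpace.single i (1 : ℝ))) (Ici 0))
    {f : Rn n → ℝ} (hf : ContDiff ℝ 1 f) (heven : ∀ x, f (-x) = f x) {ε : Fin n → ℝ}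
    (hε : ∀ k, ε k = 1 ∨ ε k = -1) (hpar : ∀ k x, f (reflect k x) = ε k * f x) :
    ∃ c : ℝ, ∫⁻ x, ENNReal.ofReal (Real.exp (-V x)) * ENNReal.ofReal ((f x - c) ^ 2) ≤
      ENNReal.ofReal (1 - 1 / p) *
        ∫⁻ x, ENNReal.ofReal (Real.exp (-V x)) * invForm (hess V x) (gradient f x) := by
  have hflip := apply_flip_of_parity hpar
  have hs : ∀ s : Fin n → Bool, s = fun i => decide (i ∈ Finset.univ.filter fun i => s i) :=
    fun s => by ext i; simp
  by_cases hu : IsUnconditional f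
  · exact hV.exists_const_of_unconditional hVconc hf hu
  have hodd : ∃ i, ε i = -1 := by
    by_contra! h
    refine hu fun s hs x => ?_
    have h1 := hflip (Finset.univ.filter fun i => s i = -1) x
    rw [Finset.prod_eq_one fun k _ => (hε k).resolve_right (h k), one_mul] at h1
    rw [← h1]
    congr 1
    ext i
    rw [flip_apply]
    rcases hs i with h2 | h2 <;> norm_num [h2]
  obtain ⟨i, hi⟩ := hodd
  -- Reflecting in all coordinates gives `-x`. If `i` were the only odd coordinate, `f` would be odd
  -- as well as even, hence zero and unconditional.
  obtain ⟨j, hij, hj⟩ : ∃ j, j ≠ i ∧ ε j = -1 := by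
    by_contra! h
    refine hu ?_
    have h0 : ∀ x, f x = 0 := by
      intro x
      have h1 := hflip Finset.univ x
      rw [Finset.prod_eq_single i (fun k _ hk => (hε k).resolve_right (h k hk))
        (fun h' => absurd (Finset.mem_univ i) h'), hi] at h1
      have h2 : flip (fun i => decide (i ∈ Finset.univ)) x = -x := by
        ext k; simp [flip_apply]
      rw [h2, heven] at h1
      linarith
    intro s _ x
    rw [h0, h0]
  have hzero : ∀ k, ε k = -1 → ∀ x : Rn n, x k = 0 → f x = 0 := by
    intro k hk x hx
    have h1 := hpar k x
    have h2 : reflect k x = x := by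
      ext l
      rw [reflect_apply]
      split_ifs with h
      · rw [h, hx, neg_zero]
      · rfl
    rw [h2, hk] at h1
    linarith
  have hsign : ∀ s : Fin n → Bool, (∀ x, f (flip s x) = f x) ∨ ∀ x, f (flip s x) = -f x := by
    intro s
    have h1 := hflip (Finset.univ.filter fun i => s i)
    rw [← hs s] at h1
    have h2 : (∏ k ∈ Finset.univ.filter fun i => s i, ε k) ^ 2 = 1 := by
      rw [← Finset.prod_pow]
      refine Finset.prod_eq_one fun k _ => ?_
      rcases hε k with h | h <;> rw [h] <;> norm_num
    rcases mul_self_eq_one_iff.1 ((sq _).symm.trans h2) with h3 | h3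
    · exact Or.inl fun x => by rw [h1, h3, one_mul]
    · exact Or.inr fun x => by rw [h1, h3, neg_one_mul]
  -- Both integrands are invariant under sign changes, since `f` changes at most by a sign; the
  -- problem reduces to the open orthant.
  refine ⟨0, ?_⟩
  simp only [sub_zero]
  rw [lintegral_of_flip_invariant, lintegral_of_flip_invariant (fun x => _ * invForm _ _),
    mul_left_comm]
  · gcongr
    refine le_trans (le_of_eq ?_) (hV.lintegral_sq_le_of_odd_odd hij.symm H hf (hzero i hi)
      (hzero j hj))
    refine lintegral_congr fun x => ?_
    rw [mul_comm, ENNReal.ofReal_mul (sq_nonneg _)]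
  · intro s x
    rw [hV.flip_eq, invForm_comp_isometry (flip s) (hV.flip_eq s)]
    rcases hsign s with h | h
    · simp only [h]
    · simp only [h, gradient_neg, invForm_neg]
  · intro s x
    rw [hV.flip_eq]
    rcases hsign s with h | h
    · rw [h]
    · rw [h, neg_sq]

/-- The inequality for even functions. -/
theorem exists_const_of_even (hVconc : ConcaveOn ℝ (orthant n) fun x => V (coordPow (1 / p) x))
    (H : ∀ (i : Fin n) (x' : Rn n), x' i = 0 → AntitoneOn (fun t : ℝ =>
      detHess (legendre V) (x' + t • EuclideanSpace.single i (1 : ℝ))) (Ici 0))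
    {f : Rn n → ℝ} (hf : ContDiff ℝ 1 f) (heven : ∀ x, f (-x) = f x) :
    ∃ c : ℝ, ∫⁻ x, ENNReal.ofReal (Real.exp (-V x)) * ENNReal.ofReal ((f x - c) ^ 2) ≤
      ENNReal.ofReal (1 - 1 / p) *
        ∫⁻ x, ENNReal.ofReal (Real.exp (-V x)) * invForm (hess V x) (gradient f x) := by
  -- Induction on the set `S` of coordinates in which the parity is still undetermined; splitting in
  -- the coordinate `a` fixes its parity and preserves those already fixed.
  suffices h : ∀ (S : Finset (Fin n)) (f : Rn n → ℝ), ContDiff ℝ 1 f → (∀ x, f (-x) = f x) →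
      (∀ k ∉ S, ∃ ε : ℝ, (ε = 1 ∨ ε = -1) ∧ ∀ x, f (reflect k x) = ε * f x) →
      ∃ c : ℝ, ∫⁻ x, ENNReal.ofReal (Real.exp (-V x)) * ENNReal.ofReal ((f x - c) ^ 2) ≤
        ENNReal.ofReal (1 - 1 / p) *
          ∫⁻ x, ENNReal.ofReal (Real.exp (-V x)) * invForm (hess V x) (gradient f x) from
    h Finset.univ f hf heven fun k hk => absurd (Finset.mem_univ k) hk
  intro S
  induction S using Finset.induction_on with
  | empty =>
    intro f hf heven hpar
    choose ε hε hpar using fun k => hpar k (Finset.notMem_empty k)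
    exact hV.exists_const_of_parity hVconc H hf heven hε hpar
  | insert a S ha ih =>
    intro f hf heven hpar
    have hn : n ≠ 0 := by rintro rfl; exact a.elim0
    have cr : ContDiff ℝ 1 fun x => f (reflect a x) := hf.comp (reflect a).contDiff
    have step : ∀ δ : ℝ, (δ = 1 ∨ δ = -1) → ∀ k ∉ S, ∃ ε : ℝ, (ε = 1 ∨ ε = -1) ∧
        ∀ x, (1 / 2) * (f (reflect k x) + δ * f (reflect a (reflect k x))) =
          ε * ((1 / 2) * (f x + δ * f (reflect a x))) := by
      intro δ hδ k hk
      by_cases hka : k = a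
      · subst hka
        refine ⟨δ, hδ, fun x => ?_⟩
        rw [reflect_reflect]
        rcases hδ with rfl | rfl <;> ring
      · obtain ⟨ε, hε, h⟩ := hpar k (by simp [hka, hk])
        refine ⟨ε, hε, fun x => ?_⟩
        rw [reflect_comm, h, h]
        ring
    refine hV.exists_const_of_parts (fun x hx => hV.inner_hess_pos_of_antitone H hn hx) a hf
      (ih _ ?_ (fun x => ?_) ?_) (ih _ ?_ (fun x => ?_) ?_)
    · exact contDiff_const.mul (hf.add cr)
    · simp only [map_neg, heven]
    · simpa only [one_mul] using step 1 (Or.inl rfl)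
    · exact contDiff_const.mul (hf.add cr.neg)
    · simp only [map_neg, heven]
    · simpa only [neg_one_mul] using step (-1) (Or.inr rfl)

end IsPotential

end StrongBL

end

theorem mainTheorem7 (n : ℕ) (p : ℝ) (hp : 1 < p) (V : StrongBL.Rn n → ℝ)
    (hVeven : ∀ x, V (-x) = V x)
    (hVconv : StrictConvexOn ℝ Set.univ V)
    (hVhom : StrongBL.IsHomogeneousOfDegree p V)
    (hVreg : ContDiffOn ℝ 2 V {0}ᶜ)
    (hVunc : StrongBL.IsUnconditional V)
    (hVconc : ConcaveOn ℝ (StrongBL.orthant n) fun x => V (StrongBL.coordPow (1 / p) x)) :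
    IsProbabilityMeasure (StrongBL.gibbs V) ∧
    (∀ f : StrongBL.Rn n → ℝ, ContDiff ℝ 1 f → StrongBL.IsUnconditional f →
      StrongBL.StrongBrascampLieb p V f) ∧
    ((∀ (i : Fin n) (x' : StrongBL.Rn n), x' i = 0 →
        AntitoneOn (fun t : ℝ =>
          StrongBL.detHess (StrongBL.legendre V) (x' + t • EuclideanSpace.single i (1 : ℝ)))
          (Set.Ici 0)) →
      ∀ f : StrongBL.Rn n → ℝ, ContDiff ℝ 1 f → (∀ x, f (-x) = f x) →
        StrongBL.StrongBrascampLieb p V f) := by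
  have hV : StrongBL.IsPotential p V := ⟨hp, hVeven, hVconv, hVhom, hVreg, hVunc⟩
  exact ⟨hV.isProbabilityMeasure_gibbs,
    fun f hf hfu => hV.strongBrascampLieb_of_exists_const hf.continuous
      (hV.exists_const_of_unconditional hVconc hf hfu),
    fun H f hf heven => hV.strongBrascampLieb_of_exists_const hf.continuous
      (hV.exists_const_of_even hVconc H hf heven)⟩
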